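/- Let $\Omega\subset\mathbb{C}^n$ be a bounded pseudoconvex domain with smooth boundary, and let $r$ be a smooth defining function of $\Omega$ (smooth in a neighbourhood $U$ of $\overline\Omega$, $\Omega=\{z\in U: r(z)<0\}$, $dr\neq 0$ on $b\Omega$) which is plurisubharmonic on $\Omega$. Let $\mathcal{L}=\left[\frac{\partial^2 r}{\partial z_j\partial\overline z_k}\right]_{1\le j,k\le n}$ be its complex Hessian matrix, acting on a $(0,1)$-form $u=\sum_{j=1}^n u_j\,d\overline z_j$ in the way that corresponds to the Hermitian form $(\mathcal{L}u,u)=\sum_{j,k}\frac{\partial^2 r}{\partial z_j\partial\overline z_k}u_j\overline{u_k}$, that is, $(\mathcal{L}u)_k=\sum_{j=1}^n\frac{\partial^2 r}{\partial z_j\partial\overline z_k}u_j$ (the transpose of the array above is applied to the column of coefficients of $u$). Then $\mathcal{L}$ is an allowable matrix for compactness estimates: its entries are smooth on a neighbourhood of $\overline\Omega$, and for every $\varepsilon>0$ there is a constant $C_\varepsilon>0$ such that $$\|\mathcal{L}u\|^2=\sum_{k=1}^n\Big\|\sum_{j=1}^n\frac{\partial^2 r}{\partial z_j\partial\overline z_k}u_j\Big\|^2_{L^2(\Omega)}\le\varepsilon\left(\|\overline\partial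 u\|^2+\|\overline\partial^*u\|^2\right)+C_\varepsilon\|u\|_{-1}^2$$ for all $u\in \mathrm{Dom}(\overline\partial)\cap\mathrm{Dom}(\overline\partial^*)\subset L^2_{(0,1)}(\Omega)$. Here $\overline\partial$ is the maximal (distributional) operator on $L^2$ forms, $\overline\partial^*$ is the Hilbert space adjoint of $\overline\partial:L^2(\Omega)\to L^2_{(0,1)}(\Omega)$, and $\|\cdot\|_{-1}$ is the norm of $W^{-1}(\Omega)$, the dual of $W^1_0(\Omega)$, taken coefficientwise. -/

import Mathlib

open MeasureTheory
open scoped ContDiff ComplexConjugate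

noncomputable section

/-- The space `ℂⁿ`, with its Euclidean norm and Lebesgue measure. -/
abbrev Cn (n : ℕ) : Type := EuclideanSpace ℂ (Fin n)

/-! ### Wirtinger derivatives, complex Hessian, domains -/

/-- `∂f/∂z_j = ½ (∂f/∂x_j - i ∂f/∂y_j)`, where `z_j = x_j + i y_j`. -/
def dz {n : ℕ} (j : Fin n) (f : Cn n → ℂ) (z : Cn n) : ℂ :=
  (1 / 2) * (fderiv ℝ f z (EuclideanSpace.single j 1)
    - Complex.I * fderiv ℝ f z (EuclideanSpace.single j Complex.I))

/-- `∂f/∂z̄_j = ½ (∂f/∂x_j + i ∂f/∂y_j)`. -/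
def dzbar {n : ℕ} (j : Fin n) (f : Cn n → ℂ) (z : Cn n) : ℂ :=
  (1 / 2) * (fderiv ℝ f z (EuclideanSpace.single j 1)
    + Complex.I * fderiv ℝ f z (EuclideanSpace.single j Complex.I))

/-- The complex Hessian matrix `ℒ = [∂²r / ∂z_i ∂z̄_j]`, row index `i`, column index `j`. -/
def complexHessian {n : ℕ} (r : Cn n → ℝ) (z : Cn n) : Matrix (Fin n) (Fin n) ℂ :=
  Matrix.of fun i j => dz i (dzbar j (fun w => (r w : ℂ))) z

/-- The Levi form `∑_{j,k} ∂²r/∂z_j∂z̄_k (z) ξ_j conj(ξ_k)`; it is real for `r` of class `C²`. -/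
def leviForm {n : ℕ} (r : Cn n → ℝ) (z : Cn n) (ξ : Fin n → ℂ) : ℝ :=
  (∑ j, ∑ k, complexHessian r z j k * ξ j * conj (ξ k)).re

/-- A function of class `C²` is plurisubharmonic on `S` when its Levi form is positive semidefinite
at every point of `S`. -/
def IsPlurisubharmonicOn {n : ℕ} (r : Cn n → ℝ) (S : Set (Cn n)) : Prop :=
  ∀ z ∈ S, ∀ ξ : Fin n → ℂ, 0 ≤ leviForm r z ξ

/-- `r` is a smooth defining function of `Ω`: it is smooth in a neighbourhood `U` of the closure
of `Ω`, `Ω = {z ∈ U : r z < 0}`, and the differential of `r` has no zero on the boundary. -/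
def IsSmoothDefiningFunction {n : ℕ} (Ω : Set (Cn n)) (r : Cn n → ℝ) : Prop :=
  (∃ U : Set (Cn n), IsOpen U ∧ closure Ω ⊆ U ∧ ContDiffOn ℝ ∞ r U ∧ Ω = {z ∈ U | r z < 0}) ∧
  ∀ z ∈ frontier Ω, fderiv ℝ r z ≠ 0

/-- Bounded (Levi) pseudoconvex domains in `ℂⁿ` with smooth boundary. -/
structure IsSmoothBoundedPseudoconvexDomain {n : ℕ} (Ω : Set (Cn n)) : Prop where
  isOpen : IsOpen Ω
  isConnected : IsConnected Ω
  isBounded : Bornology.IsBounded Ω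
  /-- The Levi form of some smooth defining function is nonnegative on the complex tangent space
  of the boundary. -/
  levi : ∃ ρ : Cn n → ℝ, IsSmoothDefiningFunction Ω ρ ∧
    ∀ p ∈ frontier Ω, ∀ ξ : Fin n → ℂ,
      ∑ j, dz j (fun w => (ρ w : ℂ)) p * ξ j = 0 → 0 ≤ leviForm ρ p ξ

/-! ### Square-integrable forms and the operators `∂̄`, `∂̄*` -/

/-- Smooth functions with compact support in `Ω`. -/
def IsTest {n : ℕ} (Ω : Set (Cn n)) (φ : Cn n → ℂ) : Prop :=
  ContDiff ℝ ∞ φ ∧ HasCompactSupport φ ∧ tsupport φ ⊆ Ω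

/-- `L²(Ω)`. -/
abbrev L2 {n : ℕ} (Ω : Set (Cn n)) : Type := Lp ℂ 2 (volume.restrict Ω)

/-- `L²_{(0,1)}(Ω)`: the form `∑_k u_k dz̄_k` is given by its coefficients, and
`‖u‖² = ∑_k ‖u_k‖²`. -/
abbrev L2Form1 {n : ℕ} (Ω : Set (Cn n)) : Type := PiLp 2 fun _ : Fin n => L2 Ω

/-- `L²_{(0,2)}(Ω)`: the form `∑_{j<k} α_{jk} dz̄_j ∧ dz̄_k` is given by its coefficients. -/
abbrev L2Form2 {n : ℕ} (Ω : Set (Cn n)) : Type :=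
  PiLp 2 fun _ : {p : Fin n × Fin n // p.1 < p.2} => L2 Ω

lemma fderiv_apply_test {n : ℕ} {Ω : Set (Cn n)} {φ : Cn n → ℂ} (h : IsTest Ω φ) (v : Cn n) :
    IsTest Ω (fun z => fderiv ℝ φ z v) := by
  refine ⟨?_, ?_, ?_⟩
  · exact (h.1.fderiv_right (m := ∞) (by simp)).clm_apply contDiff_const
  · exact h.2.1.fderiv_apply ℝ v
  · exact (tsupport_fderiv_apply_subset ℝ v).trans h.2.2

lemma IsTest.wirtinger {n : ℕ} {Ω : Set (Cn n)} {φ : Cn n → ℂ} (h : IsTest Ω φ) (j : Fin n) :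
    IsTest Ω (dzbar j φ) := by
  have h1 := fderiv_apply_test h (EuclideanSpace.single j 1)
  have h2 := fderiv_apply_test h (EuclideanSpace.single j Complex.I)
  have hs : tsupport (dzbar j φ) ⊆ tsupport φ := by
    refine closure_minimal (fun z hz => ?_) (isClosed_tsupport _)
    by_contra hz'
    have h0 : fderiv ℝ φ z = 0 := by
      by_contra hne
      exact hz' (support_fderiv_subset ℝ hne)
    exact hz (by simp [dzbar, h0])
  refine ⟨?_, ?_, hs.trans h.2.2⟩
  · exact contDiff_const.mul (h1.1.add (contDiff_const.mul h2.1))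
  · exact h.2.1.isCompact.of_isClosed_subset (isClosed_tsupport _) hs

lemma IsTest.memLp {n : ℕ} {Ω : Set (Cn n)} {φ : Cn n → ℂ} (h : IsTest Ω φ) :
    MemLp φ 2 (volume.restrict Ω) :=
  (h.1.continuous.memLp_of_hasCompactSupport h.2.1).restrict Ω

lemma IsTest.integrable_mul {n : ℕ} {Ω : Set (Cn n)} {φ : Cn n → ℂ} (h : IsTest Ω φ)
    (f : L2 Ω) : Integrable (fun z => f z * φ z) (volume.restrict Ω) :=
  (Lp.memLp f).integrable_mul h.memLp

lemma L2.integral_add_mul {n : ℕ} {Ω : Set (Cn n)} {φ : Cn n → ℂ} (h : IsTest Ω φ) (f g : L2 Ω) :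
    ∫ z in Ω, (f + g : L2 Ω) z * φ z = (∫ z in Ω, f z * φ z) + ∫ z in Ω, g z * φ z := by
  rw [← integral_add (h.integrable_mul f) (h.integrable_mul g)]
  refine integral_congr_ae ?_
  filter_upwards [Lp.coeFn_add f g] with z hz
  rw [hz, Pi.add_apply, add_mul]

lemma L2.integral_smul_mul {n : ℕ} {Ω : Set (Cn n)} (φ : Cn n → ℂ) (c : ℂ) (f : L2 Ω) :
    ∫ z in Ω, (c • f : L2 Ω) z * φ z = c * ∫ z in Ω, f z * φ z := by
  rw [← integral_const_mul]
  refine integral_congr_ae ?_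
  filter_upwards [Lp.coeFn_smul c f] with z hz
  simp [hz, mul_assoc]

lemma L2.integral_zero_mul {n : ℕ} {Ω : Set (Cn n)} (φ : Cn n → ℂ) :
    ∫ z in Ω, (0 : L2 Ω) z * φ z = 0 := by
  simpa using L2.integral_smul_mul φ 0 (0 : L2 Ω)

/-- The graph of `∂̄` on functions: the pairs `(f, β)` in `L²(Ω) × L²_{(0,1)}(Ω)` such that
`∂f/∂z̄_j = β_j` for all `j` in the sense of distributions on `Ω`. -/
def dbar0Graph {n : ℕ} (Ω : Set (Cn n)) : Submodule ℂ (L2 Ω × L2Form1 Ω) where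
  carrier := {p | ∀ j : Fin n, ∀ φ, IsTest Ω φ →
    ∫ z in Ω, p.1 z * dzbar j φ z = -∫ z in Ω, p.2 j z * φ z}
  add_mem' {p q} hp hq j φ h := by
    have h1 := L2.integral_add_mul (h.wirtinger j) p.1 q.1
    have h2 := L2.integral_add_mul h (p.2 j) (q.2 j)
    simp only [Prod.fst_add, Prod.snd_add, PiLp.add_apply]
    rw [h1, h2, hp j φ h, hq j φ h]; ring
  zero_mem' j φ h := by
    have h1 := L2.integral_zero_mul (Ω := Ω) (dzbar j φ)
    have h2 := L2.integral_zero_mul (Ω := Ω) φ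
    simp only [Prod.fst_zero, Prod.snd_zero, PiLp.zero_apply]
    rw [h1, h2, neg_zero]
  smul_mem' c p hp j φ h := by
    have h1 := L2.integral_smul_mul (dzbar j φ) c p.1
    have h2 := L2.integral_smul_mul φ c (p.2 j)
    simp only [Prod.smul_fst, Prod.smul_snd, PiLp.smul_apply]
    rw [h1, h2, hp j φ h]; ring

/-- The graph of `∂̄` on `(0,1)`-forms: the pairs `(u, α)` in `L²_{(0,1)}(Ω) × L²_{(0,2)}(Ω)` such
that `∂u_k/∂z̄_j - ∂u_j/∂z̄_k = α_{jk}` for all `j < k` in the sense of distributions on `Ω`. -/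
def dbar1Graph {n : ℕ} (Ω : Set (Cn n)) : Submodule ℂ (L2Form1 Ω × L2Form2 Ω) where
  carrier := {p | ∀ i : {i : Fin n × Fin n // i.1 < i.2}, ∀ φ, IsTest Ω φ →
    (∫ z in Ω, p.1 i.1.2 z * dzbar i.1.1 φ z) - ∫ z in Ω, p.1 i.1.1 z * dzbar i.1.2 φ z
      = -∫ z in Ω, p.2 i z * φ z}
  add_mem' {p q} hp hq i φ h := by
    have h1 := L2.integral_add_mul (h.wirtinger i.1.1) (p.1 i.1.2) (q.1 i.1.2)
    have h1' := L2.integral_add_mul (h.wirtinger i.1.2) (p.1 i.1.1) (q.1 i.1.1)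
    have h2 := L2.integral_add_mul h (p.2 i) (q.2 i)
    have h3 := hp i φ h
    have h4 := hq i φ h
    simp only [Prod.fst_add, Prod.snd_add, PiLp.add_apply]
    rw [h1, h1', h2]; linear_combination h3 + h4
  zero_mem' i φ h := by
    have h1 := L2.integral_zero_mul (Ω := Ω) (dzbar i.1.1 φ)
    have h1' := L2.integral_zero_mul (Ω := Ω) (dzbar i.1.2 φ)
    have h2 := L2.integral_zero_mul (Ω := Ω) φ
    simp only [Prod.fst_zero, Prod.snd_zero, PiLp.zero_apply]
    rw [h1, h1', h2]; simp
  smul_mem' c p hp i φ h := by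
    have h1 := L2.integral_smul_mul (dzbar i.1.1 φ) c (p.1 i.1.2)
    have h1' := L2.integral_smul_mul (dzbar i.1.2 φ) c (p.1 i.1.1)
    have h2 := L2.integral_smul_mul φ c (p.2 i)
    have h3 := hp i φ h
    simp only [Prod.smul_fst, Prod.smul_snd, PiLp.smul_apply]
    rw [h1, h1', h2]; linear_combination c * h3

/-- The maximal (weak) operator `∂̄ : L²(Ω) → L²_{(0,1)}(Ω)`. -/
def dbar0 {n : ℕ} (Ω : Set (Cn n)) : L2 Ω →ₗ.[ℂ] L2Form1 Ω := (dbar0Graph Ω).toLinearPMap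

/-- The maximal (weak) operator `∂̄ : L²_{(0,1)}(Ω) → L²_{(0,2)}(Ω)`. -/
def dbar1 {n : ℕ} (Ω : Set (Cn n)) : L2Form1 Ω →ₗ.[ℂ] L2Form2 Ω := (dbar1Graph Ω).toLinearPMap

/-- `∂̄* : L²_{(0,1)}(Ω) → L²(Ω)`, the Hilbert space adjoint of `∂̄` on functions. -/
def dbarStar {n : ℕ} (Ω : Set (Cn n)) : L2Form1 Ω →ₗ.[ℂ] L2 Ω := (dbar0 Ω).adjoint

/-- An element of `L²(Ω)` that annihilates all test functions vanishes. -/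
lemma L2.eq_zero_of_test {n : ℕ} {Ω : Set (Cn n)} (hΩ : IsOpen Ω) (f : L2 Ω)
    (h : ∀ φ, IsTest Ω φ → ∫ z in Ω, f z * φ z = 0) : f = 0 := by
  have hloc : LocallyIntegrableOn (f : Cn n → ℂ) Ω volume := by
    rw [locallyIntegrableOn_iff hΩ.isLocallyClosed]
    intro k hk hkc
    have : MemLp f 2 (volume.restrict k) :=
      (Lp.memLp f).mono_measure (Measure.restrict_mono hk le_rfl)
    have hfin : IsFiniteMeasure (volume.restrict k : Measure (Cn n)) :=
      ⟨by simpa using hkc.measure_lt_top⟩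
    exact this.integrable (by norm_num)
  have key := hΩ.ae_eq_zero_of_integral_contDiff_smul_eq_zero (μ := volume) hloc ?_
  · refine (Lp.eq_zero_iff_ae_eq_zero).2 ?_
    exact (ae_restrict_iff' hΩ.measurableSet).2 key
  · intro g hg hgc hgs
    have hsub : tsupport (fun z => (g z : ℂ)) ⊆ tsupport g :=
      closure_mono fun z hz hz' => hz (by simp [hz'])
    have ht : IsTest Ω (fun z => (g z : ℂ)) :=
      ⟨Complex.ofRealCLM.contDiff.comp hg,
        hgc.isCompact.of_isClosed_subset (isClosed_tsupport _) hsub, hsub.trans hgs⟩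
    rw [← h _ ht, ← setIntegral_eq_integral_of_forall_compl_eq_zero (s := Ω)]
    · simp [mul_comm]
    · intro z hz
      have : g z = 0 := image_eq_zero_of_notMem_tsupport fun h' => hz (hgs h')
      simp [this]

/-- The graph of `dbar0` is the prescribed one. -/
theorem dbar0_graph {n : ℕ} {Ω : Set (Cn n)} (hΩ : IsOpen Ω) :
    (dbar0 Ω).graph = dbar0Graph Ω := by
  refine Submodule.toLinearPMap_graph_eq _ ?_
  rintro ⟨f, β⟩ hp hf
  obtain rfl : f = 0 := hf
  ext1 j
  refine L2.eq_zero_of_test hΩ _ fun φ h => ?_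
  have h1 : ∫ z in Ω, (0 : L2 Ω) z * dzbar j φ z = -∫ z in Ω, β j z * φ z := hp j φ h
  rw [L2.integral_zero_mul] at h1
  exact neg_eq_zero.1 h1.symm

lemma IsTest.integral_dzbar {n : ℕ} {Ω : Set (Cn n)} {φ ψ : Cn n → ℂ} (hφ : IsTest Ω φ)
    (hψ : IsTest Ω ψ) (j : Fin n) :
    ∫ z in Ω, φ z * dzbar j ψ z = -∫ z in Ω, dzbar j φ z * ψ z := by
  have hint : ∀ {a b : Cn n → ℂ}, IsTest Ω a → IsTest Ω b →
      Integrable (fun z => a z * b z) (volume : Measure (Cn n)) := fun {a b} ha hb =>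
    (ha.1.continuous.mul hb.1.continuous).integrable_of_hasCompactSupport (ha.2.1.mul_right)
  have hres : ∀ {a b : Cn n → ℂ}, IsTest Ω a →
      ∫ z in Ω, a z * b z = ∫ z, a z * b z := fun {a b} ha =>
    setIntegral_eq_integral_of_forall_compl_eq_zero fun z hz => by
      simp [image_eq_zero_of_notMem_tsupport fun h' => hz (ha.2.2 h')]
  have hv : ∀ v : Cn n, ∫ z, φ z * fderiv ℝ ψ z v = -∫ z, fderiv ℝ φ z v * ψ z := fun v =>
    integral_mul_fderiv_eq_neg_fderiv_mul_of_integrable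
      (hint (fderiv_apply_test hφ v) hψ) (hint hφ (fderiv_apply_test hψ v)) (hint hφ hψ)
      (fun z _ => hφ.1.differentiable (by simp) z) (fun z _ => hψ.1.differentiable (by simp) z)
  rw [hres hφ, hres (hφ.wirtinger j)]
  have e1 : ∀ z, φ z * dzbar j ψ z = (1 / 2) * (φ z * fderiv ℝ ψ z (EuclideanSpace.single j 1))
      + (Complex.I / 2) * (φ z * fderiv ℝ ψ z (EuclideanSpace.single j Complex.I)) := fun z => by
    simp only [dzbar]; ring
  have e2 : ∀ z, dzbar j φ z * ψ z = (1 / 2) * (fderiv ℝ φ z (EuclideanSpace.single j 1) * ψ z)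
      + (Complex.I / 2) * (fderiv ℝ φ z (EuclideanSpace.single j Complex.I) * ψ z) := fun z => by
    simp only [dzbar]; ring
  simp only [e1, e2]
  rw [integral_add ((hint hφ (fderiv_apply_test hψ _)).const_mul _)
      ((hint hφ (fderiv_apply_test hψ _)).const_mul _),
    integral_add ((hint (fderiv_apply_test hφ _) hψ).const_mul _)
      ((hint (fderiv_apply_test hφ _) hψ).const_mul _)]
  simp only [integral_const_mul, hv]
  ring

/-- Test functions belong to the domain of `∂̄`. -/
lemma IsTest.toLp_mem_domain {n : ℕ} {Ω : Set (Cn n)} {φ : Cn n → ℂ} (h : IsTest Ω φ) :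
    h.memLp.toLp φ ∈ (dbar0 Ω).domain := by
  refine Submodule.mem_map.2
    ⟨(h.memLp.toLp φ, WithLp.toLp 2 fun j => (h.wirtinger j).memLp.toLp (dzbar j φ)), ?_, rfl⟩
  intro j ψ hψ
  have h1 : ∫ z in Ω, (h.memLp.toLp φ) z * dzbar j ψ z = ∫ z in Ω, φ z * dzbar j ψ z :=
    integral_congr_ae (by filter_upwards [h.memLp.coeFn_toLp] with z hz; rw [hz])
  have h2 : ∫ z in Ω, ((h.wirtinger j).memLp.toLp (dzbar j φ)) z * ψ z
      = ∫ z in Ω, dzbar j φ z * ψ z :=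
    integral_congr_ae (by filter_upwards [(h.wirtinger j).memLp.coeFn_toLp] with z hz; rw [hz])
  change ∫ z in Ω, (h.memLp.toLp φ) z * dzbar j ψ z
    = -∫ z in Ω, ((h.wirtinger j).memLp.toLp (dzbar j φ)) z * ψ z
  rw [h1, h2, h.integral_dzbar hψ j]

/-- `∂̄` is densely defined, so `dbarStar` is a genuine adjoint. -/
theorem dbar0_dense {n : ℕ} {Ω : Set (Cn n)} (hΩ : IsOpen Ω) :
    Dense ((dbar0 Ω).domain : Set (L2 Ω)) := by
  rw [Submodule.dense_iff_topologicalClosure_eq_top, Submodule.topologicalClosure_eq_top_iff,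
    Submodule.eq_bot_iff]
  intro f hf
  refine L2.eq_zero_of_test hΩ f fun φ h => ?_
  have hc : IsTest Ω (fun z => conj (φ z)) := by
    have hsub : tsupport (fun z => conj (φ z)) ⊆ tsupport φ :=
      closure_mono fun z hz hz' => hz (by simp [hz'])
    exact ⟨Complex.conjCLE.contDiff.comp h.1,
      h.2.1.isCompact.of_isClosed_subset (isClosed_tsupport _) hsub, hsub.trans h.2.2⟩
  have h0 := (Submodule.mem_orthogonal _ _).1 hf _ hc.toLp_mem_domain
  rw [L2.inner_def] at h0
  rw [← h0]
  refine integral_congr_ae ?_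
  filter_upwards [hc.memLp.coeFn_toLp] with z hz
  rw [hz]; simp

/-- The graph of `dbar1` is the prescribed one. -/
theorem dbar1_graph {n : ℕ} {Ω : Set (Cn n)} (hΩ : IsOpen Ω) :
    (dbar1 Ω).graph = dbar1Graph Ω := by
  refine Submodule.toLinearPMap_graph_eq _ ?_
  rintro ⟨f, α⟩ hp hf
  obtain rfl : f = 0 := hf
  ext1 i
  refine L2.eq_zero_of_test hΩ _ fun φ h => ?_
  have h1 : (∫ z in Ω, (0 : L2 Ω) z * dzbar i.1.1 φ z) - ∫ z in Ω, (0 : L2 Ω) z * dzbar i.1.2 φ z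
      = -∫ z in Ω, α i z * φ z := hp i φ h
  rw [L2.integral_zero_mul, L2.integral_zero_mul, sub_zero] at h1
  exact neg_eq_zero.1 h1.symm

/-! ### The Sobolev norm of order `-1` -/

/-- The square of the `W¹(Ω)` norm of a smooth function. -/
def sobolevOneSq {n : ℕ} (Ω : Set (Cn n)) (φ : Cn n → ℂ) : ℝ :=
  (∫ z in Ω, ‖φ z‖ ^ 2) +
    ∑ j, ((∫ z in Ω, ‖fderiv ℝ φ z (EuclideanSpace.single j 1)‖ ^ 2) +
      ∫ z in Ω, ‖fderiv ℝ φ z (EuclideanSpace.single j Complex.I)‖ ^ 2)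

/-- The norm of `f ∈ L²(Ω)` in `W⁻¹(Ω)`, the dual of `W¹₀(Ω)`. -/
def sobolevNegOne {n : ℕ} {Ω : Set (Cn n)} (f : L2 Ω) : ℝ :=
  sSup {t | ∃ φ, IsTest Ω φ ∧ sobolevOneSq Ω φ ≤ 1 ∧ t = ‖∫ z in Ω, f z * φ z‖}

/-- The set of numbers in the definition of the `W⁻¹` norm is bounded. -/
lemma sobolevNegOne_bddAbove {n : ℕ} {Ω : Set (Cn n)} (f : L2 Ω) :
    BddAbove {t | ∃ φ, IsTest Ω φ ∧ sobolevOneSq Ω φ ≤ 1 ∧ t = ‖∫ z in Ω, f z * φ z‖} := by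
  refine ⟨(∫ z in Ω, ‖f z‖ ^ 2) + 1, ?_⟩
  rintro t ⟨φ, h, h1, rfl⟩
  have hf2 : Integrable (fun z => ‖f z‖ ^ 2) (volume.restrict Ω) :=
    (Lp.memLp f).integrable_norm_pow (by norm_num)
  have hφ2 : Integrable (fun z => ‖φ z‖ ^ 2) (volume.restrict Ω) :=
    h.memLp.integrable_norm_pow (by norm_num)
  have hφ1 : ∫ z in Ω, ‖φ z‖ ^ 2 ≤ 1 := by
    refine le_trans (le_add_of_nonneg_right ?_) h1
    exact Finset.sum_nonneg fun j _ => add_nonneg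
      (integral_nonneg fun z => by positivity) (integral_nonneg fun z => by positivity)
  calc ‖∫ z in Ω, f z * φ z‖ ≤ ∫ z in Ω, ‖f z * φ z‖ := norm_integral_le_integral_norm _
    _ ≤ ∫ z in Ω, (‖f z‖ ^ 2 + ‖φ z‖ ^ 2) := by
        refine integral_mono (h.integrable_mul f).norm (hf2.add hφ2) fun z => ?_
        simp only [norm_mul]
        nlinarith [sq_nonneg (‖f z‖ - ‖φ z‖), sq_nonneg (‖f z‖ + ‖φ z‖)]
    _ ≤ _ := by rw [integral_add hf2 hφ2]; linarith

/-- `‖u‖₋₁² = ∑_k ‖u_k‖₋₁²` for a `(0,1)`-form `u`. -/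
def sobolevNegOneSq {n : ℕ} {Ω : Set (Cn n)} (u : L2Form1 Ω) : ℝ :=
  ∑ k, sobolevNegOne (u k) ^ 2

/-! ### Allowable matrices -/

/-- `‖A u‖² = ∑_j ‖∑_k A_{jk} u_k‖²` for a matrix function `A` and a `(0,1)`-form `u`. -/
def matrixNormSq {n : ℕ} {Ω : Set (Cn n)} (A : Cn n → Matrix (Fin n) (Fin n) ℂ)
    (u : L2Form1 Ω) : ℝ :=
  ∑ j, ∫ z in Ω, ‖∑ k, A z j k * u k z‖ ^ 2

/-- Allowable matrices for the compactness estimate on `(0,1)`-forms: the entries are smooth up to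
the boundary of `Ω`, and for every `ε > 0` there is `C > 0` with
`‖A u‖² ≤ ε (‖∂̄u‖² + ‖∂̄*u‖²) + C ‖u‖₋₁²` for all `u` in `Dom ∂̄ ∩ Dom ∂̄*`. -/
def IsAllowableMatrix {n : ℕ} (Ω : Set (Cn n)) (A : Cn n → Matrix (Fin n) (Fin n) ℂ) : Prop :=
  (∃ U : Set (Cn n), IsOpen U ∧ closure Ω ⊆ U ∧ ∀ j k, ContDiffOn ℝ ∞ (fun z => A z j k) U) ∧
  ∀ ε : ℝ, 0 < ε → ∃ C : ℝ, 0 < C ∧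
    ∀ (u : L2Form1 Ω) (h : u ∈ (dbar1 Ω).domain) (h' : u ∈ (dbarStar Ω).domain),
      matrixNormSq A u ≤
        ε * (‖dbar1 Ω ⟨u, h⟩‖ ^ 2 + ‖dbarStar Ω ⟨u, h'⟩‖ ^ 2) + C * sobolevNegOneSq u

end

/-! Write ℒ for the complex Hessian of r, B for a positive semidefinite Hermitian matrix function,
and div U = ∑ ∂U_j/∂z_j. Positivity of ℒ gives ‖ℒu‖² ≤ Λ ∫ (ℒu,u), so (ℒu,u) must be small near the
boundary and u must be controlled inside. Near the boundary the twisted Morrey–Kohn inequality is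
used with twist a = 2δ - δ e^{r/δ}: a is at most 2δ, while minus its Levi form dominates e^{r/δ} ℒ.
Hence ∫ e^{r/δ} (ℒu,u) ≤ Cδ (‖∂̄u‖² + ‖∂̄*u‖²) with C independent of δ, and e^{r/δ} ≥ 1/3 where r >
-δ. Where r ≤ -δ, a cut-off and the ellipticity of ∂̄ ⊕ ∂̄* pair u in W⁻¹ against W¹₀
(`exists_interior_bound`). The choice of δ and Young's inequality finish
(`IsDefining.compactness_estimate`).

The difficulty is to prove the twisted inequality on the whole of Dom ∂̄ ∩ Dom ∂̄*. Integration by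
parts is done only on test forms U, with the extra weight σ^16, where σ = -r/(s - r) vanishes on the
boundary and has nonpositive Levi form because r is plurisubharmonic (`weight_pointwise`,
`weighted_estimate`). In the variable u = σ^7 U the right side is ‖Su‖² + ‖T*u‖² with S = σ^8 ∂̄
σ^{-7}, T = σ^7 ∂̄ σ^{-6}, T* = -σ^{-6} div σ^7, and ST = 0. The principal parts carry a factor σ,
so cut-offs near the boundary have bounded commutators, and mollification extends the inequality to
all weak solutions (`WeightedBound.of_weak`).

The weighted operators are then compared with the true ones by duality
(`WeightedBound.exists_split`). To bound ∫ B(u,F) for a test form F, it is written as ⟨f, σ^7 u⟩ and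
σ^7 u is split along ker S. The component orthogonal to ker S is killed by T* and sees only ∂̄u. The
other component is ⟨p, σ^7 u⟩ with p the projection of f, and on test forms U it is bounded by the
weighted divergence. As s → 0 the vectors p have a weak limit b with |⟨b,U⟩| ≤ K ‖div U‖; by Riesz b
= ∂̄β with ‖β‖ ≤ K, so |⟨b,u⟩| = |⟨β, ∂̄*u⟩| ≤ K ‖∂̄*u‖ (`norm_inner_le_of_test`,
`IsDefining.norm_sesq_le`). Letting F tend to u in L² gives the unweighted inequality
(`IsDefining.integral_hform_le`). The boundary condition on u enters only through the definition of
the Hilbert space adjoint. -/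

noncomputable section

open Filter Topology

/-! ### Wirtinger calculus -/

section Wirtinger

variable {n : ℕ} {Ω : Set (Cn n)}

/-- Evaluation of a real-linear functional at a vector. -/
def evalL (v : Cn n) : (Cn n →L[ℝ] ℂ) →L[ℂ] ℂ :=
  LinearMap.mkContinuous
    { toFun := fun A => A v
      map_add' := fun _ _ => rfl
      map_smul' := fun _ _ => rfl } ‖v‖ fun A => (A.le_opNorm v).trans_eq (mul_comm _ _)

/-- The functional on real-linear maps inducing `∂/∂z_j`. -/
def dzL (j : Fin n) : (Cn n →L[ℝ] ℂ) →L[ℂ] ℂ :=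
  (1 / 2 : ℂ) • (evalL (EuclideanSpace.single j 1)
    - Complex.I • evalL (EuclideanSpace.single j Complex.I))

/-- The functional on real-linear maps inducing `∂/∂z̄_j`. -/
def dzbarL (j : Fin n) : (Cn n →L[ℝ] ℂ) →L[ℂ] ℂ :=
  (1 / 2 : ℂ) • (evalL (EuclideanSpace.single j 1)
    + Complex.I • evalL (EuclideanSpace.single j Complex.I))

lemma dz_eq (j : Fin n) (f : Cn n → ℂ) (z : Cn n) : dz j f z = dzL j (fderiv ℝ f z) := rfl

lemma dzbar_eq (j : Fin n) (f : Cn n → ℂ) (z : Cn n) :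
    dzbar j f z = dzbarL j (fderiv ℝ f z) := rfl

lemma fderiv_mul_complex {f g : Cn n → ℂ} {z : Cn n} (hf : DifferentiableAt ℝ f z)
    (hg : DifferentiableAt ℝ g z) :
    fderiv ℝ (fun w => f w * g w) z = f z • fderiv ℝ g z + g z • fderiv ℝ f z :=
  fderiv_fun_mul hf hg

lemma dz_mul (j : Fin n) {f g : Cn n → ℂ} {z : Cn n} (hf : DifferentiableAt ℝ f z)
    (hg : DifferentiableAt ℝ g z) :
    dz j (fun w => f w * g w) z = dz j f z * g z + f z * dz j g z := by
  simp only [dz_eq, fderiv_mul_complex hf hg, map_add, map_smul, smul_eq_mul]; ring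

lemma dzbar_mul (j : Fin n) {f g : Cn n → ℂ} {z : Cn n} (hf : DifferentiableAt ℝ f z)
    (hg : DifferentiableAt ℝ g z) :
    dzbar j (fun w => f w * g w) z = dzbar j f z * g z + f z * dzbar j g z := by
  simp only [dzbar_eq, fderiv_mul_complex hf hg, map_add, map_smul, smul_eq_mul]; ring

lemma dz_add (j : Fin n) {f g : Cn n → ℂ} {z : Cn n} (hf : DifferentiableAt ℝ f z)
    (hg : DifferentiableAt ℝ g z) :
    dz j (fun w => f w + g w) z = dz j f z + dz j g z := by
  simp only [dz_eq, fderiv_fun_add hf hg, map_add]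

lemma dzbar_add (j : Fin n) {f g : Cn n → ℂ} {z : Cn n} (hf : DifferentiableAt ℝ f z)
    (hg : DifferentiableAt ℝ g z) :
    dzbar j (fun w => f w + g w) z = dzbar j f z + dzbar j g z := by
  simp only [dzbar_eq, fderiv_fun_add hf hg, map_add]

lemma fderiv_conj (f : Cn n → ℂ) (z v : Cn n) :
    fderiv ℝ (fun w => conj (f w)) z v = conj (fderiv ℝ f z v) := by
  have := Complex.conjCLE.comp_fderiv (f := f) (x := z)
  have h2 : fderiv ℝ (fun w => conj (f w)) z = (Complex.conjCLE : ℂ →L[ℝ] ℂ).comp (fderiv ℝ f z) :=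
    this
  rw [h2]; rfl

lemma dz_conj (j : Fin n) (f : Cn n → ℂ) (z : Cn n) :
    dz j (fun w => conj (f w)) z = conj (dzbar j f z) := by
  simp [dz, dzbar, fderiv_conj, sub_eq_add_neg, Complex.conj_ofNat]

lemma dzbar_conj (j : Fin n) (f : Cn n → ℂ) (z : Cn n) :
    dzbar j (fun w => conj (f w)) z = conj (dz j f z) := by
  simp [dz, dzbar, fderiv_conj, sub_eq_add_neg, Complex.conj_ofNat]

lemma fderiv_comp_ofReal {g : ℝ → ℝ} {g' : ℝ} {r : Cn n → ℝ} {z : Cn n}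
    (hg : HasDerivAt g g' (r z)) (hr : DifferentiableAt ℝ r z) :
    fderiv ℝ (fun w => ((g (r w) : ℝ) : ℂ)) z = (g' : ℂ) • fderiv ℝ (fun w => (r w : ℂ)) z := by
  have h1 : HasFDerivAt (fun w => g (r w)) (g' • fderiv ℝ r z) z :=
    hg.comp_hasFDerivAt z hr.hasFDerivAt
  have h2 := Complex.ofRealCLM.hasFDerivAt.comp z h1
  have h3 := Complex.ofRealCLM.hasFDerivAt.comp z hr.hasFDerivAt
  have e2 : fderiv ℝ (fun w => ((g (r w) : ℝ) : ℂ)) z = _ := h2.fderiv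
  have e3 : fderiv ℝ (fun w => (r w : ℂ)) z = _ := h3.fderiv
  rw [e2, e3]
  ext v
  simp

lemma dz_comp_ofReal (j : Fin n) {g : ℝ → ℝ} {g' : ℝ} {r : Cn n → ℝ} {z : Cn n}
    (hg : HasDerivAt g g' (r z)) (hr : DifferentiableAt ℝ r z) :
    dz j (fun w => ((g (r w) : ℝ) : ℂ)) z = g' * dz j (fun w => (r w : ℂ)) z := by
  rw [dz_eq, fderiv_comp_ofReal hg hr, map_smul, dz_eq, smul_eq_mul]

lemma dzbar_comp_ofReal (j : Fin n) {g : ℝ → ℝ} {g' : ℝ} {r : Cn n → ℝ} {z : Cn n}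
    (hg : HasDerivAt g g' (r z)) (hr : DifferentiableAt ℝ r z) :
    dzbar j (fun w => ((g (r w) : ℝ) : ℂ)) z = g' * dzbar j (fun w => (r w : ℂ)) z := by
  rw [dzbar_eq, fderiv_comp_ofReal hg hr, map_smul, dzbar_eq, smul_eq_mul]

lemma dz_congr (j : Fin n) {f g : Cn n → ℂ} {z : Cn n} (h : f =ᶠ[𝓝 z] g) :
    dz j f z = dz j g z := by
  rw [dz_eq, dz_eq, h.fderiv_eq]

lemma dzbar_congr (j : Fin n) {f g : Cn n → ℂ} {z : Cn n} (h : f =ᶠ[𝓝 z] g) :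
    dzbar j f z = dzbar j g z := by
  rw [dzbar_eq, dzbar_eq, h.fderiv_eq]

lemma dzbar_ofReal (j : Fin n) (r : Cn n → ℝ) (z : Cn n) :
    dzbar j (fun w => (r w : ℂ)) z = conj (dz j (fun w => (r w : ℂ)) z) := by
  rw [← dzbar_conj]; simp

lemma contDiffOn_clm_fderiv (ℓ : (Cn n →L[ℝ] ℂ) →L[ℂ] ℂ) {f : Cn n → ℂ} (hΩ : IsOpen Ω)
    (hf : ContDiffOn ℝ ∞ f Ω) : ContDiffOn ℝ ∞ (fun z => ℓ (fderiv ℝ f z)) Ω :=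
  (ℓ.restrictScalars ℝ).contDiff.comp_contDiffOn (hf.fderiv_of_isOpen hΩ (m := ∞) (by simp))

lemma contDiffOn_dz (j : Fin n) {f : Cn n → ℂ} (hΩ : IsOpen Ω) (hf : ContDiffOn ℝ ∞ f Ω) :
    ContDiffOn ℝ ∞ (dz j f) Ω := contDiffOn_clm_fderiv (dzL j) hΩ hf

lemma contDiffOn_dzbar (j : Fin n) {f : Cn n → ℂ} (hΩ : IsOpen Ω) (hf : ContDiffOn ℝ ∞ f Ω) :
    ContDiffOn ℝ ∞ (dzbar j f) Ω := contDiffOn_clm_fderiv (dzbarL j) hΩ hf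

lemma ContDiffOn.diffAt {f : Cn n → ℂ} (hf : ContDiffOn ℝ ∞ f Ω) (hΩ : IsOpen Ω) {z : Cn n}
    (hz : z ∈ Ω) : DifferentiableAt ℝ f z :=
  ((hf z hz).contDiffAt (hΩ.mem_nhds hz)).differentiableAt (by simp)

lemma ContDiffOn.ofReal_comp {r : Cn n → ℝ} (hr : ContDiffOn ℝ ∞ r Ω) :
    ContDiffOn ℝ ∞ (fun z => (r z : ℂ)) Ω :=
  Complex.ofRealCLM.contDiff.comp_contDiffOn hr

lemma ContDiffOn.conj_comp {f : Cn n → ℂ} (hf : ContDiffOn ℝ ∞ f Ω) :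
    ContDiffOn ℝ ∞ (fun z => conj (f z)) Ω :=
  Complex.conjCLE.contDiff.comp_contDiffOn hf

lemma fderiv_clm_fderiv (ℓ : (Cn n →L[ℝ] ℂ) →L[ℂ] ℂ) {f : Cn n → ℂ} (hΩ : IsOpen Ω)
    (hf : ContDiffOn ℝ ∞ f Ω) {z : Cn n} (hz : z ∈ Ω) (u : Cn n) :
    fderiv ℝ (fun w => ℓ (fderiv ℝ f w)) z u = ℓ (fderiv ℝ (fderiv ℝ f) z u) := by
  have h1 : DifferentiableAt ℝ (fderiv ℝ f) z :=
    (((hf.fderiv_of_isOpen hΩ (m := ∞) (by simp)) z hz).contDiffAt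
      (hΩ.mem_nhds hz)).differentiableAt (by simp)
  have h2 : HasFDerivAt (fun w => ℓ (fderiv ℝ f w))
      ((ℓ.restrictScalars ℝ).comp (fderiv ℝ (fderiv ℝ f) z)) z :=
    (ℓ.restrictScalars ℝ).hasFDerivAt.comp z h1.hasFDerivAt
  rw [h2.fderiv]; rfl

lemma dz_dzbar_comm (j k : Fin n) {f : Cn n → ℂ} (hΩ : IsOpen Ω) (hf : ContDiffOn ℝ ∞ f Ω)
    {z : Cn n} (hz : z ∈ Ω) : dz j (dzbar k f) z = dzbar k (dz j f) z := by
  have hs : IsSymmSndFDerivAt ℝ f z :=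
    ((hf z hz).contDiffAt (hΩ.mem_nhds hz)).isSymmSndFDerivAt (by
      simpa using (WithTop.coe_le_coe.2 le_top : ((2 : ℕ∞) : WithTop ℕ∞) ≤ ∞))
  have e1 : ∀ u, fderiv ℝ (dzbar k f) z u = dzbarL k (fderiv ℝ (fderiv ℝ f) z u) :=
    fderiv_clm_fderiv (dzbarL k) hΩ hf hz
  have e2 : ∀ u, fderiv ℝ (dz j f) z u = dzL j (fderiv ℝ (fderiv ℝ f) z u) :=
    fderiv_clm_fderiv (dzL j) hΩ hf hz
  rw [dz, dzbar, e1, e1, e2, e2]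
  simp only [dzL, dzbarL, evalL, _root_.smul_apply, _root_.add_apply,
    _root_.sub_apply, LinearMap.mkContinuous_apply, LinearMap.coe_mk, AddHom.coe_mk,
    smul_eq_mul]
  rw [hs (EuclideanSpace.single j 1) (EuclideanSpace.single k 1),
    hs (EuclideanSpace.single j 1) (EuclideanSpace.single k Complex.I),
    hs (EuclideanSpace.single j Complex.I) (EuclideanSpace.single k 1),
    hs (EuclideanSpace.single j Complex.I) (EuclideanSpace.single k Complex.I)]
  ring

/-! ### Test functions -/

lemma IsTest.mul_contDiffOn (hΩ : IsOpen Ω) {a φ : Cn n → ℂ} (ha : ContDiffOn ℝ ∞ a Ω)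
    (h : IsTest Ω φ) : IsTest Ω (fun z => a z * φ z) := by
  have hs : tsupport (fun z => a z * φ z) ⊆ tsupport φ :=
    closure_mono fun z hz hz' => hz (by simp [hz'])
  refine ⟨?_, h.2.1.mul_left, hs.trans h.2.2⟩
  have hc : IsOpen (tsupport φ)ᶜ := (isClosed_tsupport _).isOpen_compl
  rw [contDiff_iff_contDiffAt]
  intro z
  by_cases hz : z ∈ tsupport φ
  · exact ((ha z (h.2.2 hz)).contDiffAt (hΩ.mem_nhds (h.2.2 hz))).mul h.1.contDiffAt
  · have : (fun z => a z * φ z) =ᶠ[𝓝 z] fun _ => 0 := by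
      filter_upwards [hc.mem_nhds hz] with w hw
      simp [image_eq_zero_of_notMem_tsupport hw]
    exact contDiffAt_const.congr_of_eventuallyEq this

lemma IsTest.contDiffOn {φ : Cn n → ℂ} (h : IsTest Ω φ) : ContDiffOn ℝ ∞ φ Ω := h.1.contDiffOn

lemma IsTest.diffAt {φ : Cn n → ℂ} (h : IsTest Ω φ) (z : Cn n) : DifferentiableAt ℝ φ z :=
  h.1.differentiable (by simp) z

lemma IsTest.conj {φ : Cn n → ℂ} (h : IsTest Ω φ) : IsTest Ω (fun z => conj (φ z)) := by
  have hsub : tsupport (fun z => (starRingEnd ℂ) (φ z)) ⊆ tsupport φ :=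
    closure_mono fun z hz hz' => hz (by simp [hz'])
  exact ⟨Complex.conjCLE.contDiff.comp h.1,
    h.2.1.isCompact.of_isClosed_subset (isClosed_tsupport _) hsub, hsub.trans h.2.2⟩

lemma IsTest.add {φ ψ : Cn n → ℂ} (h : IsTest Ω φ) (h' : IsTest Ω ψ) :
    IsTest Ω (fun z => φ z + ψ z) :=
  ⟨h.1.add h'.1, h.2.1.add h'.2.1,
    (tsupport_add φ ψ).trans (Set.union_subset h.2.2 h'.2.2)⟩

lemma IsTest.zero : IsTest Ω (fun _ : Cn n => (0 : ℂ)) := by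
  refine ⟨contDiff_const, HasCompactSupport.zero, ?_⟩
  have : tsupport (fun _ : Cn n => (0 : ℂ)) = ∅ := tsupport_eq_empty_iff.2 rfl
  rw [this]; exact Set.empty_subset _

lemma IsTest.const_mul {φ : Cn n → ℂ} (h : IsTest Ω φ) (c : ℂ) :
    IsTest Ω (fun z => c * φ z) := by
  have hs : tsupport (fun z => c * φ z) ⊆ tsupport φ :=
    closure_mono fun z hz hz' => hz (by simp [hz'])
  exact ⟨contDiff_const.mul h.1, h.2.1.mul_left, hs.trans h.2.2⟩

lemma IsTest.sub {φ ψ : Cn n → ℂ} (h : IsTest Ω φ) (h' : IsTest Ω ψ) :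
    IsTest Ω (fun z => φ z - ψ z) := by
  simpa [sub_eq_add_neg] using h.add (h'.const_mul (-1))

lemma IsTest.sum {ι : Type*} (s : Finset ι) {φ : ι → Cn n → ℂ} (h : ∀ i, IsTest Ω (φ i)) :
    IsTest Ω (fun z => ∑ i ∈ s, φ i z) := by
  classical
  induction s using Finset.induction_on with
  | empty => simpa using IsTest.zero
  | insert a s ha ih => simpa [Finset.sum_insert ha] using (h a).add ih

lemma IsTest.clm_fderiv {φ : Cn n → ℂ} (h : IsTest Ω φ) (ℓ : (Cn n →L[ℝ] ℂ) →L[ℂ] ℂ) :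
    IsTest Ω (fun z => ℓ (fderiv ℝ φ z)) := by
  have hs : tsupport (fun z => ℓ (fderiv ℝ φ z)) ⊆ tsupport φ := by
    refine closure_minimal (fun z hz => ?_) (isClosed_tsupport _)
    by_contra hz'
    have h0 : fderiv ℝ φ z = 0 := by
      by_contra hne
      exact hz' (support_fderiv_subset ℝ hne)
    exact hz (by simp [h0])
  exact ⟨(ℓ.restrictScalars ℝ).contDiff.comp (h.1.fderiv_right (m := ∞) (by simp)),
    h.2.1.isCompact.of_isClosed_subset (isClosed_tsupport _) hs, hs.trans h.2.2⟩

lemma IsTest.dz {φ : Cn n → ℂ} (h : IsTest Ω φ) (j : Fin n) : IsTest Ω (dz j φ) :=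
  h.clm_fderiv (dzL j)

lemma IsTest.integrable {φ : Cn n → ℂ} (h : IsTest Ω φ) (μ : Measure (Cn n))
    [IsFiniteMeasureOnCompacts μ] : Integrable φ μ :=
  h.1.continuous.integrable_of_hasCompactSupport h.2.1

lemma IsTest.integrableOn {φ : Cn n → ℂ} (h : IsTest Ω φ) : IntegrableOn φ Ω :=
  (h.integrable volume).integrableOn

lemma IsTest.eq_zero {φ : Cn n → ℂ} (h : IsTest Ω φ) {z : Cn n} (hz : z ∉ Ω) : φ z = 0 :=
  image_eq_zero_of_notMem_tsupport fun h' => hz (h.2.2 h')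

lemma IsTest.integral_fderiv {φ : Cn n → ℂ} (h : IsTest Ω φ) (v : Cn n) :
    ∫ z in Ω, fderiv ℝ φ z v = 0 := by
  rw [setIntegral_eq_integral_of_forall_compl_eq_zero
    fun z hz => (fderiv_apply_test h v).eq_zero hz]
  have := integral_mul_fderiv_eq_neg_fderiv_mul_of_integrable (μ := (volume : Measure (Cn n)))
    (f := fun _ : Cn n => (1 : ℂ)) (g := φ) (v := v) (by simp)
    (by simpa using (fderiv_apply_test h v).integrable volume) (by simpa using h.integrable volume)
    (fun z _ => differentiableAt_const _) (fun z _ => h.diffAt z)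
  simpa using this

lemma IsTest.integral_dz_eq_zero {φ : Cn n → ℂ} (h : IsTest Ω φ) (j : Fin n) :
    ∫ z in Ω, _root_.dz j φ z = 0 := by
  simp only [_root_.dz]
  rw [integral_const_mul, integral_sub (fderiv_apply_test h _).integrableOn
    ((fderiv_apply_test h _).integrableOn.const_mul _), integral_const_mul, h.integral_fderiv,
    h.integral_fderiv]
  simp

lemma IsTest.integral_dzbar_eq_zero {φ : Cn n → ℂ} (h : IsTest Ω φ) (j : Fin n) :
    ∫ z in Ω, dzbar j φ z = 0 := by
  simp only [dzbar]
  rw [integral_const_mul, integral_add (fderiv_apply_test h _).integrableOn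
    ((fderiv_apply_test h _).integrableOn.const_mul _), integral_const_mul, h.integral_fderiv,
    h.integral_fderiv]
  simp

end Wirtinger

/-! ### The weighted Morrey–Kohn identity -/

section Morrey

variable {n : ℕ} {Ω : Set (Cn n)}

/-- The integrand of the Morrey–Kohn identity with weight `W`. -/
def morreyTerm (W : Cn n → ℂ) (U : Fin n → Cn n → ℂ) (j k : Fin n) (z : Cn n) : ℂ :=
  W z * dzbar k (U j) z * conj (dzbar j (U k) z) - W z * dz j (U j) z * conj (dz k (U k) z)
    - dzbar k W z * dz j (U j) z * conj (U k z)
    - dzbar k (dz j W) z * U j z * conj (U k z) - dz j W z * U j z * conj (dz k (U k) z)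

/-- The integrand is a sum of first derivatives of compactly supported functions: exchanging ∂_j and
∂̄_k in W ∂̄_k U_j conj(U_k) moves both derivatives, and the support of U leaves no boundary term.
-/
lemma integral_morreyTerm (hΩ : IsOpen Ω) {W : Cn n → ℂ} (hW : ContDiffOn ℝ ∞ W Ω)
    {U : Fin n → Cn n → ℂ} (hU : ∀ j, IsTest Ω (U j)) (j k : Fin n) :
    ∫ z in Ω, morreyTerm W U j k z = 0 := by
  have t1 : IsTest Ω fun z => W z * (dzbar k (U j) z * conj (U k z)) :=
    ((hU k).conj.mul_contDiffOn hΩ ((hU j).wirtinger k).contDiffOn).mul_contDiffOn hΩ hW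
  have t2 : IsTest Ω fun z => W z * (dz j (U j) z * conj (U k z)) :=
    ((hU k).conj.mul_contDiffOn hΩ ((hU j).dz j).contDiffOn).mul_contDiffOn hΩ hW
  have t3 : IsTest Ω fun z => dz j W z * (U j z * conj (U k z)) :=
    ((hU k).conj.mul_contDiffOn hΩ (hU j).contDiffOn).mul_contDiffOn hΩ (contDiffOn_dz j hΩ hW)
  have key : ∀ z ∈ Ω, morreyTerm W U j k z = dz j (fun z => W z * (dzbar k (U j) z * conj (U k z))) z
      - dzbar k (fun z => W z * (dz j (U j) z * conj (U k z))) z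
      - dzbar k (fun z => dz j W z * (U j z * conj (U k z))) z := by
    intro z hz
    have dW := hW.diffAt hΩ hz
    have dW' := (contDiffOn_dz j hΩ hW).diffAt hΩ hz
    have d1 := ((hU j).wirtinger k).diffAt z
    have d2 := ((hU j).dz j).diffAt z
    have d3 := (hU k).conj.diffAt z
    have d4 := (hU j).diffAt z
    have d13 : DifferentiableAt ℝ (fun z => dzbar k (U j) z * conj (U k z)) z := d1.mul d3
    have d23 : DifferentiableAt ℝ (fun z => dz j (U j) z * conj (U k z)) z := d2.mul d3
    have d43 : DifferentiableAt ℝ (fun z => U j z * conj (U k z)) z := d4.mul d3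
    rw [dz_mul j dW d13, dzbar_mul k dW d23, dzbar_mul k dW' d43, dz_mul j d1 d3,
      dzbar_mul k d2 d3, dzbar_mul k d4 d3, dz_conj, dzbar_conj,
      dz_dzbar_comm j k hΩ (hU j).contDiffOn hz, morreyTerm]
    ring
  rw [setIntegral_congr_fun hΩ.measurableSet key]
  rw [integral_sub (((t1.dz j).sub (t2.wirtinger k)).integrableOn)
    (t3.wirtinger k).integrableOn, integral_sub (t1.dz j).integrableOn (t2.wirtinger k).integrableOn,
    t1.integral_dz_eq_zero, t2.integral_dzbar_eq_zero, t3.integral_dzbar_eq_zero]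
  simp

lemma isTest_morreyTerm (hΩ : IsOpen Ω) {W : Cn n → ℂ} (hW : ContDiffOn ℝ ∞ W Ω)
    {U : Fin n → Cn n → ℂ} (hU : ∀ j, IsTest Ω (U j)) (j k : Fin n) :
    IsTest Ω (morreyTerm W U j k) := by
  have hz := contDiffOn_dz j hΩ hW
  exact (((((((hU k).wirtinger j).conj.mul_contDiffOn hΩ
    (hW.mul ((hU j).wirtinger k).contDiffOn)).sub
    (((hU k).dz k).conj.mul_contDiffOn hΩ (hW.mul ((hU j).dz j).contDiffOn))).sub
    ((hU k).conj.mul_contDiffOn hΩ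
      ((contDiffOn_dzbar k hΩ hW).mul ((hU j).dz j).contDiffOn))).sub
    ((hU k).conj.mul_contDiffOn hΩ
      ((contDiffOn_dzbar k hΩ hz).mul (hU j).contDiffOn))).sub
    (((hU k).dz k).conj.mul_contDiffOn hΩ (hz.mul (hU j).contDiffOn)))

/-- `∑_j ∂U_j/∂z_j`. -/
def divz (U : Fin n → Cn n → ℂ) (z : Cn n) : ℂ := ∑ j, dz j (U j) z

/-- With D a b = ∂̄_a U_b this is |∂̄U|² = (all ∂̄-derivatives squared) minus the mixed products,
which are the ones that appear in the Morrey–Kohn identity. -/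
lemma sum_antisymm_sq (D : Fin n → Fin n → ℂ) :
    ∑ i : {p : Fin n × Fin n // p.1 < p.2}, ‖D i.1.1 i.1.2 - D i.1.2 i.1.1‖ ^ 2
      = (∑ j, ∑ k, ‖D k j‖ ^ 2) - (∑ j, ∑ k, D k j * conj (D j k)).re := by
  have h0 : ∀ x y : ℂ, ‖x - y‖ ^ 2
      = ‖x‖ ^ 2 + ‖y‖ ^ 2 - (x * conj y).re - (y * conj x).re := by
    intro x y
    simp only [← Complex.normSq_eq_norm_sq, Complex.normSq_apply, Complex.sub_re, Complex.sub_im,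
      Complex.mul_re, Complex.conj_re, Complex.conj_im]
    ring
  have h1 : (∑ j, ∑ k, ‖D k j‖ ^ 2) - (∑ j, ∑ k, D k j * conj (D j k)).re
      = ∑ p : Fin n × Fin n, (‖D p.1 p.2‖ ^ 2 - (D p.1 p.2 * conj (D p.2 p.1)).re) := by
    rw [Finset.sum_comm, Finset.sum_comm (f := fun j k => D k j * conj (D j k)),
      Fintype.sum_prod_type]
    simp only [Complex.re_sum, ← Finset.sum_sub_distrib]
  have h2 : ∀ f : Fin n × Fin n → ℝ, (∀ j, f (j, j) = 0) → ∑ p, f p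
      = ∑ i : {p : Fin n × Fin n // p.1 < p.2}, (f i.1 + f i.1.swap) := by
    intro f hf
    have e : ∀ g : Fin n × Fin n → ℝ, ∑ i : {p : Fin n × Fin n // p.1 < p.2}, g i.1
        = ∑ p, if p.1 < p.2 then g p else 0 := by
      intro g
      rw [← Finset.sum_filter]
      exact (Finset.sum_subtype _ (by simp) g).symm
    rw [e fun p => f p + f p.swap]
    have hs : ∑ p : Fin n × Fin n, (if p.2 < p.1 then f p else 0)
        = ∑ p : Fin n × Fin n, if p.1 < p.2 then f p.swap else 0 :=
      Fintype.sum_equiv (Equiv.prodComm _ _) _ _ fun p => by simp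
    have hsplit : ∀ p : Fin n × Fin n, (if p.1 < p.2 then f p + f p.swap else 0)
        = (if p.1 < p.2 then f p else 0) + if p.1 < p.2 then f p.swap else 0 := by
      intro p; split_ifs <;> simp
    simp only [hsplit, Finset.sum_add_distrib]
    rw [← hs, ← Finset.sum_add_distrib]
    refine Finset.sum_congr rfl fun p _ => ?_
    obtain ⟨a, b⟩ := p
    rcases lt_trichotomy a b with h | h | h
    · simp [h, h.not_gt]
    · subst h; simp [hf]
    · simp [h, h.not_gt]
  rw [h1, h2]
  · refine Finset.sum_congr rfl fun i _ => ?_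
    rw [h0]; simp only [Prod.fst_swap, Prod.snd_swap]; ring
  · intro j
    simp only [Complex.mul_conj, Complex.ofReal_re, Complex.normSq_eq_norm_sq, sub_self]

/-- The algebra behind the twisted estimate, with θ = div U, A = ∂a(U), S = ∂σ(U), La and Ls the
Levi forms, D - C the squared norm of ∂̄U. The long real part is the summed Morrey–Kohn integrand,
of integral zero. For a weight aσ^{2q} the coefficient of S must be c = 2q - 2 in order that the two
operators of the right side form a complex after the substitution u = σ^{q-1} U. Expressed through h
= σθ + cS, the S² term then has coefficient (2q - 4)a, and with the factor 4a in front of h² the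
form in (h, S, A) is nonnegative exactly when q ≥ 8. This explains 16, 14 and 240 = 16 · 15. -/
lemma weight_pointwise {a σ B D : ℝ} {C La Ls θ A S : ℂ} (ha : 0 < a) (hσ : 0 < σ)
    (hLs : Ls.re ≤ 0) (hA : ‖A‖ ^ 2 + a * B ≤ -a * La.re) (hD : 0 ≤ D) (hDC : 0 ≤ D - C.re) :
    σ ^ 16 * B ≤ 4 * a * (σ ^ 16 * (D - C.re) + ‖σ ^ 8 * θ + 14 * σ ^ 7 * S‖ ^ 2)
      + (a * σ ^ 16 * C - a * σ ^ 16 * (θ * conj θ)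
        - θ * conj (σ ^ 16 * A + 16 * a * σ ^ 15 * S)
        - (σ ^ 16 * La + 16 * σ ^ 15 * (A * conj S + S * conj A)
          + 240 * a * σ ^ 14 * (S * conj S) + 16 * a * σ ^ 15 * Ls)
        - conj θ * (σ ^ 16 * A + 16 * a * σ ^ 15 * S)).re := by
  have e1 : (a * σ ^ 16 * C - a * σ ^ 16 * (θ * conj θ)
        - θ * conj (σ ^ 16 * A + 16 * a * σ ^ 15 * S)
        - (σ ^ 16 * La + 16 * σ ^ 15 * (A * conj S + S * conj A)
          + 240 * a * σ ^ 14 * (S * conj S) + 16 * a * σ ^ 15 * Ls)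
        - conj θ * (σ ^ 16 * A + 16 * a * σ ^ 15 * S)).re
      = a * σ ^ 16 * C.re - a * σ ^ 16 * (θ.re ^ 2 + θ.im ^ 2)
        - 2 * (θ.re * (σ ^ 16 * A.re + 16 * a * σ ^ 15 * S.re)
          + θ.im * (σ ^ 16 * A.im + 16 * a * σ ^ 15 * S.im))
        - (σ ^ 16 * La.re + 32 * σ ^ 15 * (A.re * S.re + A.im * S.im)
          + 240 * a * σ ^ 14 * (S.re ^ 2 + S.im ^ 2) + 16 * a * σ ^ 15 * Ls.re) := by
    have p16 : (σ : ℂ) ^ 16 = ((σ ^ 16 : ℝ) : ℂ) := by push_cast; rfl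
    have p15 : (σ : ℂ) ^ 15 = ((σ ^ 15 : ℝ) : ℂ) := by push_cast; rfl
    have p14 : (σ : ℂ) ^ 14 = ((σ ^ 14 : ℝ) : ℂ) := by push_cast; rfl
    rw [p16, p15, p14]
    generalize σ ^ 16 = s16
    generalize σ ^ 15 = s15
    generalize σ ^ 14 = s14
    simp only [Complex.sub_re, Complex.add_re, Complex.mul_re, Complex.mul_im, Complex.conj_re,
      Complex.conj_im, Complex.add_im, Complex.ofReal_re, Complex.ofReal_im, Complex.re_ofNat,
      Complex.im_ofNat, map_add, map_mul]
    ring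
  have e2 : ‖σ ^ 8 * θ + 14 * σ ^ 7 * S‖ ^ 2
      = (σ ^ 8 * θ.re + 14 * σ ^ 7 * S.re) ^ 2 + (σ ^ 8 * θ.im + 14 * σ ^ 7 * S.im) ^ 2 := by
    have p8 : (σ : ℂ) ^ 8 = ((σ ^ 8 : ℝ) : ℂ) := by push_cast; rfl
    have p7 : (σ : ℂ) ^ 7 = ((σ ^ 7 : ℝ) : ℂ) := by push_cast; rfl
    rw [p8, p7, ← Complex.normSq_eq_norm_sq, Complex.normSq_apply]
    generalize σ ^ 8 = s8
    generalize σ ^ 7 = s7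
    simp only [Complex.add_re, Complex.mul_re, Complex.mul_im, Complex.add_im, Complex.ofReal_re,
      Complex.ofReal_im, Complex.re_ofNat, Complex.im_ofNat]
    ring
  have hA' : A.re ^ 2 + A.im ^ 2 + a * B + a * La.re ≤ 0 := by
    rw [← Complex.normSq_eq_norm_sq, Complex.normSq_apply] at hA
    nlinarith
  rw [e1, e2]
  -- with `h = σθ + 14 S` the difference is a sum of squares
  have sq : ∀ t s w : ℝ, 0 ≤ (σ * w - a * (σ * t + 14 * s) - 2 * a * s) ^ 2
      + 2 * a ^ 2 * (σ * t + 14 * s - 2 * s) ^ 2 := fun t s w => by positivity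
  have q1 := sq θ.re S.re A.re
  have q2 := sq θ.im S.im A.im
  -- Spending 4a on D - C rather than a leaves aD + 3a(D - C), so the mixed term aC needs no sign of
  -- its own.
  have q3 : 0 ≤ a * σ ^ 2 * (4 * a * (D - C.re) + a * C.re) := by
    have : 4 * a * (D - C.re) + a * C.re = a * D + 3 * a * (D - C.re) := by ring
    rw [this]; positivity
  have q4 : 0 ≤ -(16 * a ^ 2 * σ * Ls.re) := by
    have := mul_nonneg (by positivity : (0:ℝ) ≤ 16 * a ^ 2 * σ) (neg_nonneg.2 hLs)
    linarith
  have q5 : 0 ≤ -(σ ^ 2 * (A.re ^ 2 + A.im ^ 2 + a * B + a * La.re)) := by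
    have := mul_nonneg (sq_nonneg σ) (neg_nonneg.2 hA')
    linarith
  have hs : 0 < a * 1 := by simpa using ha
  have key : 0 ≤ (4 * a * (σ ^ 16 * (D - C.re) + ((σ ^ 8 * θ.re + 14 * σ ^ 7 * S.re) ^ 2
      + (σ ^ 8 * θ.im + 14 * σ ^ 7 * S.im) ^ 2))
      + (a * σ ^ 16 * C.re - a * σ ^ 16 * (θ.re ^ 2 + θ.im ^ 2)
        - 2 * (θ.re * (σ ^ 16 * A.re + 16 * a * σ ^ 15 * S.re)
          + θ.im * (σ ^ 16 * A.im + 16 * a * σ ^ 15 * S.im))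
        - (σ ^ 16 * La.re + 32 * σ ^ 15 * (A.re * S.re + A.im * S.im)
          + 240 * a * σ ^ 14 * (S.re ^ 2 + S.im ^ 2) + 16 * a * σ ^ 15 * Ls.re))
      - σ ^ 16 * B) * a := by
    -- The difference of the two sides, multiplied by a, is σ^14 times the sum of q1, …, q5; the
    -- factor a allows the hypothesis on |A|² to be used without division.
    have h14 : 0 ≤ σ ^ 14 := by positivity
    have := mul_nonneg h14 (add_nonneg (add_nonneg (add_nonneg (add_nonneg q1 q2) q3) q4) q5)
    refine this.trans_eq ?_
    ring
  have := nonneg_of_mul_nonneg_left key ha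
  linarith

lemma dz_weight (j : Fin n) (hΩ : IsOpen Ω) {a σ : Cn n → ℝ} (ha : ContDiffOn ℝ ∞ a Ω)
    (hσ : ContDiffOn ℝ ∞ σ Ω) {z : Cn n} (hz : z ∈ Ω) :
    dz j (fun w => (a w : ℂ) * ((σ w ^ 16 : ℝ) : ℂ)) z
      = σ z ^ 16 * dz j (fun w => (a w : ℂ)) z
        + 16 * a z * σ z ^ 15 * dz j (fun w => (σ w : ℂ)) z := by
  have da := ha.ofReal_comp.diffAt hΩ hz
  have dσ : DifferentiableAt ℝ σ z :=
    ((hσ z hz).contDiffAt (hΩ.mem_nhds hz)).differentiableAt (by simp)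
  rw [dz_mul j da (((hσ.pow 16).ofReal_comp).diffAt hΩ hz),
    dz_comp_ofReal j (g := fun t => t ^ 16) (hasDerivAt_pow 16 (σ z)) dσ]
  push_cast; ring

lemma dzbar_dz_weight (j k : Fin n) (hΩ : IsOpen Ω) {a σ : Cn n → ℝ} (ha : ContDiffOn ℝ ∞ a Ω)
    (hσ : ContDiffOn ℝ ∞ σ Ω) {z : Cn n} (hz : z ∈ Ω) :
    dzbar k (dz j (fun w => (a w : ℂ) * ((σ w ^ 16 : ℝ) : ℂ))) z
      = σ z ^ 16 * complexHessian a z j k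
        + 16 * σ z ^ 15 * (dz j (fun w => (a w : ℂ)) z * conj (dz k (fun w => (σ w : ℂ)) z)
          + dz j (fun w => (σ w : ℂ)) z * conj (dz k (fun w => (a w : ℂ)) z))
        + 240 * a z * σ z ^ 14
          * (dz j (fun w => (σ w : ℂ)) z * conj (dz k (fun w => (σ w : ℂ)) z))
        + 16 * a z * σ z ^ 15 * complexHessian σ z j k := by
  have dσ : DifferentiableAt ℝ σ z :=
    ((hσ z hz).contDiffAt (hΩ.mem_nhds hz)).differentiableAt (by simp)
  have da := ha.ofReal_comp.diffAt hΩ hz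
  have da1 := (contDiffOn_dz j hΩ ha.ofReal_comp).diffAt hΩ hz
  have dσ1 := (contDiffOn_dz j hΩ hσ.ofReal_comp).diffAt hΩ hz
  have d16 := ((hσ.pow 16).ofReal_comp).diffAt hΩ hz
  have d15 := ((hσ.pow 15).ofReal_comp).diffAt hΩ hz
  have ev : dz j (fun w => (a w : ℂ) * ((σ w ^ 16 : ℝ) : ℂ)) =ᶠ[𝓝 z]
      fun w => ((σ w ^ 16 : ℝ) : ℂ) * dz j (fun w => (a w : ℂ)) w
        + (16 * (a w : ℂ)) * (((σ w ^ 15 : ℝ) : ℂ) * dz j (fun w => (σ w : ℂ)) w) := by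
    filter_upwards [hΩ.mem_nhds hz] with w hw
    rw [dz_weight j hΩ ha hσ hw]; push_cast; ring
  have d15' : DifferentiableAt ℝ
      (fun w => ((σ w ^ 15 : ℝ) : ℂ) * dz j (fun w => (σ w : ℂ)) w) z := d15.mul dσ1
  have da16 : DifferentiableAt ℝ (fun w => 16 * (a w : ℂ)) z := da.const_mul 16
  have hc : dzbar k (fun w => 16 * (a w : ℂ)) z = 16 * dzbar k (fun w => (a w : ℂ)) z := by
    rw [dzbar_mul k (differentiableAt_const _) da]
    simp [dzbar_eq]
  have m1 : DifferentiableAt ℝ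
      (fun w => ((σ w ^ 16 : ℝ) : ℂ) * dz j (fun w => (a w : ℂ)) w) z := d16.mul da1
  have m2 : DifferentiableAt ℝ (fun w => (16 * (a w : ℂ))
      * (((σ w ^ 15 : ℝ) : ℂ) * dz j (fun w => (σ w : ℂ)) w)) z := da16.mul d15'
  have ca : complexHessian a z j k = dzbar k (dz j (fun w => (a w : ℂ))) z :=
    dz_dzbar_comm j k hΩ ha.ofReal_comp hz
  have cσ : complexHessian σ z j k = dzbar k (dz j (fun w => (σ w : ℂ))) z :=
    dz_dzbar_comm j k hΩ hσ.ofReal_comp hz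
  have c16 := dzbar_comp_ofReal k (g := fun t => t ^ 16) (hasDerivAt_pow 16 (σ z)) dσ
  have c15 := dzbar_comp_ofReal k (g := fun t => t ^ 15) (hasDerivAt_pow 15 (σ z)) dσ
  rw [ca, cσ, dzbar_congr k ev, dzbar_add k m1 m2, dzbar_mul k d16 da1,
    dzbar_mul k da16 d15', dzbar_mul k d15 dσ1, hc, c16, c15, dzbar_ofReal, dzbar_ofReal]
  push_cast; ring

/-- Expands the derivatives of the weight aσ^16 and collects the double sums into the scalars θ, A,
S, La, Ls, C on which `weight_pointwise` operates. -/
lemma sum_morreyTerm (hΩ : IsOpen Ω) {a σ : Cn n → ℝ} (ha : ContDiffOn ℝ ∞ a Ω)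
    (hσ : ContDiffOn ℝ ∞ σ Ω) (U : Fin n → Cn n → ℂ) {z : Cn n} (hz : z ∈ Ω)
    {θ A S La Ls C : ℂ} (hθ : θ = divz U z)
    (hA : A = ∑ j, dz j (fun w => (a w : ℂ)) z * U j z)
    (hS : S = ∑ j, dz j (fun w => (σ w : ℂ)) z * U j z)
    (hLa : La = ∑ j, ∑ k, complexHessian a z j k * U j z * conj (U k z))
    (hLs : Ls = ∑ j, ∑ k, complexHessian σ z j k * U j z * conj (U k z))
    (hC : C = ∑ j, ∑ k, dzbar k (U j) z * conj (dzbar j (U k) z)) :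
    ∑ j, ∑ k, morreyTerm (fun w => (a w : ℂ) * ((σ w ^ 16 : ℝ) : ℂ)) U j k z
      = a z * σ z ^ 16 * C - a z * σ z ^ 16 * (θ * conj θ)
        - θ * conj (σ z ^ 16 * A + 16 * a z * σ z ^ 15 * S)
        - (σ z ^ 16 * La + 16 * σ z ^ 15 * (A * conj S + S * conj A)
          + 240 * a z * σ z ^ 14 * (S * conj S) + 16 * a z * σ z ^ 15 * Ls)
        - conj θ * (σ z ^ 16 * A + 16 * a z * σ z ^ 15 * S) := by
  have hV : σ z ^ 16 * A + 16 * a z * σ z ^ 15 * S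
      = ∑ j, dz j (fun w => (a w : ℂ) * ((σ w ^ 16 : ℝ) : ℂ)) z * U j z := by
    simp only [dz_weight _ hΩ ha hσ hz, hA, hS, Finset.mul_sum, ← Finset.sum_add_distrib]
    exact Finset.sum_congr rfl fun j _ => by ring
  have hbar : ∀ k, dzbar k (fun w => (a w : ℂ) * ((σ w ^ 16 : ℝ) : ℂ)) z
      = conj (dz k (fun w => (a w : ℂ) * ((σ w ^ 16 : ℝ) : ℂ)) z) := fun k => by
    have e : (fun w => (a w : ℂ) * ((σ w ^ 16 : ℝ) : ℂ)) = fun w => ((a w * σ w ^ 16 : ℝ) : ℂ) := by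
      ext w; simp
    rw [e]; exact dzbar_ofReal k _ z
  have hp : ∀ f g : Fin n → ℂ, (∑ j, f j) * conj (∑ k, g k) = ∑ j, ∑ k, f j * conj (g k) :=
    fun f g => by rw [map_sum, Finset.sum_mul_sum]
  have hp' : ∀ f g : Fin n → ℂ, conj (∑ k, g k) * (∑ j, f j) = ∑ j, ∑ k, f j * conj (g k) :=
    fun f g => by rw [mul_comm, hp]
  rw [hV, hA, hS, hLa, hLs, hC, hθ, divz, hp, hp, hp, hp, hp, hp']
  simp only [Finset.mul_sum, ← Finset.sum_add_distrib, ← Finset.sum_sub_distrib]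
  refine Finset.sum_congr rfl fun j _ => Finset.sum_congr rfl fun k _ => ?_
  rw [morreyTerm, dzbar_dz_weight j k hΩ ha hσ hz, hbar]
  simp only [map_mul]
  push_cast
  ring

/-- The twisted weighted estimate for test forms. -/
theorem weighted_estimate (hΩ : IsOpen Ω) {a σ : Cn n → ℝ} (ha : ContDiffOn ℝ ∞ a Ω)
    (hσ : ContDiffOn ℝ ∞ σ Ω) {M : ℝ} (ha0 : ∀ z ∈ Ω, 0 < a z) (haM : ∀ z ∈ Ω, a z ≤ M)
    (hσ0 : ∀ z ∈ Ω, 0 < σ z) (hLs : ∀ z ∈ Ω, ∀ ξ, leviForm σ z ξ ≤ 0)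
    {B : Cn n → (Fin n → ℂ) → ℝ}
    (hA : ∀ z ∈ Ω, ∀ ξ : Fin n → ℂ, ‖∑ j, dz j (fun w => (a w : ℂ)) z * ξ j‖ ^ 2 + a z * B z ξ
      ≤ -a z * leviForm a z ξ)
    {U : Fin n → Cn n → ℂ} (hU : ∀ j, IsTest Ω (U j))
    (hB : IntegrableOn (fun z => σ z ^ 16 * B z (fun j => U j z)) Ω) :
    ∫ z in Ω, σ z ^ 16 * B z (fun j => U j z)
      ≤ 4 * M * ((∑ i : {p : Fin n × Fin n // p.1 < p.2},
          ∫ z in Ω, ‖σ z ^ 8 * (dzbar i.1.1 (U i.1.2) z - dzbar i.1.2 (U i.1.1) z)‖ ^ 2)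
        + ∫ z in Ω, ‖σ z ^ 8 * divz U z
            + 14 * σ z ^ 7 * ∑ j, dz j (fun w => (σ w : ℂ)) z * U j z‖ ^ 2) := by
  set W : Cn n → ℂ := fun w => (a w : ℂ) * ((σ w ^ 16 : ℝ) : ℂ) with hWdef
  have hW : ContDiffOn ℝ ∞ W Ω := ha.ofReal_comp.mul (hσ.pow 16).ofReal_comp
  have hE : IsTest Ω fun z => ∑ j, ∑ k, morreyTerm W U j k z :=
    IsTest.sum _ fun j => IsTest.sum _ fun k => isTest_morreyTerm hΩ hW hU j k
  have hE0 : ∫ z in Ω, (∑ j, ∑ k, morreyTerm W U j k z).re = 0 := by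
    have h1 : ∫ z in Ω, (∑ j, ∑ k, morreyTerm W U j k z) = 0 := by
      rw [integral_finsetSum _ fun j _ =>
        (IsTest.sum _ fun k => isTest_morreyTerm hΩ hW hU j k).integrableOn]
      refine Finset.sum_eq_zero fun j _ => ?_
      rw [integral_finsetSum _ fun k _ => (isTest_morreyTerm hΩ hW hU j k).integrableOn]
      exact Finset.sum_eq_zero fun k _ => integral_morreyTerm hΩ hW hU j k
    have h2 : ∫ z in Ω, (∑ j, ∑ k, morreyTerm W U j k z).re
        = (∫ z in Ω, ∑ j, ∑ k, morreyTerm W U j k z).re := integral_re hE.integrableOn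
    rw [h2, h1]; simp
  have hpow : ∀ m : ℕ, ContDiffOn ℝ ∞ (fun z => (σ z : ℂ) ^ m) Ω := fun m => hσ.ofReal_comp.pow m
  have i1 : ∀ i : {p : Fin n × Fin n // p.1 < p.2}, IsTest Ω fun z =>
      (σ z : ℂ) ^ 8 * (dzbar i.1.1 (U i.1.2) z - dzbar i.1.2 (U i.1.1) z) := fun i =>
    (((hU i.1.2).wirtinger i.1.1).sub ((hU i.1.1).wirtinger i.1.2)).mul_contDiffOn hΩ (hpow 8)
  have i2 : IsTest Ω fun z => (σ z : ℂ) ^ 8 * divz U z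
      + 14 * (σ z : ℂ) ^ 7 * ∑ j, dz j (fun w => (σ w : ℂ)) z * U j z :=
    ((IsTest.sum _ fun j => (hU j).dz j).mul_contDiffOn hΩ (hpow 8)).add
      ((IsTest.sum _ fun j => (hU j).mul_contDiffOn hΩ
        (contDiffOn_dz j hΩ hσ.ofReal_comp)).mul_contDiffOn hΩ (contDiffOn_const.mul (hpow 7)))
  have j1 := fun i => (i1 i).memLp.integrable_norm_pow (p := 2) (by norm_num)
  have j2 := i2.memLp.integrable_norm_pow (p := 2) (by norm_num)
  have j3 := (((integrable_finsetSum Finset.univ fun i _ => j1 i).add j2).const_mul (4 * M))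
  have hre : IntegrableOn (fun z => (∑ j, ∑ k, morreyTerm W U j k z).re) Ω :=
    hE.integrableOn.re
  -- The vanishing integral of the Morrey–Kohn terms is added to the right side, so that the
  -- inequality becomes a pointwise one.
  rw [← integral_finsetSum _ fun i _ => j1 i,
    ← integral_add (integrable_finsetSum _ fun i _ => j1 i) j2,
    ← integral_const_mul, ← add_zero (∫ z in Ω, 4 * M * _), ← hE0]
  refine le_trans ?_ (integral_add j3 hre).le
  refine setIntegral_mono_on hB (j3.add hre) hΩ.measurableSet fun z hz => ?_
  have hD := sum_antisymm_sq fun j k => dzbar j (U k) z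
  have key := weight_pointwise (a := a z) (σ := σ z) (B := B z fun j => U j z)
    (D := ∑ j, ∑ k, ‖dzbar k (U j) z‖ ^ 2) (θ := divz U z)
    (S := ∑ j, dz j (fun w => (σ w : ℂ)) z * U j z)
    (C := ∑ j, ∑ k, dzbar k (U j) z * conj (dzbar j (U k) z))
    (ha0 z hz) (hσ0 z hz) (hLs z hz fun j => U j z) (hA z hz fun j => U j z) (by positivity)
    (by rw [← hD]; positivity)
  rw [← sum_morreyTerm hΩ ha hσ U hz rfl rfl rfl rfl rfl rfl] at key
  refine key.trans (add_le_add_left ?_ _)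
  rw [← hD]
  have e : ∑ i : {p : Fin n × Fin n // p.1 < p.2},
      ‖(σ z : ℂ) ^ 8 * (dzbar i.1.1 (U i.1.2) z - dzbar i.1.2 (U i.1.1) z)‖ ^ 2
      = σ z ^ 16 * ∑ i : {p : Fin n × Fin n // p.1 < p.2},
        ‖dzbar i.1.1 (U i.1.2) z - dzbar i.1.2 (U i.1.1) z‖ ^ 2 := by
    rw [Finset.mul_sum]
    refine Finset.sum_congr rfl fun i _ => ?_
    rw [norm_mul, norm_pow, Complex.norm_real, Real.norm_of_nonneg (hσ0 z hz).le]; ring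
  simp only [Pi.add_apply]
  rw [e]
  have := haM z hz
  have := (hσ0 z hz).le
  gcongr

end Morrey

/-! ### Mollification -/

section Mollification

open ContinuousLinearMap

variable {n : ℕ} {Ω : Set (Cn n)}

/-- Smooth bumps at the origin with supports shrinking to a point. -/
def bumpSeq (n m : ℕ) : ContDiffBump (0 : Cn n) where
  rIn := 1 / (2 * ((m : ℝ) + 1))
  rOut := 1 / ((m : ℝ) + 1)
  rIn_pos := by positivity
  rIn_lt_rOut := by
    apply one_div_lt_one_div_of_lt <;> nlinarith [(Nat.cast_nonneg m : (0:ℝ) ≤ m)]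

/-- Mollification of `f` at scale `1 / (m + 1)`. -/
def moll (m : ℕ) (f : Cn n → ℂ) : Cn n → ℂ :=
  convolution ((bumpSeq n m).normed volume) f (lsmul ℝ ℝ) volume

lemma bumpSeq_rOut_tendsto : Tendsto (fun m => (bumpSeq n m).rOut) atTop (𝓝 0) :=
  tendsto_one_div_add_atTop_nhds_zero_nat

lemma moll_apply (m : ℕ) (f : Cn n → ℂ) (z : Cn n) :
    moll m f z = ∫ t, (bumpSeq n m).normed volume (z - t) • f t := by
  rw [moll, convolution_eq_swap]; rfl

lemma moll_contDiff (m : ℕ) {f : Cn n → ℂ} (hf : LocallyIntegrable f) :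
    ContDiff ℝ ∞ (moll m f) :=
  ((bumpSeq n m).hasCompactSupport_normed).contDiff_convolution_left (n := ⊤) _
    ((bumpSeq n m).contDiff_normed) hf

lemma moll_isTest {K : Set (Cn n)} (hK : IsCompact K) (hΩ : IsOpen Ω) (hKΩ : K ⊆ Ω)
    {f : Cn n → ℂ} (hf : LocallyIntegrable f) (hfK : ∀ z, z ∉ K → f z = 0) :
    ∀ᶠ m in atTop, IsTest Ω (moll m f) := by
  obtain ⟨δ, hδ, hδK⟩ := hK.exists_cthickening_subset_open hΩ hKΩ
  filter_upwards [(bumpSeq_rOut_tendsto (n := n)).eventually (gt_mem_nhds hδ)] with m hm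
  have hs : Function.support (moll m f) ⊆ Metric.cthickening δ K := by
    refine (support_convolution_subset _).trans ?_
    rintro _ ⟨x, hx, y, hy, rfl⟩
    have hy' : y ∈ K := by by_contra h; exact hy (hfK y h)
    rw [(bumpSeq n m).support_normed_eq] at hx
    refine Metric.mem_cthickening_of_dist_le _ y _ _ hy' ?_
    simp only [Metric.mem_ball, dist_zero_right] at hx
    simpa [dist_eq_norm] using (hx.trans hm).le
  have hs' : tsupport (moll m f) ⊆ Metric.cthickening δ K :=
    closure_minimal hs Metric.isClosed_cthickening
  exact ⟨moll_contDiff m hf, hK.cthickening.of_isClosed_subset (isClosed_tsupport _) hs',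
    hs'.trans hδK⟩

lemma integrable_normed_smul (m : ℕ) {E : Type*} [NormedAddCommGroup E] [NormedSpace ℝ E]
    {f : Cn n → E} (hf : LocallyIntegrable f) (z : Cn n) :
    Integrable fun t => (bumpSeq n m).normed volume (z - t) • f t := by
  have h := ((bumpSeq n m).hasCompactSupport_normed (μ := (volume : Measure (Cn n)))).convolutionExists_left
    (lsmul ℝ ℝ) (bumpSeq n m).continuous_normed hf z
  exact convolutionExistsAt_iff_integrable_swap.1 h

/-- Jensen's inequality for the probability density ρ(z - ·), obtained from nonnegativity of the
variance of ‖f‖ about its mean c. -/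
lemma norm_moll_sq_le (m : ℕ) {f : Cn n → ℂ} (hf : MemLp f 2) (z : Cn n) :
    ‖moll m f z‖ ^ 2
      ≤ convolution ((bumpSeq n m).normed volume) (fun t => ‖f t‖ ^ 2) (lsmul ℝ ℝ) volume z := by
  set ρ := (bumpSeq n m).normed (volume : Measure (Cn n)) with hρ
  have hf1 : LocallyIntegrable f := hf.locallyIntegrable (by norm_num)
  have hf2 : LocallyIntegrable fun t => ‖f t‖ ^ 2 :=
    (hf.integrable_norm_pow (p := 2) (by norm_num)).locallyIntegrable
  have hρ0 : ∀ t, 0 ≤ ρ t := (bumpSeq n m).nonneg_normed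
  have i0 : Integrable fun t => ρ (z - t) :=
    ((bumpSeq n m).integrable_normed).comp_sub_left z
  have e0 : ∫ t, ρ (z - t) = 1 := by
    rw [integral_sub_left_eq_self ρ volume z]; exact (bumpSeq n m).integral_normed
  have i1 : Integrable fun t => ρ (z - t) * ‖f t‖ := by
    have := (integrable_normed_smul m hf1 z).norm
    refine this.congr (Eventually.of_forall fun t => ?_)
    simp only [norm_smul, ← hρ, Real.norm_of_nonneg (hρ0 _)]
  have i2 : Integrable fun t => ρ (z - t) * ‖f t‖ ^ 2 := integrable_normed_smul m hf2 z
  have h1 : ‖moll m f z‖ ≤ ∫ t, ρ (z - t) * ‖f t‖ := by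
    rw [moll_apply]
    refine (norm_integral_le_integral_norm _).trans_eq (integral_congr_ae (Eventually.of_forall fun t => ?_))
    simp only [norm_smul, ← hρ, Real.norm_of_nonneg (hρ0 _)]
  set c := ∫ t, ρ (z - t) * ‖f t‖ with hc
  have h2 : 0 ≤ ∫ t, ρ (z - t) * (‖f t‖ - c) ^ 2 :=
    integral_nonneg fun t => mul_nonneg (hρ0 _) (sq_nonneg _)
  have h3 : ∫ t, ρ (z - t) * (‖f t‖ - c) ^ 2 = (∫ t, ρ (z - t) * ‖f t‖ ^ 2) - c ^ 2 := by
    have e : ∀ t, ρ (z - t) * (‖f t‖ - c) ^ 2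
        = ρ (z - t) * ‖f t‖ ^ 2 - (2 * c) * (ρ (z - t) * ‖f t‖) + c ^ 2 * ρ (z - t) := by
      intro t; ring
    simp only [e]
    have i3 : Integrable fun t => ρ (z - t) * ‖f t‖ ^ 2 - (2 * c) * (ρ (z - t) * ‖f t‖) :=
      i2.sub (i1.const_mul _)
    rw [integral_add i3 (i0.const_mul _), integral_sub i2 (i1.const_mul _),
      integral_const_mul, integral_const_mul, e0, ← hc]
    ring
  rw [convolution_eq_swap]
  have h4 : ‖moll m f z‖ ^ 2 ≤ c ^ 2 := pow_le_pow_left₀ (norm_nonneg _) h1 2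
  have h5 : c ^ 2 ≤ ∫ t, ρ (z - t) * ‖f t‖ ^ 2 := by linarith
  exact h4.trans h5

lemma moll_sq (m : ℕ) {f : Cn n → ℂ} (hf : MemLp f 2) :
    Integrable (fun z => ‖moll m f z‖ ^ 2) ∧ ∫ z, ‖moll m f z‖ ^ 2 ≤ ∫ z, ‖f z‖ ^ 2 := by
  have hf1 : LocallyIntegrable f := hf.locallyIntegrable (by norm_num)
  have i2 := hf.integrable_norm_pow (p := 2) (by norm_num)
  have hint := ((bumpSeq n m).integrable_normed (μ := volume)).integrable_convolution
    (lsmul ℝ ℝ) i2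
  have e := integral_convolution (lsmul ℝ ℝ) ((bumpSeq n m).integrable_normed (μ := volume)) i2
  have h1 : Integrable (fun z => ‖moll m f z‖ ^ 2) := by
    refine hint.mono' ((moll_contDiff m hf1).continuous.norm.pow 2).aestronglyMeasurable ?_
    refine Eventually.of_forall fun z => ?_
    rw [Real.norm_of_nonneg (sq_nonneg _)]
    exact norm_moll_sq_le m hf z
  refine ⟨h1, (integral_mono h1 hint (norm_moll_sq_le m hf)).trans_eq ?_⟩
  rw [e, (bumpSeq n m).integral_normed]; simp

/-- Mollification does not increase the L² norm and converges almost everywhere; Fatou's lemma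
applied to 2|f|² + 2|f_m|² - |f_m - f|² ≥ 0 upgrades this to convergence in L². -/
lemma moll_tendsto {f : Cn n → ℂ} (hf : MemLp f 2) :
    Tendsto (fun m => ∫ z, ‖moll m f z - f z‖ ^ 2) atTop (𝓝 0) := by
  have hf1 : LocallyIntegrable f := hf.locallyIntegrable (by norm_num)
  have i2 := hf.integrable_norm_pow (p := 2) (by norm_num)
  have hm : ∀ m, MemLp (moll m f) 2 := fun m =>
    (memLp_two_iff_integrable_sq_norm (moll_contDiff m hf1).continuous.aestronglyMeasurable).2
      (moll_sq m hf).1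
  have hae : ∀ᵐ z, Tendsto (fun m => moll m f z) atTop (𝓝 (f z)) := by
    -- The ratio 2 of outer to inner radius is the shape bound required for convergence at Lebesgue
    -- points.
    refine ContDiffBump.ae_convolution_tendsto_right_of_locallyIntegrable (K := 2)
      bumpSeq_rOut_tendsto (Eventually.of_forall fun m => ?_) hf1
    simp only [bumpSeq]
    have : (0 : ℝ) < (m : ℝ) + 1 := by positivity
    field_simp; norm_num
  set N := ∫ z, ‖f z‖ ^ 2 with hN
  set d : ℕ → ℝ := fun m => ∫ z, ‖moll m f z - f z‖ ^ 2 with hd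
  have idm : ∀ m, Integrable fun z => ‖moll m f z - f z‖ ^ 2 := fun m =>
    ((hm m).sub hf).integrable_norm_pow (p := 2) (by norm_num)
  let h : ℕ → Cn n → ℝ := fun m z => 2 * ‖f z‖ ^ 2 + 2 * ‖moll m f z‖ ^ 2 - ‖moll m f z - f z‖ ^ 2
  have h0 : ∀ m z, 0 ≤ h m z := by
    intro m z
    have := parallelogram_law_with_norm ℝ (moll m f z) (f z)
    have h3 := sq_nonneg ‖moll m f z + f z‖
    simp only [h]; nlinarith
  have ih : ∀ m, Integrable (h m) := fun m =>
    ((i2.const_mul 2).add ((moll_sq m hf).1.const_mul 2)).sub (idm m)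
  -- The pointwise limit of h integrates to 4N, so Fatou forces limsup d_m ≤ 0.
  have eh : ∀ m, ∫ z, h m z ≤ 4 * N - d m := by
    intro m
    have : ∫ z, h m z = 2 * N + 2 * (∫ z, ‖moll m f z‖ ^ 2) - d m := by
      have i3 : Integrable fun z => 2 * ‖f z‖ ^ 2 + 2 * ‖moll m f z‖ ^ 2 :=
        (i2.const_mul 2).add ((moll_sq m hf).1.const_mul 2)
      rw [integral_sub i3 (idm m), integral_add (i2.const_mul 2) ((moll_sq m hf).1.const_mul 2), integral_const_mul,
        integral_const_mul]
    rw [this]; linarith [(moll_sq m hf).2]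
  have fatou := lintegral_liminf_le' (u := atTop) (μ := (volume : Measure (Cn n)))
    (f := fun m z => ENNReal.ofReal (h m z)) fun m => (ih m).aemeasurable.ennreal_ofReal
  have hl : ∫⁻ z, liminf (fun m => ENNReal.ofReal (h m z)) atTop = ENNReal.ofReal (4 * N) := by
    rw [hN, ← integral_const_mul, ofReal_integral_eq_lintegral_ofReal (i2.const_mul 4)
      (Eventually.of_forall fun z => by positivity)]
    refine lintegral_congr_ae ?_
    filter_upwards [hae] with z hz
    refine Tendsto.liminf_eq ((ENNReal.continuous_ofReal.tendsto _).comp ?_)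
    have h1 := hz.norm.pow 2
    have h2 := (hz.sub_const (f z)).norm.pow 2
    have h3 := ((h1.const_mul 2).const_add (2 * ‖f z‖ ^ 2)).sub h2
    convert h3 using 2
    rw [sub_self, norm_zero]; ring
  have hr : ∀ m, ∫⁻ z, ENNReal.ofReal (h m z) ≤ ENNReal.ofReal (4 * N - d m) := fun m => by
    rw [← ofReal_integral_eq_lintegral_ofReal (ih m) (Eventually.of_forall (h0 m))]
    exact ENNReal.ofReal_le_ofReal (eh m)
  have hd0 : ∀ m, 0 ≤ d m := fun m => integral_nonneg fun z => sq_nonneg _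
  have hd4 : ∀ m, d m ≤ 4 * N := fun m => by
    have := (integral_nonneg (h0 m)).trans (eh m)
    linarith
  rw [hl] at fatou
  have fatou' : ENNReal.ofReal (4 * N) ≤ liminf (fun m => ENNReal.ofReal (4 * N - d m)) atTop :=
    fatou.trans (liminf_le_liminf (Eventually.of_forall hr))
  have hN0 : 0 ≤ N := integral_nonneg fun z => sq_nonneg _
  refine Metric.tendsto_atTop'.2 fun ε hε => ?_
  rcases hN0.eq_or_lt with h | hpos
  · refine ⟨0, fun m _ => ?_⟩
    have := hd4 m
    have h00 : d m = 0 := le_antisymm (by linarith) (hd0 m)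
    simpa [h00] using hε
  · have hlt : ENNReal.ofReal (4 * N - ε) < ENNReal.ofReal (4 * N) :=
      (ENNReal.ofReal_lt_ofReal_iff (by linarith)).2 (by linarith)
    have hev := eventually_lt_of_lt_liminf (hlt.trans_le fatou')
    obtain ⟨m₀, hm₀⟩ := eventually_atTop.1 hev
    refine ⟨m₀, fun m hm => ?_⟩
    have h5 := hm₀ m hm.le
    rw [Real.dist_eq, sub_zero, abs_of_nonneg (hd0 m)]
    have h6 := (ENNReal.ofReal_lt_ofReal_iff').1 h5
    linarith [h6.1]

/-- The cut-off is 1 in a neighbourhood of K and not merely on K, so its derivatives vanish on K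
too. -/
lemma exists_cutoff {K : Set (Cn n)} (hK : IsCompact K) (hΩ : IsOpen Ω) (hKΩ : K ⊆ Ω) :
    ∃ χ : Cn n → ℝ, IsTest Ω (fun z => (χ z : ℂ)) ∧ (∀ᶠ z in 𝓝ˢ K, χ z = 1) ∧
      ∀ z, χ z ∈ Set.Icc (0 : ℝ) 1 := by
  obtain ⟨δ, hδ, hδK⟩ := hK.exists_cthickening_subset_open hΩ hKΩ
  obtain ⟨χ, h0, h1, h01⟩ := exists_contMDiffMap_zero_one_nhds_of_isClosed (n := ⊤)
    (modelWithCornersSelf ℝ (Cn n))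
    (Metric.isOpen_thickening (δ := δ) (E := K)).isClosed_compl hK.isClosed
    (Set.disjoint_compl_left_iff_subset.2 (Metric.self_subset_thickening hδ K))
  have hs : tsupport (fun z => (χ z : ℂ)) ⊆ Metric.cthickening δ K := by
    refine closure_minimal (fun z hz => ?_) Metric.isClosed_cthickening
    refine Metric.thickening_subset_cthickening _ _ ?_
    by_contra h
    have h00 := h0.self_of_nhdsSet z h
    exact hz (by simp [h00])
  exact ⟨χ, ⟨Complex.ofRealCLM.contDiff.comp χ.contMDiff.contDiff,
    hK.cthickening.of_isClosed_subset (isClosed_tsupport _) hs, hs.trans hδK⟩, h1, h01⟩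

/-! ### First-order equations in the weak sense -/

/-- `∑_i ℓ_i(d f_i) = g` in the sense of distributions on `Ω`. -/
def WeakEq (Ω : Set (Cn n)) (ℓ : Fin n → ((Cn n →L[ℝ] ℂ) →L[ℂ] ℂ)) (f : Fin n → Cn n → ℂ)
    (g : Cn n → ℂ) : Prop :=
  ∀ φ, IsTest Ω φ → ∑ i, ∫ z in Ω, f i z * ℓ i (fderiv ℝ φ z) = -∫ z in Ω, g z * φ z

/-- The operators have constant coefficients, so mollification commutes with them and no commutator
estimate is needed: the weak equation is tested on t ↦ ρ(z - t), cut off outside the support K of f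
and g. -/
lemma WeakEq.moll (hΩ : IsOpen Ω) {K : Set (Cn n)} (hK : IsCompact K) (hKΩ : K ⊆ Ω)
    {ℓ : Fin n → ((Cn n →L[ℝ] ℂ) →L[ℂ] ℂ)} {f : Fin n → Cn n → ℂ} {g : Cn n → ℂ}
    (hf : ∀ i, LocallyIntegrable (f i)) (hfK : ∀ i z, z ∉ K → f i z = 0)
    (hgK : ∀ z, z ∉ K → g z = 0) (h : WeakEq Ω ℓ f g) (m : ℕ)
    (z : Cn n) : ∑ i, ℓ i (fderiv ℝ (_root_.moll m (f i)) z) = _root_.moll m g z := by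
  obtain ⟨χ, hχ, hχ1, -⟩ := exists_cutoff hK hΩ hKΩ
  set ρ := (bumpSeq n m).normed (volume : Measure (Cn n)) with hρ
  have hρs : ContDiff ℝ ∞ ρ := (bumpSeq n m).contDiff_normed
  have hs : ContDiff ℝ ∞ fun t => ((ρ (z - t) : ℝ) : ℂ) :=
    Complex.ofRealCLM.contDiff.comp (hρs.comp (contDiff_const.sub contDiff_id))
  have hφ : IsTest Ω fun t => ((ρ (z - t) : ℝ) : ℂ) * (χ t : ℂ) :=
    hχ.mul_contDiffOn hΩ hs.contDiffOn
  have hφK : ∀ t ∈ K, ((fun t => ((ρ (z - t) : ℝ) : ℂ) * (χ t : ℂ)) =ᶠ[𝓝 t]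
      fun t => ((ρ (z - t) : ℝ) : ℂ)) := by
    intro t ht
    filter_upwards [hχ1.filter_mono (nhds_le_nhdsSet ht)] with w hw
    simp [hw]
  have hD : ∀ t, fderiv ℝ (fun t => ((ρ (z - t) : ℝ) : ℂ)) t
      = -(Complex.ofRealCLM.comp (fderiv ℝ ρ (z - t))) := by
    intro t
    have h1 : HasFDerivAt ρ (fderiv ℝ ρ (z - t)) (z - t) :=
      (hρs.differentiable (by simp) _).hasFDerivAt
    have h2 : HasFDerivAt (fun t => ρ (z - t)) (-fderiv ℝ ρ (z - t)) t := by
      have := h1.comp t ((hasFDerivAt_id t).const_sub z)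
      simpa using! this
    have h3 : HasFDerivAt (fun t => ((ρ (z - t) : ℝ) : ℂ)) _ t :=
      Complex.ofRealCLM.hasFDerivAt.comp t h2
    rw [h3.fderiv]; simp
  have hset : ∀ a b : Cn n → ℂ, (∀ z, z ∉ K → a z = 0) →
      ∫ t in Ω, a t * b t = ∫ t, a t * b t := fun a b ha =>
    setIntegral_eq_integral_of_forall_compl_eq_zero fun t ht => by simp [ha t fun h => ht (hKΩ h)]
  have key := h _ hφ
  rw [hset g _ hgK] at key
  have e1 : ∫ t, g t * (((ρ (z - t) : ℝ) : ℂ) * (χ t : ℂ)) = _root_.moll m g z := by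
    rw [moll_apply]
    refine integral_congr_ae (Eventually.of_forall fun t => ?_)
    by_cases ht : t ∈ K
    · have := (hφK t ht).eq_of_nhds
      calc _ = g t * ((ρ (z - t) : ℝ) : ℂ) := congrArg (g t * ·) this
        _ = ρ (z - t) • g t := by rw [Complex.real_smul, mul_comm]
    · simp [hgK t ht]
  have e2 : ∀ i, ∫ t in Ω, f i t * ℓ i (fderiv ℝ (fun t => ((ρ (z - t) : ℝ) : ℂ) * (χ t : ℂ)) t)
      = -ℓ i (fderiv ℝ (_root_.moll m (f i)) z) := by
    intro i
    rw [hset (f i) _ (hfK i)]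
    have hc : HasCompactSupport ρ := (bumpSeq n m).hasCompactSupport_normed
    have hd := (hc.hasFDerivAt_convolution_left (lsmul ℝ ℝ) (μ := volume)
      (hρs.of_le (by simp)) (hf i) z).fderiv
    have hint := ((hc.fderiv ℝ).convolutionExists_left ((lsmul ℝ ℝ : ℝ →L[ℝ] ℂ →L[ℝ] ℂ).precompL (Cn n))
      (hρs.continuous_fderiv (by simp)) (hf i) z)
    have hint' := convolutionExistsAt_iff_integrable_swap.1 hint
    have hd' : fderiv ℝ (_root_.moll m (f i)) z = _ := hd
    rw [hd', convolution_eq_swap]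
    have := (ℓ i).restrictScalars ℝ |>.integral_comp_comm hint'
    simp only [ContinuousLinearMap.coe_restrictScalars'] at this
    rw [← this, ← integral_neg]
    refine integral_congr_ae (Eventually.of_forall fun t => ?_)
    by_cases ht : t ∈ K
    · have e3 : ((lsmul ℝ ℝ : ℝ →L[ℝ] ℂ →L[ℝ] ℂ).precompL (Cn n) (fderiv ℝ ρ (z - t))) (f i t)
          = f i t • (Complex.ofRealCLM.comp (fderiv ℝ ρ (z - t))) := by
        ext v
        simp [precompL_apply, mul_comm]
      simp only [(hφK t ht).fderiv_eq, hD, e3, map_smul, map_neg, smul_eq_mul, mul_neg]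
    · simp [hfK i t ht]
  simp only [e2, e1, Finset.sum_neg_distrib, neg_inj] at key
  exact key

end Mollification

/-! ### Convergence in `L²(Ω)` -/

section L2Convergence

variable {n : ℕ} {Ω : Set (Cn n)}

/-- Convergence in `L²(Ω)` of a sequence of square-integrable functions. -/
def L2Tendsto (Ω : Set (Cn n)) (a : ℕ → Cn n → ℂ) (a₀ : Cn n → ℂ) : Prop :=
  (∀ m, MemLp (a m) 2 (volume.restrict Ω)) ∧ MemLp a₀ 2 (volume.restrict Ω) ∧
    Tendsto (fun m => eLpNorm (a m - a₀) 2 (volume.restrict Ω)) atTop (𝓝 0)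

lemma MemLp.mul_bdd {μ : Measure (Cn n)} {f b : Cn n → ℂ} {C : ℝ} (hf : MemLp f 2 μ)
    (hb : AEStronglyMeasurable b μ) (hC : ∀ᵐ z ∂μ, ‖b z‖ ≤ C) :
    MemLp (fun z => b z * f z) 2 μ := by
  refine hf.of_le_mul (c := C) (hb.mul hf.1) ?_
  filter_upwards [hC] with z hz
  rw [norm_mul]
  gcongr

lemma norm_toLp_sq {μ : Measure (Cn n)} {f : Cn n → ℂ} (hf : MemLp f 2 μ) :
    ‖hf.toLp f‖ ^ 2 = ∫ z, ‖f z‖ ^ 2 ∂μ := by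
  have h := L2.inner_def (𝕜 := ℂ) (hf.toLp f) (hf.toLp f)
  have h2 : inner ℂ (hf.toLp f) (hf.toLp f) = ((‖hf.toLp f‖ ^ 2 : ℝ) : ℂ) := by
    rw [inner_self_eq_norm_sq_to_K]; norm_cast
  have h3 : ∫ z, inner ℂ (hf.toLp f z) (hf.toLp f z) ∂μ = ((∫ z, ‖f z‖ ^ 2 ∂μ : ℝ) : ℂ) := by
    rw [← integral_complex_ofReal]
    refine integral_congr_ae ?_
    filter_upwards [hf.coeFn_toLp] with z hz
    rw [hz, inner_self_eq_norm_sq_to_K]; norm_cast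
  rw [h2, h3] at h
  exact_mod_cast h

lemma norm_L2_sq (f : L2 Ω) : ‖f‖ ^ 2 = ∫ z in Ω, ‖f z‖ ^ 2 := by
  have := norm_toLp_sq (Lp.memLp f)
  rwa [Lp.toLp_coeFn] at this

namespace L2Tendsto

variable {a b : ℕ → Cn n → ℂ} {a₀ b₀ : Cn n → ℂ}

lemma toLp (h : L2Tendsto Ω a a₀) :
    Tendsto (fun m => (h.1 m).toLp (a m)) atTop (𝓝 (h.2.1.toLp a₀)) :=
  (Lp.tendsto_Lp_iff_tendsto_eLpNorm'' a h.1 a₀ h.2.1).2 h.2.2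

lemma norm_sq (h : L2Tendsto Ω a a₀) :
    Tendsto (fun m => ∫ z in Ω, ‖a m z‖ ^ 2) atTop (𝓝 (∫ z in Ω, ‖a₀ z‖ ^ 2)) := by
  simpa only [norm_toLp_sq] using h.toLp.norm.pow 2

lemma integral_mul_conj (h : L2Tendsto Ω a a₀) (h' : L2Tendsto Ω b b₀) :
    Tendsto (fun m => ∫ z in Ω, a m z * conj (b m z)) atTop
      (𝓝 (∫ z in Ω, a₀ z * conj (b₀ z))) := by
  have key : ∀ {f g : Cn n → ℂ} (hf : MemLp f 2 (volume.restrict Ω))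
      (hg : MemLp g 2 (volume.restrict Ω)),
      inner ℂ (hg.toLp g) (hf.toLp f) = ∫ z in Ω, f z * conj (g z) := by
    intro f g hf hg
    rw [L2.inner_def]
    refine integral_congr_ae ?_
    filter_upwards [hf.coeFn_toLp, hg.coeFn_toLp] with z h1 h2
    rw [h1, h2]; rfl
  have := Tendsto.inner (𝕜 := ℂ) h'.toLp h.toLp
  simpa only [key] using this

lemma const (h : MemLp a₀ 2 (volume.restrict Ω)) : L2Tendsto Ω (fun _ => a₀) a₀ :=
  ⟨fun _ => h, h, by simp⟩

lemma add (h : L2Tendsto Ω a a₀) (h' : L2Tendsto Ω b b₀) :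
    L2Tendsto Ω (fun m z => a m z + b m z) (fun z => a₀ z + b₀ z) := by
  refine ⟨fun m => (h.1 m).add (h'.1 m), h.2.1.add h'.2.1, ?_⟩
  have h0 := h.2.2.add h'.2.2
  rw [add_zero] at h0
  refine tendsto_of_tendsto_of_tendsto_of_le_of_le tendsto_const_nhds h0 (fun _ => zero_le)
    fun m => ?_
  have e : (fun z => a m z + b m z) - (fun z => a₀ z + b₀ z) = (a m - a₀) + (b m - b₀) := by
    ext z; simp only [Pi.sub_apply, Pi.add_apply]; ring
  rw [e]
  exact eLpNorm_add_le ((h.1 m).sub h.2.1).1 ((h'.1 m).sub h'.2.1).1 (by norm_num)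

lemma mul_bdd {c : Cn n → ℂ} {C : ℝ} (hc : AEStronglyMeasurable c (volume.restrict Ω))
    (hC : ∀ᵐ z ∂(volume.restrict Ω), ‖c z‖ ≤ C) (h : L2Tendsto Ω a a₀) :
    L2Tendsto Ω (fun m z => c z * a m z) (fun z => c z * a₀ z) := by
  refine ⟨fun m => MemLp.mul_bdd (h.1 m) hc hC, MemLp.mul_bdd h.2.1 hc hC, ?_⟩
  have h0 := ENNReal.Tendsto.const_mul (a := ENNReal.ofReal C) h.2.2 (Or.inr ENNReal.ofReal_ne_top)
  rw [mul_zero] at h0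
  refine tendsto_of_tendsto_of_tendsto_of_le_of_le tendsto_const_nhds h0 (fun _ => zero_le)
    fun m => ?_
  refine eLpNorm_le_mul_eLpNorm_of_ae_le_mul ?_ 2
  filter_upwards [hC] with z hz
  simp only [Pi.sub_apply, ← mul_sub, norm_mul]
  gcongr

lemma sum {ι : Type*} (s : Finset ι) {a : ι → ℕ → Cn n → ℂ} {a₀ : ι → Cn n → ℂ}
    (h : ∀ i, L2Tendsto Ω (a i) (a₀ i)) :
    L2Tendsto Ω (fun m z => ∑ i ∈ s, a i m z) (fun z => ∑ i ∈ s, a₀ i z) := by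
  classical
  induction s using Finset.induction_on with
  | empty => simpa using const (Ω := Ω) (MemLp.zero' (ε := ℂ))
  | insert i s hi ih => simpa [Finset.sum_insert hi] using (h i).add ih

lemma of_dominated {g : Cn n → ℝ} (hg : MemLp g 2 (volume.restrict Ω))
    (ha : ∀ m, AEStronglyMeasurable (a m) (volume.restrict Ω))
    (ha₀ : AEStronglyMeasurable a₀ (volume.restrict Ω))
    (hb : ∀ m, ∀ᵐ z ∂(volume.restrict Ω), ‖a m z‖ ≤ g z)
    (hlim : ∀ᵐ z ∂(volume.restrict Ω), Tendsto (fun m => a m z) atTop (𝓝 (a₀ z))) :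
    L2Tendsto Ω a a₀ := by
  have hm : ∀ m, MemLp (a m) 2 (volume.restrict Ω) := fun m =>
    hg.mono (ha m) ((hb m).mono fun z hz => hz.trans (le_abs_self _))
  have hb₀ : ∀ᵐ z ∂(volume.restrict Ω), ‖a₀ z‖ ≤ g z := by
    filter_upwards [hlim, ae_all_iff.2 hb] with z h1 h2
    exact le_of_tendsto h1.norm (Eventually.of_forall h2)
  have hm₀ : MemLp a₀ 2 (volume.restrict Ω) :=
    hg.mono ha₀ (hb₀.mono fun z hz => hz.trans (le_abs_self _))
  refine ⟨hm, hm₀, ?_⟩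
  have hint : Tendsto (fun m => ∫ z in Ω, ‖a m z - a₀ z‖ ^ 2) atTop (𝓝 (∫ z in Ω, (0:ℝ))) := by
    refine tendsto_integral_of_dominated_convergence (fun z => (2 * g z) ^ 2)
      (fun m => ((ha m).sub ha₀).norm.pow 2) ?_ (fun m => ?_) ?_
    · have := (hg.const_mul 2).integrable_norm_pow (p := 2) (by norm_num)
      simpa [mul_pow, sq_abs] using this
    · filter_upwards [hb m, hb₀] with z h1 h2
      rw [Real.norm_of_nonneg (sq_nonneg _)]
      have := norm_sub_le (a m z) (a₀ z)
      exact pow_le_pow_left₀ (norm_nonneg _) (by linarith) 2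
    · filter_upwards [hlim] with z hz
      have := (hz.sub_const (a₀ z)).norm.pow 2
      simpa using this
  have h2 : Tendsto (fun m => ‖((hm m).sub hm₀).toLp (a m - a₀)‖ ^ 2) atTop (𝓝 0) := by
    simp only [norm_toLp_sq]
    simpa using hint
  have h3 : Tendsto (fun m => ‖((hm m).sub hm₀).toLp (a m - a₀)‖) atTop (𝓝 0) := by
    have := h2.sqrt
    simpa using this
  have h4 := ENNReal.tendsto_ofReal h3
  simpa [Lp.norm_toLp, ENNReal.ofReal_toReal ((hm _).sub hm₀).2.ne] using h4

end L2Tendsto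

lemma L2Tendsto_moll {f : Cn n → ℂ} (hf : MemLp f 2) : L2Tendsto Ω (fun m => moll m f) f := by
  have hf1 : LocallyIntegrable f := hf.locallyIntegrable (by norm_num)
  have hm : ∀ m, MemLp (moll m f) 2 := fun m =>
    (memLp_two_iff_integrable_sq_norm (moll_contDiff m hf1).continuous.aestronglyMeasurable).2
      (moll_sq m hf).1
  refine ⟨fun m => (hm m).restrict Ω, hf.restrict Ω, ?_⟩
  have h2 : Tendsto (fun m => ‖((hm m).sub hf).toLp (moll m f - f)‖ ^ 2) atTop (𝓝 0) := by
    simp only [norm_toLp_sq]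
    exact moll_tendsto hf
  have h3 : Tendsto (fun m => ‖((hm m).sub hf).toLp (moll m f - f)‖) atTop (𝓝 0) := by
    have := h2.sqrt
    simpa using this
  have h4 := ENNReal.tendsto_ofReal h3
  have h5 : Tendsto (fun m => eLpNorm (moll m f - f) 2 volume) atTop (𝓝 0) := by
    simpa [Lp.norm_toLp, ENNReal.ofReal_toReal ((hm _).sub hf).2.ne] using h4
  exact tendsto_of_tendsto_of_tendsto_of_le_of_le tendsto_const_nhds h5 (fun _ => zero_le)
    fun m => eLpNorm_mono_measure _ Measure.restrict_le_self

/-- The real part of the sesquilinear form of a matrix on the diagonal. -/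
def hform (B : Matrix (Fin n) (Fin n) ℂ) (ξ : Fin n → ℂ) : ℝ :=
  (∑ j, ∑ k, B j k * ξ j * conj (ξ k)).re

lemma hform_smul (B : Matrix (Fin n) (Fin n) ℂ) (t : ℝ) (ξ : Fin n → ℂ) :
    hform B (fun j => (t : ℂ) * ξ j) = t ^ 2 * hform B ξ := by
  have : ∑ j, ∑ k, B j k * ((t : ℂ) * ξ j) * conj ((t : ℂ) * ξ k)
      = ((t ^ 2 : ℝ) : ℂ) * ∑ j, ∑ k, B j k * ξ j * conj (ξ k) := by
    simp only [Finset.mul_sum, map_mul, Complex.conj_ofReal]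
    refine Finset.sum_congr rfl fun j _ => Finset.sum_congr rfl fun k _ => ?_
    push_cast; ring
  rw [hform, this, Complex.re_ofReal_mul, hform]

/-- Matrix functions with bounded measurable entries on `Ω`. -/
def IsBddMatrix (Ω : Set (Cn n)) (B : Cn n → Matrix (Fin n) (Fin n) ℂ) (C : ℝ) : Prop :=
  ∀ j k, AEStronglyMeasurable (fun z => B z j k) (volume.restrict Ω) ∧
    ∀ᵐ z ∂(volume.restrict Ω), ‖B z j k‖ ≤ C

lemma IsBddMatrix.integrable {B : Cn n → Matrix (Fin n) (Fin n) ℂ} {C : ℝ}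
    (hB : IsBddMatrix Ω B C) {u v : Fin n → Cn n → ℂ}
    (hu : ∀ j, MemLp (u j) 2 (volume.restrict Ω)) (hv : ∀ j, MemLp (v j) 2 (volume.restrict Ω)) :
    IntegrableOn (fun z => ∑ j, ∑ k, B z j k * u j z * conj (v k z)) Ω := by
  refine integrable_finsetSum _ fun j _ => integrable_finsetSum _ fun k _ => ?_
  exact (MemLp.mul_bdd (hu j) (hB j k).1 (hB j k).2).integrable_mul (hv k).star

/-- A bounded quadratic form is continuous for strong L² convergence; only boundedness of B is used,
not positivity. -/
lemma tendsto_integral_hform {B : Cn n → Matrix (Fin n) (Fin n) ℂ} {C : ℝ}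
    (hB : IsBddMatrix Ω B C) {u : ℕ → Fin n → Cn n → ℂ} {u₀ : Fin n → Cn n → ℂ}
    (hu : ∀ j, L2Tendsto Ω (fun m => u m j) (u₀ j)) :
    Tendsto (fun m => ∫ z in Ω, hform (B z) (fun j => u m j z)) atTop
      (𝓝 (∫ z in Ω, hform (B z) (fun j => u₀ j z))) := by
  have e : ∀ v : Fin n → Cn n → ℂ, (∀ j, MemLp (v j) 2 (volume.restrict Ω)) →
      ∫ z in Ω, hform (B z) (fun j => v j z)
        = (∑ j, ∑ k, ∫ z in Ω, B z j k * v j z * conj (v k z)).re := by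
    intro v hv
    have hi : ∀ j k, IntegrableOn (fun z => B z j k * v j z * conj (v k z)) Ω := fun j k =>
      (MemLp.mul_bdd (hv j) (hB j k).1 (hB j k).2).integrable_mul (hv k).star
    have h1 : ∫ z in Ω, hform (B z) (fun j => v j z)
        = (∫ z in Ω, ∑ j, ∑ k, B z j k * v j z * conj (v k z)).re :=
      integral_re (hB.integrable hv hv)
    rw [h1, integral_finsetSum _ fun j _ => integrable_finsetSum _ fun k _ => hi j k]
    congr 1
    exact Finset.sum_congr rfl fun j _ => integral_finsetSum _ fun k _ => hi j k
  rw [e u₀ fun j => (hu j).2.1]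
  simp only [fun m => e (u m) fun j => (hu j).1 m]
  refine (Complex.continuous_re.tendsto _).comp ?_
  refine tendsto_finsetSum _ fun j _ => tendsto_finsetSum _ fun k _ => ?_
  exact ((hu j).mul_bdd (hB j k).1 (hB j k).2).integral_mul_conj (hu k)

end L2Convergence

/-! ### The weighted estimate for forms in the weak domain -/

section WeakDomain

variable {n : ℕ} {Ω : Set (Cn n)}

/-- Local integrability against test functions. -/
def TestIntegrable (Ω : Set (Cn n)) (f : Cn n → ℂ) : Prop :=
  ∀ φ, IsTest Ω φ → IntegrableOn (fun z => f z * φ z) Ω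

lemma TestIntegrable.of_memLp {f : Cn n → ℂ} (hf : MemLp f 2 (volume.restrict Ω)) :
    TestIntegrable Ω f := fun _ h => hf.integrable_mul h.memLp

lemma TestIntegrable.mul {f a : Cn n → ℂ} (hΩ : IsOpen Ω) (ha : ContDiffOn ℝ ∞ a Ω)
    (hf : TestIntegrable Ω f) : TestIntegrable Ω fun z => a z * f z := fun φ h => by
  refine (hf _ (h.mul_contDiffOn hΩ ha)).congr (Eventually.of_forall fun z => ?_)
  simp only; ring

/-- Leibniz rule in the sense of distributions: the factor a is moved onto the test function. -/
lemma WeakEq.mul (hΩ : IsOpen Ω) {ℓ : Fin n → ((Cn n →L[ℝ] ℂ) →L[ℂ] ℂ)} {f : Fin n → Cn n → ℂ}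
    {g a : Cn n → ℂ} (hf : ∀ i, TestIntegrable Ω (f i)) (hg : TestIntegrable Ω g)
    (ha : ContDiffOn ℝ ∞ a Ω) (h : WeakEq Ω ℓ f g) :
    WeakEq Ω ℓ (fun i z => a z * f i z)
      (fun z => a z * g z + ∑ i, ℓ i (fderiv ℝ a z) * f i z) := by
  intro φ hφ
  have key := h _ (hφ.mul_contDiffOn hΩ ha)
  have hd : ∀ i, TestIntegrable Ω fun z => ℓ i (fderiv ℝ a z) * f i z := fun i =>
    (hf i).mul hΩ (contDiffOn_clm_fderiv (ℓ i) hΩ ha)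
  have e1 : ∀ i, ∫ z in Ω, f i z * ℓ i (fderiv ℝ (fun z => a z * φ z) z)
      = (∫ z in Ω, a z * f i z * ℓ i (fderiv ℝ φ z))
        + ∫ z in Ω, ℓ i (fderiv ℝ a z) * f i z * φ z := by
    intro i
    rw [← integral_add (((hf i).mul hΩ ha) _ (hφ.clm_fderiv (ℓ i))) (hd i φ hφ)]
    refine setIntegral_congr_fun hΩ.measurableSet fun z hz => ?_
    simp only [fderiv_mul_complex (ha.diffAt hΩ hz) (hφ.diffAt z), map_add, map_smul, smul_eq_mul]
    ring
  have e2 : ∫ z in Ω, (a z * g z + ∑ i, ℓ i (fderiv ℝ a z) * f i z) * φ z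
      = (∫ z in Ω, g z * (a z * φ z)) + ∑ i, ∫ z in Ω, ℓ i (fderiv ℝ a z) * f i z * φ z := by
    rw [← integral_finsetSum _ fun i _ => hd i φ hφ,
      ← integral_add (hg _ (hφ.mul_contDiffOn hΩ ha))
        (integrable_finsetSum _ fun i _ => hd i φ hφ)]
    refine integral_congr_ae (Eventually.of_forall fun z => ?_)
    simp only [add_mul, Finset.sum_mul]; ring
  simp only [e1, Finset.sum_add_distrib] at key
  rw [e2]
  linear_combination key

lemma WeakEq.congr (hΩ : IsOpen Ω) {ℓ : Fin n → ((Cn n →L[ℝ] ℂ) →L[ℂ] ℂ)}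
    {f f' : Fin n → Cn n → ℂ} {g g' : Cn n → ℂ} (h : WeakEq Ω ℓ f g)
    (hf : ∀ i, ∀ z ∈ Ω, f i z = f' i z) (hg : ∀ z ∈ Ω, g z = g' z) : WeakEq Ω ℓ f' g' := by
  intro φ hφ
  have e1 : ∀ i, ∫ z in Ω, f' i z * ℓ i (fderiv ℝ φ z) = ∫ z in Ω, f i z * ℓ i (fderiv ℝ φ z) :=
    fun i => setIntegral_congr_fun hΩ.measurableSet fun z hz => by simp only [hf i z hz]
  have e2 : ∫ z in Ω, g' z * φ z = ∫ z in Ω, g z * φ z :=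
    setIntegral_congr_fun hΩ.measurableSet fun z hz => by simp only [hg z hz]
  simp only [e1, e2]
  exact h φ hφ

/-- Index set of the components of a `(0,2)`-form. -/
abbrev Pairs (n : ℕ) : Type := {p : Fin n × Fin n // p.1 < p.2}

/-- The first-order symbol of the `i`-th component of `∂̄` on `(0,1)`-forms. -/
def dbarL (i : Pairs n) (k : Fin n) : (Cn n →L[ℝ] ℂ) →L[ℂ] ℂ :=
  (if k = i.1.2 then dzbarL i.1.1 else 0) - if k = i.1.1 then dzbarL i.1.2 else 0

/-- F is only required to respect subtraction, so the same collapse of the sum serves for pointwise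
values and for integrals against test functions. -/
lemma sum_dbarL (i : Pairs n) (F : Fin n → ((Cn n →L[ℝ] ℂ) →L[ℂ] ℂ) → ℂ)
    (hF : ∀ k ℓ ℓ', F k (ℓ - ℓ') = F k ℓ - F k ℓ') :
    ∑ k, F k (dbarL i k) = F i.1.2 (dzbarL i.1.1) - F i.1.1 (dzbarL i.1.2) := by
  have h0 : ∀ k, F k 0 = 0 := fun k => by
    have := (congrArg (F k) (sub_self 0).symm).trans (hF k 0 0)
    simpa using this
  simp only [dbarL, hF, Finset.sum_sub_distrib]
  congr 1
  · rw [Finset.sum_eq_single i.1.2 (fun k _ hk => by simp [hk, h0]) (by simp)]; simp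
  · rw [Finset.sum_eq_single i.1.1 (fun k _ hk => by simp [hk, h0]) (by simp)]; simp

lemma sum_dbarL_apply (i : Pairs n) (A : Fin n → (Cn n →L[ℝ] ℂ)) :
    ∑ k, dbarL i k (A k) = dzbarL i.1.1 (A i.1.2) - dzbarL i.1.2 (A i.1.1) :=
  sum_dbarL i (fun k ℓ => ℓ (A k)) fun _ _ _ => rfl

lemma norm_dzL_le (j : Fin n) (A : Cn n →L[ℝ] ℂ) : ‖dzL j A‖ ≤ ‖A‖ := by
  have h1 : ‖A (EuclideanSpace.single j 1)‖ ≤ ‖A‖ := by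
    simpa using A.le_opNorm (EuclideanSpace.single j 1)
  have h2 : ‖A (EuclideanSpace.single j Complex.I)‖ ≤ ‖A‖ := by
    simpa using A.le_opNorm (EuclideanSpace.single j Complex.I)
  have h3 : dzL j A = (1 / 2 : ℂ) * (A (EuclideanSpace.single j 1)
    - Complex.I * A (EuclideanSpace.single j Complex.I)) := rfl
  rw [h3, norm_mul]
  have h4 := norm_sub_le (A (EuclideanSpace.single j 1))
    (Complex.I * A (EuclideanSpace.single j Complex.I))
  rw [norm_mul, Complex.norm_I, one_mul] at h4
  norm_num
  linarith

lemma norm_dzbarL_le (j : Fin n) (A : Cn n →L[ℝ] ℂ) : ‖dzbarL j A‖ ≤ ‖A‖ := by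
  have h1 : ‖A (EuclideanSpace.single j 1)‖ ≤ ‖A‖ := by
    simpa using A.le_opNorm (EuclideanSpace.single j 1)
  have h2 : ‖A (EuclideanSpace.single j Complex.I)‖ ≤ ‖A‖ := by
    simpa using A.le_opNorm (EuclideanSpace.single j Complex.I)
  have h3 : dzbarL j A = (1 / 2 : ℂ) * (A (EuclideanSpace.single j 1)
    + Complex.I * A (EuclideanSpace.single j Complex.I)) := rfl
  rw [h3, norm_mul]
  have h4 := norm_add_le (A (EuclideanSpace.single j 1))
    (Complex.I * A (EuclideanSpace.single j Complex.I))
  rw [norm_mul, Complex.norm_I, one_mul] at h4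
  norm_num
  linarith

lemma norm_dbarL_le (i : Pairs n) (k : Fin n) (A : Cn n →L[ℝ] ℂ) : ‖dbarL i k A‖ ≤ 2 * ‖A‖ := by
  have h1 : ‖(if k = i.1.2 then dzbarL i.1.1 else 0) A‖ ≤ ‖A‖ := by
    split_ifs
    · exact norm_dzbarL_le _ A
    · simp
  have h2 : ‖(if k = i.1.1 then dzbarL i.1.2 else 0) A‖ ≤ ‖A‖ := by
    split_ifs
    · exact norm_dzbarL_le _ A
    · simp
  have := norm_sub_le ((if k = i.1.2 then dzbarL i.1.1 else 0) A)
    ((if k = i.1.1 then dzbarL i.1.2 else 0) A)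
  calc ‖dbarL i k A‖ = _ := rfl
    _ ≤ _ := this
    _ ≤ _ := by linarith

/-- Weight functions degenerating at the boundary, with adapted cut-off functions. -/
structure IsWeight (Ω : Set (Cn n)) (σ : Cn n → ℝ) : Prop where
  smooth : ContDiffOn ℝ ∞ σ Ω
  pos : ∀ z ∈ Ω, 0 < σ z
  le_one : ∀ z ∈ Ω, σ z ≤ 1
  bdd_dz : ∃ C, ∀ z ∈ Ω, ∀ j, ‖dz j (fun w => (σ w : ℂ)) z‖ ≤ C
  cutoff : ∃ η : ℕ → Cn n → ℝ, (∀ m, IsTest Ω fun z => (η m z : ℂ)) ∧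
    (∀ m z, η m z ∈ Set.Icc (0 : ℝ) 1) ∧ (∀ z ∈ Ω, ∀ᶠ m in atTop, η m =ᶠ[𝓝 z] fun _ => 1) ∧
    ∃ C, ∀ m, ∀ z ∈ Ω, σ z * ‖fderiv ℝ (fun w => (η m w : ℂ)) z‖ ≤ C

/-- The weighted estimate with weight `σ`, matrix `B` and constant `C` for test forms. -/
def WeightedBound (Ω : Set (Cn n)) (σ : Cn n → ℝ) (B : Cn n → Matrix (Fin n) (Fin n) ℂ)
    (C : ℝ) : Prop :=
  ∀ U : Fin n → Cn n → ℂ, (∀ j, IsTest Ω (U j)) →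
    ∫ z in Ω, hform (B z) (fun j => (σ z : ℂ) ^ 8 * U j z)
      ≤ C * ((∑ i : Pairs n, ∫ z in Ω,
          ‖(σ z : ℂ) ^ 8 * (dzbar i.1.1 (U i.1.2) z - dzbar i.1.2 (U i.1.1) z)‖ ^ 2)
        + ∫ z in Ω, ‖(σ z : ℂ) ^ 8 * divz U z
            + 14 * (σ z : ℂ) ^ 7 * ∑ j, dz j (fun w => (σ w : ℂ)) z * U j z‖ ^ 2)

lemma ContDiffOn.aestronglyMeasurable' {f : Cn n → ℂ} (hΩ : IsOpen Ω)
    (hf : ContDiffOn ℝ ∞ f Ω) : AEStronglyMeasurable f (volume.restrict Ω) :=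
  hf.continuousOn.aestronglyMeasurable hΩ.measurableSet

/-- Mollifications of W are eventually test forms, and their ∂̄ and divergence are the
mollifications of G and D. All weights are bounded, so both sides converge. -/
lemma WeightedBound.of_compact (hΩ : IsOpen Ω) {σ : Cn n → ℝ} (hσ : IsWeight Ω σ)
    {B : Cn n → Matrix (Fin n) (Fin n) ℂ} {C CB : ℝ} (hB : IsBddMatrix Ω B CB)
    (h : WeightedBound Ω σ B C) {K : Set (Cn n)} (hK : IsCompact K) (hKΩ : K ⊆ Ω)
    {W : Fin n → Cn n → ℂ} {G : Pairs n → Cn n → ℂ} {D : Cn n → ℂ}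
    (hW : ∀ j, MemLp (W j) 2) (hG : ∀ i, MemLp (G i) 2) (hD : MemLp D 2)
    (hWK : ∀ j z, z ∉ K → W j z = 0) (hGK : ∀ i z, z ∉ K → G i z = 0)
    (hDK : ∀ z, z ∉ K → D z = 0)
    (eG : ∀ i, WeakEq Ω (dbarL i) W (G i)) (eD : WeakEq Ω dzL W D) :
    ∫ z in Ω, hform (B z) (fun j => (σ z : ℂ) ^ 8 * W j z)
      ≤ C * ((∑ i : Pairs n, ∫ z in Ω, ‖(σ z : ℂ) ^ 8 * G i z‖ ^ 2)
        + ∫ z in Ω, ‖(σ z : ℂ) ^ 8 * D z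
            + 14 * (σ z : ℂ) ^ 7 * ∑ j, dz j (fun w => (σ w : ℂ)) z * W j z‖ ^ 2) := by
  obtain ⟨Cσ, hCσ⟩ := hσ.bdd_dz
  have loc : ∀ j, LocallyIntegrable (W j) := fun j => (hW j).locallyIntegrable (by norm_num)
  have hpow : ∀ k : ℕ, ContDiffOn ℝ ∞ (fun z => (σ z : ℂ) ^ k) Ω := fun k =>
    hσ.smooth.ofReal_comp.pow k
  have hpow1 : ∀ k : ℕ, ∀ z ∈ Ω, ‖(σ z : ℂ) ^ k‖ ≤ 1 := fun k z hz => by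
    rw [norm_pow, Complex.norm_real, Real.norm_of_nonneg (hσ.pos z hz).le]
    exact pow_le_one₀ (hσ.pos z hz).le (hσ.le_one z hz)
  have b8 : ∀ᵐ z ∂(volume.restrict Ω), ‖(σ z : ℂ) ^ 8‖ ≤ 1 :=
    (ae_restrict_iff' hΩ.measurableSet).2 (Eventually.of_forall (hpow1 8))
  have b7 : ∀ᵐ z ∂(volume.restrict Ω), ‖14 * (σ z : ℂ) ^ 7‖ ≤ 14 := by
    refine (ae_restrict_iff' hΩ.measurableSet).2 (Eventually.of_forall fun z hz => ?_)
    rw [norm_mul]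
    have := hpow1 7 z hz
    norm_num at this ⊢
    linarith
  have bs : ∀ j, ∀ᵐ z ∂(volume.restrict Ω), ‖dz j (fun w => (σ w : ℂ)) z‖ ≤ Cσ := fun j =>
    (ae_restrict_iff' hΩ.measurableSet).2 (Eventually.of_forall fun z hz => hCσ z hz j)
  have m8 := (hpow 8).aestronglyMeasurable' hΩ
  have m7 : AEStronglyMeasurable (fun z => 14 * (σ z : ℂ) ^ 7) (volume.restrict Ω) :=
    (contDiffOn_const.mul (hpow 7)).aestronglyMeasurable' hΩ
  have ms := fun j => (contDiffOn_dz j hΩ hσ.smooth.ofReal_comp).aestronglyMeasurable' hΩ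
  have tW := fun j => L2Tendsto_moll (Ω := Ω) (hW j)
  have t1 := tendsto_integral_hform hB fun j => (tW j).mul_bdd m8 b8
  have t2 : ∀ i, Tendsto (fun m => ∫ z in Ω, ‖(σ z : ℂ) ^ 8 * moll m (G i) z‖ ^ 2) atTop _ :=
    fun i => ((L2Tendsto_moll (Ω := Ω) (hG i)).mul_bdd m8 b8).norm_sq
  have t3 := (((L2Tendsto_moll (Ω := Ω) hD).mul_bdd m8 b8).add
    ((L2Tendsto.sum Finset.univ fun j => (tW j).mul_bdd (ms j) (bs j)).mul_bdd m7 b7)).norm_sq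
  refine le_of_tendsto_of_tendsto t1
    (((tendsto_finsetSum Finset.univ fun i _ => t2 i).add t3).const_mul C) ?_
  have hev : ∀ᶠ m in atTop, ∀ j, IsTest Ω (moll m (W j)) :=
    eventually_all.2 fun j => moll_isTest hK hΩ hKΩ (loc j) (hWK j)
  filter_upwards [hev] with m hm
  have key := h _ hm
  have e1 : ∀ (i : Pairs n) z, dzbar i.1.1 (moll m (W i.1.2)) z - dzbar i.1.2 (moll m (W i.1.1)) z
      = moll m (G i) z := fun i z => by
    rw [← (eG i).moll hΩ hK hKΩ loc hWK (hGK i) m z, sum_dbarL_apply]; rfl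
  have e2 : ∀ z, divz (fun j => moll m (W j)) z = moll m D z := fun z => by
    rw [← eD.moll hΩ hK hKΩ loc hWK hDK m z]; rfl
  simp only [e1, e2] at key
  exact key

/-- The factor φ vanishes off Ω, so square integrability on Ω becomes square integrability on the
whole space, where mollification takes place. -/
lemma IsTest.memLp_mul {φ f : Cn n → ℂ} (hΩ : IsOpen Ω) (h : IsTest Ω φ)
    (hf : MemLp f 2 (volume.restrict Ω)) : MemLp (fun z => φ z * f z) 2 := by
  obtain ⟨C, hC⟩ := h.2.1.exists_bound_of_continuous h.1.continuous
  have h1 : MemLp (fun z => φ z * f z) 2 (volume.restrict Ω) :=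
    MemLp.mul_bdd hf h.1.continuous.aestronglyMeasurable (Eventually.of_forall hC)
  have h2 := (memLp_indicator_iff_restrict hΩ.measurableSet).2 h1
  have e : Ω.indicator (fun z => φ z * f z) = fun z => φ z * f z := by
    refine Set.indicator_eq_self.2 fun z hz => ?_
    by_contra hz'
    exact hz (by simp [h.eq_zero hz'])
  rwa [e] at h2

/-- The weighted estimate for square-integrable forms satisfying the conjugated equations
weakly. -/
theorem WeightedBound.of_weak (hΩ : IsOpen Ω) {σ : Cn n → ℝ} (hσ : IsWeight Ω σ)
    {B : Cn n → Matrix (Fin n) (Fin n) ℂ} {C CB : ℝ} (hB : IsBddMatrix Ω B CB)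
    (h : WeightedBound Ω σ B C) {u : Fin n → Cn n → ℂ} {g : Pairs n → Cn n → ℂ} {k : Cn n → ℂ}
    (hu : ∀ j, MemLp (u j) 2 (volume.restrict Ω)) (hg : ∀ i, MemLp (g i) 2 (volume.restrict Ω))
    (hk : MemLp k 2 (volume.restrict Ω))
    (eg : ∀ i, WeakEq Ω (dbarL i) (fun j z => ((σ z)⁻¹ : ℂ) ^ 7 * u j z)
      (fun z => ((σ z)⁻¹ : ℂ) ^ 8 * g i z))
    (ek : WeakEq Ω dzL (fun j z => (σ z : ℂ) ^ 7 * u j z) (fun z => -((σ z : ℂ) ^ 6 * k z))) :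
    ∫ z in Ω, hform (B z) (fun j => (σ z : ℂ) * u j z)
      ≤ C * ((∑ i : Pairs n, ∫ z in Ω, ‖g i z‖ ^ 2) + ∫ z in Ω, ‖k z‖ ^ 2) := by
  obtain ⟨η, hηt, hη01, hη1, Cη, hCη⟩ := hσ.cutoff
  have sσ : ContDiffOn ℝ ∞ (fun z => (σ z : ℂ)) Ω := hσ.smooth.ofReal_comp
  have hne : ∀ z ∈ Ω, (σ z : ℂ) ≠ 0 := fun z hz => by exact_mod_cast (hσ.pos z hz).ne'
  have sτ : ContDiffOn ℝ ∞ (fun z => ((σ z)⁻¹ : ℂ)) Ω := sσ.inv hne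
  have nη : ∀ m z, ‖(η m z : ℂ)‖ ≤ 1 := fun m z => by
    rw [Complex.norm_real, Real.norm_of_nonneg (hη01 m z).1]; exact (hη01 m z).2
  have fη : ∀ z ∈ Ω, ∀ᶠ m in atTop, (η m z : ℂ) = 1 ∧ fderiv ℝ (fun w => (η m w : ℂ)) z = 0 := by
    intro z hz
    filter_upwards [hη1 z hz] with m hm
    have : (fun w => (η m w : ℂ)) =ᶠ[𝓝 z] fun _ => 1 := by
      filter_upwards [hm] with w hw; simp [hw]
    exact ⟨this.eq_of_nhds, by rw [this.fderiv_eq]; simp⟩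
  -- the estimate for the truncated forms
  have step : ∀ m, ∫ z in Ω, hform (B z) (fun j => (σ z : ℂ) * ((η m z : ℂ) * u j z))
      ≤ C * ((∑ i : Pairs n, ∫ z in Ω, ‖(η m z : ℂ) * g i z
          + ∑ j, (σ z : ℂ) * dbarL i j (fderiv ℝ (fun w => (η m w : ℂ)) z) * u j z‖ ^ 2)
        + ∫ z in Ω, ‖-1 * ((η m z : ℂ) * k z)
          + ∑ j, (σ z : ℂ) * dzL j (fderiv ℝ (fun w => (η m w : ℂ)) z) * u j z‖ ^ 2) := by
    intro m
    set χ : Cn n → ℂ := fun w => (η m w : ℂ) with hχ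
    have tχ : IsTest Ω χ := hηt m
    set τ : Cn n → ℂ := fun w => ((σ w)⁻¹ : ℂ) with hτ
    have sτp : ∀ p : ℕ, ContDiffOn ℝ ∞ (fun z => τ z ^ p) Ω := fun p => sτ.pow p
    have ssp : ∀ p : ℕ, ContDiffOn ℝ ∞ (fun z => (σ z : ℂ) ^ p) Ω := fun p => sσ.pow p
    have sdσ : ∀ j, ContDiffOn ℝ ∞ (dz j fun w => (σ w : ℂ)) Ω := fun j => contDiffOn_dz j hΩ sσ
    have hK : IsCompact (tsupport χ) := tχ.2.1
    have χ0 : ∀ z, z ∉ tsupport χ → χ z = 0 := fun z hz => image_eq_zero_of_notMem_tsupport hz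
    have dχ0 : ∀ z, z ∉ tsupport χ → fderiv ℝ χ z = 0 := fun z hz => by
      by_contra hne
      exact hz (support_fderiv_subset ℝ hne)
    -- The test-form variable is U = σ^{-7} u, here truncated by χ. G and D are its ∂̄ and its
    -- divergence, computed by multiplying the first equation by χ and the second by χσ^{-14}.
    let W : Fin n → Cn n → ℂ := fun j z => τ z ^ 7 * χ z * u j z
    let G : Pairs n → Cn n → ℂ := fun i z => τ z ^ 8 * χ z * g i z
      + ∑ j, τ z ^ 7 * dbarL i j (fderiv ℝ χ z) * u j z
    let D : Cn n → ℂ := fun z => -1 * (τ z ^ 8 * χ z * k z)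
      + ∑ j, (τ z ^ 7 * dzL j (fderiv ℝ χ z)
        - 14 * (τ z ^ 8 * dz j (fun w => (σ w : ℂ)) z * χ z)) * u j z
    have mW : ∀ j, MemLp (W j) 2 := fun j => (tχ.mul_contDiffOn hΩ (sτp 7)).memLp_mul hΩ (hu j)
    have mG : ∀ i, MemLp (G i) 2 := fun i =>
      ((tχ.mul_contDiffOn hΩ (sτp 8)).memLp_mul hΩ (hg i)).add (memLp_finsetSum _ fun j _ =>
        ((tχ.clm_fderiv (dbarL i j)).mul_contDiffOn hΩ (sτp 7)).memLp_mul hΩ (hu j))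
    have mD : MemLp D 2 :=
      (((tχ.mul_contDiffOn hΩ (sτp 8)).memLp_mul hΩ hk).const_mul (-1)).add
        (memLp_finsetSum _ fun j _ =>
          (((tχ.clm_fderiv (dzL j)).mul_contDiffOn hΩ (sτp 7)).sub
            ((tχ.mul_contDiffOn hΩ ((sτp 8).mul (sdσ j))).const_mul 14)).memLp_mul hΩ (hu j))
    have iu := fun j => TestIntegrable.of_memLp (hu j)
    have eG : ∀ i, WeakEq Ω (dbarL i) W (G i) := fun i => by
      refine ((eg i).mul hΩ (fun j => (iu j).mul hΩ (sτp 7))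
        ((TestIntegrable.of_memLp (hg i)).mul hΩ (sτp 8)) tχ.contDiffOn).congr hΩ
        (fun j z _ => ?_) fun z _ => ?_
      · simp only [W, hτ]; ring
      · simp only [G, hτ]
        congr 1
        · ring
        · exact Finset.sum_congr rfl fun j _ => by ring
    -- Passing from div(σ^7 u) to div(σ^{-7} u) costs the derivative of σ^{-14}.
    have hτ14 : ∀ j, ∀ z ∈ Ω, dzL j (fderiv ℝ (fun w => χ w * τ w ^ 14) z)
        = τ z ^ 14 * dzL j (fderiv ℝ χ z)
          - 14 * (τ z ^ 15 * dz j (fun w => (σ w : ℂ)) z * χ z) := by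
      intro j z hz
      have hs0 : σ z ≠ 0 := (hσ.pos z hz).ne'
      have dσ : DifferentiableAt ℝ σ z :=
        ((hσ.smooth z hz).contDiffAt (hΩ.mem_nhds hz)).differentiableAt (by simp)
      have e := dz_comp_ofReal j (g := fun t => t⁻¹ ^ 14) ((hasDerivAt_inv hs0).pow 14) dσ
      have e' : (fun w => (((σ w)⁻¹ ^ 14 : ℝ) : ℂ)) = fun w => τ w ^ 14 := by
        ext w; simp [hτ]
      rw [e'] at e
      rw [← dz_eq, dz_mul j (tχ.diffAt z) ((sτp 14).diffAt hΩ hz), e, dz_eq, dz_eq]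
      simp only [hτ]
      push_cast
      ring
    have hστ : ∀ z ∈ Ω, (σ z : ℂ) * τ z = 1 := fun z hz => mul_inv_cancel₀ (hne z hz)
    have eD : WeakEq Ω dzL W D := by
      refine (ek.mul hΩ (fun j => (iu j).mul hΩ (ssp 7))
        (g := fun z => -((σ z : ℂ) ^ 6 * k z)) ?_
        (tχ.contDiffOn.mul (sτp 14))).congr hΩ (fun j z hz => ?_) fun z hz => ?_
      · have := ((TestIntegrable.of_memLp hk).mul hΩ (ssp 6)).mul hΩ
          (contDiffOn_const (c := (-1 : ℂ)))
        simpa using this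
      · have h1 := hστ z hz
        calc χ z * τ z ^ 14 * ((σ z : ℂ) ^ 7 * u j z)
            = ((σ z : ℂ) * τ z) ^ 7 * (τ z ^ 7 * χ z * u j z) := by ring
          _ = W j z := by rw [h1, one_pow, one_mul]
      · have h1 := hστ z hz
        simp only [D]
        congr 1
        · calc χ z * τ z ^ 14 * -((σ z : ℂ) ^ 6 * k z)
              = ((σ z : ℂ) * τ z) ^ 6 * (-1 * (τ z ^ 8 * χ z * k z)) := by ring
            _ = _ := by rw [h1, one_pow, one_mul]
        · refine Finset.sum_congr rfl fun j _ => ?_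
          rw [hτ14 j z hz]
          calc _ = ((σ z : ℂ) * τ z) ^ 7 * ((τ z ^ 7 * dzL j (fderiv ℝ χ z)
                - 14 * (τ z ^ 8 * dz j (fun w => (σ w : ℂ)) z * χ z)) * u j z) := by ring
            _ = _ := by rw [h1, one_pow, one_mul]
    have key := h.of_compact hΩ hσ hB hK tχ.2.2 mW mG mD
      (fun j z hz => by simp [W, χ0 z hz])
      (fun i z hz => by simp [G, χ0 z hz, dχ0 z hz])
      (fun z hz => by simp [D, χ0 z hz, dχ0 z hz]) eG eD
    have c1 : ∫ z in Ω, hform (B z) (fun j => (σ z : ℂ) ^ 8 * W j z)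
        = ∫ z in Ω, hform (B z) (fun j => (σ z : ℂ) * (χ z * u j z)) := by
      refine setIntegral_congr_fun hΩ.measurableSet fun z hz => ?_
      have h1 := hστ z hz
      congr 1
      ext j
      calc (σ z : ℂ) ^ 8 * W j z = ((σ z : ℂ) * τ z) ^ 7 * ((σ z : ℂ) * (χ z * u j z)) := by
            simp only [W]; ring
        _ = _ := by rw [h1, one_pow, one_mul]
    have c2 : ∀ i, ∫ z in Ω, ‖(σ z : ℂ) ^ 8 * G i z‖ ^ 2
        = ∫ z in Ω, ‖χ z * g i z + ∑ j, (σ z : ℂ) * dbarL i j (fderiv ℝ χ z) * u j z‖ ^ 2 := by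
      intro i
      refine setIntegral_congr_fun hΩ.measurableSet fun z hz => ?_
      have h1 := hστ z hz
      congr 2
      simp only [G, mul_add, Finset.mul_sum]
      congr 1
      · calc _ = ((σ z : ℂ) * τ z) ^ 8 * (χ z * g i z) := by ring
          _ = _ := by rw [h1, one_pow, one_mul]
      · refine Finset.sum_congr rfl fun j _ => ?_
        calc _ = ((σ z : ℂ) * τ z) ^ 7
              * ((σ z : ℂ) * dbarL i j (fderiv ℝ χ z) * u j z) := by ring
          _ = _ := by rw [h1, one_pow, one_mul]
    have c3 : ∫ z in Ω, ‖(σ z : ℂ) ^ 8 * D z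
            + 14 * (σ z : ℂ) ^ 7 * ∑ j, dz j (fun w => (σ w : ℂ)) z * W j z‖ ^ 2
        = ∫ z in Ω, ‖-1 * (χ z * k z)
          + ∑ j, (σ z : ℂ) * dzL j (fderiv ℝ χ z) * u j z‖ ^ 2 := by
      refine setIntegral_congr_fun hΩ.measurableSet fun z hz => ?_
      have h1 := hστ z hz
      congr 2
      simp only [D, W, mul_add, Finset.mul_sum]
      rw [add_assoc, ← Finset.sum_add_distrib]
      congr 1
      · calc _ = ((σ z : ℂ) * τ z) ^ 8 * (-1 * (χ z * k z)) := by ring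
          _ = _ := by rw [h1, one_pow, one_mul]
      -- The term -14 ∂σ(u) in D cancels the term +14 ∂σ(U) of the weighted estimate, leaving only
      -- the commutator with χ.
      · refine Finset.sum_congr rfl fun j _ => ?_
        calc _ = ((σ z : ℂ) * τ z) ^ 7 * ((σ z : ℂ) * dzL j (fderiv ℝ χ z) * u j z
                + 14 * dz j (fun w => (σ w : ℂ)) z * χ z * u j z * (1 - (σ z : ℂ) * τ z)) := by
              ring
          _ = _ := by rw [h1]; ring
    rw [c1, c3] at key
    simp only [c2] at key
    exact key
  have hmem : ∀ m (ℓ : (Cn n →L[ℝ] ℂ) →L[ℂ] ℂ), AEStronglyMeasurable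
      (fun z => (σ z : ℂ) * ℓ (fderiv ℝ (fun w => (η m w : ℂ)) z)) (volume.restrict Ω) :=
    fun m ℓ => (sσ.mul ((hηt m).clm_fderiv ℓ).contDiffOn).aestronglyMeasurable' hΩ
  have lim1 : ∀ f : Cn n → ℂ, MemLp f 2 (volume.restrict Ω) →
      L2Tendsto Ω (fun m z => (η m z : ℂ) * f z) f := by
    intro f hf
    refine L2Tendsto.of_dominated hf.norm
      (fun m => ((hηt m).1.continuous.aestronglyMeasurable).mul hf.1) hf.1
      (fun m => Eventually.of_forall fun z => ?_) ?_
    · rw [norm_mul]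
      exact mul_le_of_le_one_left (norm_nonneg _) (nη m z)
    · refine (ae_restrict_iff' hΩ.measurableSet).2 (Eventually.of_forall fun z hz => ?_)
      refine tendsto_const_nhds.congr' ?_
      filter_upwards [fη z hz] with m hm
      rw [hm.1, one_mul]
  -- The commutators vanish in the limit: they are dominated because σ |dη_m| is bounded uniformly
  -- in m, and at each point of Ω the derivative dη_m is eventually zero.
  have lim2 : ∀ (f : Cn n → ℂ) (ℓ : (Cn n →L[ℝ] ℂ) →L[ℂ] ℂ), MemLp f 2 (volume.restrict Ω) →
      L2Tendsto Ω (fun m z => (σ z : ℂ) * ℓ (fderiv ℝ (fun w => (η m w : ℂ)) z) * f z)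
        (fun _ => 0) := by
    intro f ℓ hf
    refine L2Tendsto.of_dominated (g := fun z => (‖ℓ‖ * Cη) * ‖f z‖) (hf.norm.const_mul _)
      (fun m => (hmem m ℓ).mul hf.1) aestronglyMeasurable_const (fun m => ?_) ?_
    · refine (ae_restrict_iff' hΩ.measurableSet).2 (Eventually.of_forall fun z hz => ?_)
      rw [norm_mul, norm_mul, Complex.norm_real, Real.norm_of_nonneg (hσ.pos z hz).le]
      have h1 := ℓ.le_opNorm (fderiv ℝ (fun w => (η m w : ℂ)) z)
      have h2 := hCη m z hz
      have h3 := (hσ.pos z hz).le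
      refine mul_le_mul_of_nonneg_right ?_ (norm_nonneg _)
      calc _ ≤ σ z * (‖ℓ‖ * ‖fderiv ℝ (fun w => (η m w : ℂ)) z‖) := by gcongr
        _ = ‖ℓ‖ * (σ z * ‖fderiv ℝ (fun w => (η m w : ℂ)) z‖) := by ring
        _ ≤ _ := by gcongr
    · refine (ae_restrict_iff' hΩ.measurableSet).2 (Eventually.of_forall fun z hz => ?_)
      refine tendsto_const_nhds.congr' ?_
      filter_upwards [fη z hz] with m hm
      simp [hm.2]
  have mσ := sσ.aestronglyMeasurable' hΩ
  have bσ : ∀ᵐ z ∂(volume.restrict Ω), ‖(σ z : ℂ)‖ ≤ 1 := by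
    refine (ae_restrict_iff' hΩ.measurableSet).2 (Eventually.of_forall fun z hz => ?_)
    rw [Complex.norm_real, Real.norm_of_nonneg (hσ.pos z hz).le]; exact hσ.le_one z hz
  have t1 := tendsto_integral_hform hB fun j => (lim1 _ (hu j)).mul_bdd mσ bσ
  have t2 := fun i => ((lim1 _ (hg i)).add
    (L2Tendsto.sum Finset.univ fun j => lim2 (u j) (dbarL i j) (hu j))).norm_sq
  have t3 := (((lim1 _ hk).mul_bdd (c := fun _ => -1) (C := 1) aestronglyMeasurable_const
    (by simp)).add (L2Tendsto.sum Finset.univ fun j => lim2 (u j) (dzL j) (hu j))).norm_sq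
  have := le_of_tendsto_of_tendsto' t1
    (((tendsto_finsetSum Finset.univ fun i _ => t2 i).add t3).const_mul C) step
  simpa using this

end WeakDomain

/-! ### Defining functions and the boundary weights -/

section DefiningFunction

variable {n : ℕ} {Ω : Set (Cn n)}

lemma complexHessian_comp (hΩ : IsOpen Ω) {r : Cn n → ℝ} (hr : ContDiffOn ℝ ∞ r Ω) {z : Cn n}
    (hz : z ∈ Ω) {g g₁ : ℝ → ℝ} {g₂ : ℝ} (h1 : ∀ w ∈ Ω, HasDerivAt g (g₁ (r w)) (r w))
    (h2 : HasDerivAt g₁ g₂ (r z)) (j k : Fin n) :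
    complexHessian (fun w => g (r w)) z j k = g₁ (r z) * complexHessian r z j k
      + g₂ * (dz j (fun w => (r w : ℂ)) z * conj (dz k (fun w => (r w : ℂ)) z)) := by
  have dr : ∀ w ∈ Ω, DifferentiableAt ℝ r w := fun w hw =>
    ((hr w hw).contDiffAt (hΩ.mem_nhds hw)).differentiableAt (by simp)
  have ev : dzbar k (fun w => ((g (r w) : ℝ) : ℂ)) =ᶠ[𝓝 z]
      fun w => ((g₁ (r w) : ℝ) : ℂ) * dzbar k (fun w => (r w : ℂ)) w := by
    filter_upwards [hΩ.mem_nhds hz] with w hw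
    exact dzbar_comp_ofReal k (h1 w hw) (dr w hw)
  have d1 : DifferentiableAt ℝ (fun w => ((g₁ (r w) : ℝ) : ℂ)) z :=
    Complex.ofRealCLM.differentiableAt.comp z (h2.differentiableAt.comp z (dr z hz))
  have e : complexHessian (fun w => g (r w)) z j k
      = dz j (dzbar k (fun w => ((g (r w) : ℝ) : ℂ))) z := rfl
  have e' : complexHessian r z j k = dz j (dzbar k (fun w => (r w : ℂ))) z := rfl
  rw [e, e', dz_congr j ev, dz_mul j d1 ((contDiffOn_dzbar k hΩ hr.ofReal_comp).diffAt hΩ hz),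
    dz_comp_ofReal j h2 (dr z hz), dzbar_ofReal]
  ring

/-- The chain rule used both for the boundary weight σ and for the exponential twist. -/
lemma leviForm_comp (hΩ : IsOpen Ω) {r : Cn n → ℝ} (hr : ContDiffOn ℝ ∞ r Ω) {z : Cn n}
    (hz : z ∈ Ω) {g g₁ : ℝ → ℝ} {g₂ : ℝ} (h1 : ∀ w ∈ Ω, HasDerivAt g (g₁ (r w)) (r w))
    (h2 : HasDerivAt g₁ g₂ (r z)) (ξ : Fin n → ℂ) :
    leviForm (fun w => g (r w)) z ξ = g₁ (r z) * leviForm r z ξ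
      + g₂ * ‖∑ j, dz j (fun w => (r w : ℂ)) z * ξ j‖ ^ 2 := by
  have e : ∑ j, ∑ k, complexHessian (fun w => g (r w)) z j k * ξ j * conj (ξ k)
      = ((g₁ (r z) : ℝ) : ℂ) * (∑ j, ∑ k, complexHessian r z j k * ξ j * conj (ξ k))
        + ((g₂ * ‖∑ j, dz j (fun w => (r w : ℂ)) z * ξ j‖ ^ 2 : ℝ) : ℂ) := by
    have e2 : ((‖∑ j, dz j (fun w => (r w : ℂ)) z * ξ j‖ ^ 2 : ℝ) : ℂ)
        = ∑ j, ∑ k, (dz j (fun w => (r w : ℂ)) z * ξ j)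
          * conj (dz k (fun w => (r w : ℂ)) z * ξ k) := by
      rw [← Complex.normSq_eq_norm_sq, ← Complex.mul_conj, map_sum, Finset.sum_mul_sum]
    rw [Complex.ofReal_mul, e2]
    simp only [Finset.mul_sum, ← Finset.sum_add_distrib]
    refine Finset.sum_congr rfl fun j _ => Finset.sum_congr rfl fun k _ => ?_
    rw [complexHessian_comp hΩ hr hz h1 h2, map_mul]
    ring
  rw [leviForm, e, Complex.add_re, Complex.re_ofReal_mul, Complex.ofReal_re, leviForm]

/-- The geometric information on a defining function used below. -/
structure IsDefining (Ω : Set (Cn n)) (r : Cn n → ℝ) : Prop where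
  isOpen : IsOpen Ω
  smooth : ContDiffOn ℝ ∞ r Ω
  neg : ∀ z ∈ Ω, r z < 0
  compact : ∀ δ > 0, IsCompact {z ∈ closure Ω | r z ≤ -δ}
  sublevel_subset : ∀ δ > 0, {z ∈ closure Ω | r z ≤ -δ} ⊆ Ω
  bdd_fderiv : ∃ C, ∀ z ∈ Ω, ‖fderiv ℝ (fun w => (r w : ℂ)) z‖ ≤ C
  bdd_hessian : ∃ C, ∀ z ∈ Ω, ∀ j k, ‖complexHessian r z j k‖ ≤ C

lemma contDiffOn_complexHessian {U : Set (Cn n)} (hU : IsOpen U) {r : Cn n → ℝ}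
    (hr : ContDiffOn ℝ ∞ r U) (j k : Fin n) :
    ContDiffOn ℝ ∞ (fun z => complexHessian r z j k) U :=
  contDiffOn_dz j hU (contDiffOn_dzbar k hU hr.ofReal_comp)

/-- Sublevel sets r ≤ -δ of the closure avoid the boundary because Ω is all of {r < 0} near its
closure; the bounds come from compactness of the closure. -/
lemma IsSmoothDefiningFunction.isDefining {r : Cn n → ℝ} (hΩ : IsOpen Ω)
    (hb : Bornology.IsBounded Ω) (hr : IsSmoothDefiningFunction Ω r) : IsDefining Ω r := by
  obtain ⟨⟨U, hU, hcl, hs, hΩr⟩, -⟩ := hr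
  have hsub : ∀ δ > 0, {z ∈ closure Ω | r z ≤ -δ} ⊆ Ω := by
    rintro δ hδ z ⟨hz, hz'⟩
    rw [hΩr]
    exact ⟨hcl hz, by linarith⟩
  have hK : IsCompact (closure Ω) := hb.isCompact_closure
  refine ⟨hΩ, hs.mono (subset_closure.trans hcl), fun z hz => ?_, fun δ hδ => ?_, hsub, ?_, ?_⟩
  · rw [hΩr] at hz; exact hz.2
  · have hc : ContinuousOn r (closure Ω) := hs.continuousOn.mono hcl
    have : {z ∈ closure Ω | r z ≤ -δ} = closure Ω ∩ r ⁻¹' Set.Iic (-δ) := rfl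
    rw [this]
    exact hK.of_isClosed_subset (hc.preimage_isClosed_of_isClosed isClosed_closure isClosed_Iic)
      Set.inter_subset_left
  · have h1 : ContinuousOn (fderiv ℝ (fun w => (r w : ℂ))) (closure Ω) :=
      (hs.ofReal_comp.fderiv_of_isOpen hU (m := ∞) (by simp)).continuousOn.mono hcl
    obtain ⟨C, hC⟩ := hK.exists_bound_of_continuousOn h1
    exact ⟨C, fun z hz => hC z (subset_closure hz)⟩
  · have h2 : ∀ j k, ∃ C, ∀ z ∈ Ω, ‖complexHessian r z j k‖ ≤ C := fun j k => by
      obtain ⟨C, hC⟩ := hK.exists_bound_of_continuousOn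
        ((contDiffOn_complexHessian hU hs j k).continuousOn.mono hcl)
      exact ⟨C, fun z hz => hC z (subset_closure hz)⟩
    choose C hC using h2
    refine ⟨∑ j, ∑ k, |C j k|, fun z hz j k => (hC j k z hz).trans ((le_abs_self _).trans ?_)⟩
    exact (Finset.single_le_sum (f := fun k => |C j k|) (fun _ _ => abs_nonneg _)
      (Finset.mem_univ k)).trans (Finset.single_le_sum (f := fun j => ∑ k, |C j k|)
        (fun _ _ => Finset.sum_nonneg fun _ _ => abs_nonneg _) (Finset.mem_univ j))

/-- The weight `σ_s = (-r) / (s - r)`. -/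
def sigma (r : Cn n → ℝ) (s : ℝ) (z : Cn n) : ℝ := 1 - s * (s - r z)⁻¹

lemma sigma_deriv {s t : ℝ} (h : s - t ≠ 0) :
    HasDerivAt (fun t => 1 - s * (s - t)⁻¹) (-(s * ((s - t) ^ 2)⁻¹)) t := by
  have h1 : HasDerivAt (fun t => s - t) (-1) t := by
    simpa using (hasDerivAt_id t).const_sub s
  exact (((h1.inv h).const_mul s).const_sub 1).congr_deriv (by field_simp)

lemma sigma_deriv2 {s t : ℝ} (h : s - t ≠ 0) :
    HasDerivAt (fun t => -(s * ((s - t) ^ 2)⁻¹)) (-(2 * s * ((s - t) ^ 3)⁻¹)) t := by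
  have h1 : HasDerivAt (fun t => s - t) (-1) t := by
    simpa using (hasDerivAt_id t).const_sub s
  exact (((h1.pow 2).inv (pow_ne_zero 2 h)).const_mul s).neg.congr_deriv (by
    simp only [Pi.pow_apply]; field_simp; norm_num; ring)

/-! ### Properties of the boundary weight σ. -/

section Sigma

variable {r : Cn n → ℝ} {s : ℝ}

lemma IsDefining.sub_pos (hr : IsDefining Ω r) (hs : 0 < s) {z : Cn n} (hz : z ∈ Ω) :
    0 < s - r z := by have := hr.neg z hz; linarith

lemma IsDefining.sigma_pos (hr : IsDefining Ω r) (hs : 0 < s) {z : Cn n} (hz : z ∈ Ω) :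
    0 < sigma r s z := by
  have h1 := hr.sub_pos hs hz
  have h2 := hr.neg z hz
  have : sigma r s z = -r z / (s - r z) := by rw [sigma]; field_simp; ring
  rw [this]; exact div_pos (by linarith) h1

lemma IsDefining.sigma_le_one (hr : IsDefining Ω r) (hs : 0 < s) {z : Cn n} (hz : z ∈ Ω) :
    sigma r s z ≤ 1 := by
  have h1 := hr.sub_pos hs hz
  have : 0 ≤ s * (s - r z)⁻¹ := by positivity
  rw [sigma]; linarith

lemma IsDefining.sigma_smooth (hr : IsDefining Ω r) (hs : 0 < s) :
    ContDiffOn ℝ ∞ (sigma r s) Ω :=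
  contDiffOn_const.sub (contDiffOn_const.mul ((contDiffOn_const.sub hr.smooth).inv
    fun _ hz => (hr.sub_pos hs hz).ne'))

/-- Linear decay of σ towards the boundary, which compensates the growth of the derivatives of the
cut-offs. -/
lemma IsDefining.sigma_le (hr : IsDefining Ω r) (hs : 0 < s) {z : Cn n} (hz : z ∈ Ω) :
    sigma r s z ≤ -r z / s := by
  have h1 := hr.sub_pos hs hz
  have h2 := hr.neg z hz
  have : sigma r s z = -r z / (s - r z) := by rw [sigma]; field_simp; ring
  rw [this]
  exact div_le_div_of_nonneg_left (by linarith) hs (by linarith)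

lemma IsDefining.dz_sigma (hr : IsDefining Ω r) (hs : 0 < s) {z : Cn n} (hz : z ∈ Ω)
    (j : Fin n) : dz j (fun w => (sigma r s w : ℂ)) z
      = ((-(s * ((s - r z) ^ 2)⁻¹) : ℝ) : ℂ) * dz j (fun w => (r w : ℂ)) z :=
  dz_comp_ofReal j (sigma_deriv (hr.sub_pos hs hz).ne')
    (((hr.smooth z hz).contDiffAt (hr.isOpen.mem_nhds hz)).differentiableAt (by simp))

/-- σ is a decreasing concave function of the plurisubharmonic function r, so both terms of the
chain rule are nonpositive. -/
lemma IsDefining.leviForm_sigma_nonpos (hr : IsDefining Ω r) (hpsh : IsPlurisubharmonicOn r Ω)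
    (hs : 0 < s) {z : Cn n} (hz : z ∈ Ω) (ξ : Fin n → ℂ) : leviForm (sigma r s) z ξ ≤ 0 := by
  have h1 := hr.sub_pos hs hz
  have e := leviForm_comp hr.isOpen hr.smooth hz (g := fun t => 1 - s * (s - t)⁻¹)
    (fun w hw => sigma_deriv (hr.sub_pos hs hw).ne') (sigma_deriv2 h1.ne') ξ
  have e' : leviForm (sigma r s) z ξ = _ := e
  rw [e']
  have h2 := hpsh z hz ξ
  have h3 : 0 ≤ s * ((s - r z) ^ 2)⁻¹ * leviForm r z ξ := by positivity
  have h4 : 0 ≤ 2 * s * ((s - r z) ^ 3)⁻¹ * ‖∑ j, dz j (fun w => (r w : ℂ)) z * ξ j‖ ^ 2 := by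
    positivity
  linarith

lemma exists_bound_deriv_smoothTransition :
    ∃ C, ∀ t : ℝ, |deriv Real.smoothTransition t| ≤ C := by
  have hc : Continuous (deriv Real.smoothTransition) :=
    (Real.smoothTransition.contDiff (n := 1)).continuous_deriv le_rfl
  obtain ⟨C, hC⟩ := (isCompact_Icc (a := (0:ℝ)) (b := 1)).exists_bound_of_continuousOn
    hc.continuousOn
  refine ⟨max C 0, fun t => ?_⟩
  by_cases h : t ∈ Set.Icc (0:ℝ) 1
  · exact (hC t h).trans (le_max_left _ _)
  · have : deriv Real.smoothTransition t = 0 := by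
      rw [Set.mem_Icc, not_and_or, not_le, not_le] at h
      rcases h with h | h
      · have : Real.smoothTransition =ᶠ[𝓝 t] fun _ => 0 := by
          filter_upwards [gt_mem_nhds h] with x hx
          exact Real.smoothTransition.zero_of_nonpos hx.le
        rw [this.deriv_eq]; simp
      · have : Real.smoothTransition =ᶠ[𝓝 t] fun _ => 1 := by
          filter_upwards [lt_mem_nhds h] with x hx
          exact Real.smoothTransition.one_of_one_le hx.le
        rw [this.deriv_eq]; simp
    simp [this]

-- The cut-offs are smooth transitions in -(m+1)r - 1: they vanish where -r ≤ 1/(m+1) and equal 1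
-- where -r ≥ 2/(m+1). Extension by zero outside Ω is smooth because the support lies in a compact
-- sublevel set.
open Classical in
lemma IsDefining.isWeight_sigma (hr : IsDefining Ω r) (hs : 0 < s) :
    IsWeight Ω (sigma r s) := by
  obtain ⟨C, hC⟩ := hr.bdd_fderiv
  obtain ⟨Ct, hCt⟩ := exists_bound_deriv_smoothTransition
  have hCt0 : 0 ≤ Ct := (abs_nonneg _).trans (hCt 0)
  refine ⟨hr.sigma_smooth hs, fun z hz => hr.sigma_pos hs hz, fun z hz => hr.sigma_le_one hs hz,
    ⟨s⁻¹ * C, fun z hz j => ?_⟩, ?_⟩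
  · rw [hr.dz_sigma hs hz, norm_mul, Complex.norm_real, norm_neg]
    have h1 := hr.sub_pos hs hz
    have h2 := hr.neg z hz
    rw [Real.norm_of_nonneg (by positivity)]
    -- The derivative of σ in r is largest in size at r = 0, where it equals 1/s.
    have h3 : s * ((s - r z) ^ 2)⁻¹ ≤ s⁻¹ := by
      rw [← div_eq_mul_inv, div_le_iff₀ (by positivity), inv_mul_eq_div, le_div_iff₀ hs]
      nlinarith
    have h4 := (norm_dzL_le j _).trans (hC z hz)
    rw [← dz_eq] at h4
    gcongr
  · let c : ℕ → ℝ → ℝ := fun m t => Real.smoothTransition (-((m : ℝ) + 1) * t - 1)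
    have c0 : ∀ (m : ℕ) (t : ℝ), -((m : ℝ) + 1) * t - 1 ≤ 0 → c m t = 0 := fun m t h =>
      Real.smoothTransition.zero_of_nonpos h
    have c1 : ∀ (m : ℕ) (t : ℝ), 1 ≤ -((m : ℝ) + 1) * t - 1 → c m t = 1 := fun m t h =>
      Real.smoothTransition.one_of_one_le h
    have cs : ∀ m, ContDiff ℝ ∞ (c m) := fun m =>
      Real.smoothTransition.contDiff.comp ((contDiff_const.mul contDiff_id).sub contDiff_const)
    have cd : ∀ m t, HasDerivAt (c m)
        (deriv Real.smoothTransition (-((m : ℝ) + 1) * t - 1) * (-((m : ℝ) + 1))) t := by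
      intro m t
      have h1 : HasDerivAt (fun t : ℝ => -((m : ℝ) + 1) * t - 1) (-((m : ℝ) + 1)) t := by
        simpa using ((hasDerivAt_id t).const_mul (-((m : ℝ) + 1))).sub_const 1
      have h2 : HasDerivAt Real.smoothTransition _ (-((m : ℝ) + 1) * t - 1) :=
        ((Real.smoothTransition.contDiff (n := 1)).differentiable (by simp) _).hasDerivAt
      exact h2.comp t h1
    let η : ℕ → Cn n → ℝ := fun m z => if z ∈ Ω then c m (r z) else 0
    have ηΩ : ∀ m, ∀ z ∈ Ω, η m =ᶠ[𝓝 z] fun w => c m (r w) := fun m z hz => by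
      filter_upwards [hr.isOpen.mem_nhds hz] with w hw
      simp [η, hw]
    have η0 : ∀ (m : ℕ) (w : Cn n), w ∉ {z ∈ closure Ω | r z ≤ -(1 / ((m : ℝ) + 1))} → η m w = 0 := by
      intro m w hw
      by_cases hwΩ : w ∈ Ω
      · simp only [η, hwΩ, if_true]
        have h1 : -(1 / ((m : ℝ) + 1)) < r w := by
          by_contra h
          exact hw ⟨subset_closure hwΩ, not_lt.1 h⟩
        refine c0 m _ ?_
        have hp : (0:ℝ) < (m : ℝ) + 1 := by positivity
        have : ((m : ℝ) + 1) * -(1 / ((m : ℝ) + 1)) ≤ ((m : ℝ) + 1) * r w := by gcongr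
        rw [mul_neg, mul_one_div_cancel hp.ne'] at this
        linarith
      · simp [η, hwΩ]
    have hpos : ∀ m : ℕ, (0:ℝ) < 1 / ((m : ℝ) + 1) := fun m => by positivity
    refine ⟨η, fun m => ?_, fun m z => ?_, fun z hz => ?_, s⁻¹ * 2 * Ct * C, fun m z hz => ?_⟩
    · have hK := hr.compact _ (hpos m)
      have hs' : tsupport (fun z => (η m z : ℂ)) ⊆ {z ∈ closure Ω | r z ≤ -(1 / ((m : ℝ) + 1))} :=
        closure_minimal (fun z hz => by
          by_contra h
          exact hz (by simp [η0 m z h])) hK.isClosed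
      refine ⟨?_, hK.of_isClosed_subset (isClosed_tsupport _) hs',
        hs'.trans (hr.sublevel_subset _ (hpos m))⟩
      rw [contDiff_iff_contDiffAt]
      intro z
      by_cases hz : z ∈ Ω
      · have h1 : ContDiffAt ℝ ∞ (fun w => c m (r w)) z :=
          (cs m).contDiffAt.comp z ((hr.smooth z hz).contDiffAt (hr.isOpen.mem_nhds hz))
        exact Complex.ofRealCLM.contDiff.contDiffAt.comp z (h1.congr_of_eventuallyEq (ηΩ m z hz))
      · have h1 : z ∉ {z ∈ closure Ω | r z ≤ -(1 / ((m : ℝ) + 1))} := fun h =>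
          hz (hr.sublevel_subset _ (hpos m) h)
        have h2 : (fun z => (η m z : ℂ)) =ᶠ[𝓝 z] fun _ => 0 := by
          filter_upwards [hK.isClosed.isOpen_compl.mem_nhds h1] with w hw
          simp [η0 m w hw]
        exact contDiffAt_const.congr_of_eventuallyEq h2
    · by_cases hz : z ∈ Ω
      · simp only [η, hz, if_true]
        exact ⟨Real.smoothTransition.nonneg _, Real.smoothTransition.le_one _⟩
      · simp [η, hz]
    · have h1 := hr.neg z hz
      obtain ⟨m₀, hm₀⟩ := exists_nat_gt (2 / -r z)
      filter_upwards [eventually_ge_atTop m₀] with m hm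
      have h2 : ((m : ℝ) + 1) * r z < -2 := by
        have h3 : (m₀ : ℝ) ≤ m := by exact_mod_cast hm
        rw [div_lt_iff₀ (by linarith)] at hm₀
        nlinarith
      have hc : ContinuousAt (fun w => ((m : ℝ) + 1) * r w) z :=
        continuousAt_const.mul ((hr.smooth.continuousOn z hz).continuousAt (hr.isOpen.mem_nhds hz))
      filter_upwards [hc.eventually (gt_mem_nhds h2), ηΩ m z hz] with w hw hw'
      rw [hw']
      exact c1 m _ (by linarith)
    · have e1 : (fun w => (η m w : ℂ)) =ᶠ[𝓝 z] fun w => ((c m (r w) : ℝ) : ℂ) := by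
        filter_upwards [ηΩ m z hz] with w hw
        rw [hw]
      have dr : DifferentiableAt ℝ r z :=
        ((hr.smooth z hz).contDiffAt (hr.isOpen.mem_nhds hz)).differentiableAt (by simp)
      rw [e1.fderiv_eq, fderiv_comp_ofReal (cd m (r z)) dr, norm_smul, Complex.norm_real,
        Real.norm_eq_abs, abs_mul, abs_neg, abs_of_pos (by positivity : (0:ℝ) < (m : ℝ) + 1)]
      have h1 := hr.neg z hz
      have hσ := hr.sigma_le hs hz
      have hσ0 := (hr.sigma_pos hs hz).le
      have hC0 : 0 ≤ C := (norm_nonneg _).trans (hC z hz)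
      have key : sigma r s z * (|deriv Real.smoothTransition (-((m : ℝ) + 1) * r z - 1)|
          * ((m : ℝ) + 1)) ≤ s⁻¹ * 2 * Ct := by
        -- The derivative, of size O(m+1), lives only where -(m+1)r ≤ 2, and there σ(m+1) ≤ 2/s.
        by_cases hbig : -((m : ℝ) + 1) * r z - 1 ≤ 1
        · have h2 : sigma r s z * ((m : ℝ) + 1) ≤ s⁻¹ * 2 := by
            calc sigma r s z * ((m : ℝ) + 1) ≤ -r z / s * ((m : ℝ) + 1) := by gcongr
              _ = s⁻¹ * (-((m : ℝ) + 1) * r z) := by rw [div_eq_inv_mul]; ring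
              _ ≤ _ := by gcongr; linarith
          calc _ = sigma r s z * ((m : ℝ) + 1)
                * |deriv Real.smoothTransition (-((m : ℝ) + 1) * r z - 1)| := by ring
            _ ≤ s⁻¹ * 2 * Ct := by
                gcongr
                exact hCt _
        · have h0 : deriv Real.smoothTransition (-((m : ℝ) + 1) * r z - 1) = 0 := by
            have : Real.smoothTransition =ᶠ[𝓝 (-((m : ℝ) + 1) * r z - 1)] fun _ => 1 := by
              filter_upwards [lt_mem_nhds (not_le.1 hbig)] with x hx
              exact Real.smoothTransition.one_of_one_le hx.le
            rw [this.deriv_eq]; simp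
          rw [h0]; simp; positivity
      calc _ = sigma r s z * (|deriv Real.smoothTransition (-((m : ℝ) + 1) * r z - 1)|
            * ((m : ℝ) + 1)) * ‖fderiv ℝ (fun w => (r w : ℂ)) z‖ := by ring
        _ ≤ s⁻¹ * 2 * Ct * C := by
          gcongr
          exact hC z hz

end Sigma

end DefiningFunction

/-! ### Two weighted estimates -/

section ConcreteWeights

variable {n : ℕ} {Ω : Set (Cn n)}

lemma hform_ofReal_smul (c : ℝ) (B : Matrix (Fin n) (Fin n) ℂ) (ξ : Fin n → ℂ) :
    hform ((c : ℂ) • B) ξ = c * hform B ξ := by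
  simp only [hform, Matrix.smul_apply, smul_eq_mul, mul_assoc, ← Finset.mul_sum,
    Complex.re_ofReal_mul]

lemma hform_one (ξ : Fin n → ℂ) : hform 1 ξ = ∑ j, ‖ξ j‖ ^ 2 := by
  have : ∀ j : Fin n, ∑ k, (1 : Matrix (Fin n) (Fin n) ℂ) j k * ξ j * conj (ξ k)
      = ((‖ξ j‖ ^ 2 : ℝ) : ℂ) := fun j => by
    rw [Finset.sum_eq_single j (fun k _ hk => by simp [Matrix.one_apply_ne hk.symm]) (by simp),
      Matrix.one_apply_eq, one_mul, Complex.mul_conj, Complex.normSq_eq_norm_sq]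
  simp only [hform, this, ← Complex.ofReal_sum, Complex.ofReal_re]

lemma IsBddMatrix.of_continuousOn (hΩ : IsOpen Ω) {B : Cn n → Matrix (Fin n) (Fin n) ℂ} {C : ℝ}
    (h : ∀ j k, ContDiffOn ℝ ∞ (fun z => B z j k) Ω) (hC : ∀ z ∈ Ω, ∀ j k, ‖B z j k‖ ≤ C) :
    IsBddMatrix Ω B C := fun j k =>
  ⟨(h j k).continuousOn.aestronglyMeasurable hΩ.measurableSet,
    (ae_restrict_iff' hΩ.measurableSet).2 (Eventually.of_forall fun z hz => hC z hz j k)⟩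

lemma weightedBound_of_weight (hΩ : IsOpen Ω) {a σ : Cn n → ℝ} (ha : ContDiffOn ℝ ∞ a Ω)
    (hσ : ContDiffOn ℝ ∞ σ Ω) {M : ℝ} (ha0 : ∀ z ∈ Ω, 0 < a z) (haM : ∀ z ∈ Ω, a z ≤ M)
    (hσ0 : ∀ z ∈ Ω, 0 < σ z) (hLs : ∀ z ∈ Ω, ∀ ξ, leviForm σ z ξ ≤ 0)
    {B : Cn n → Matrix (Fin n) (Fin n) ℂ} {CB : ℝ} (hB : IsBddMatrix Ω B CB)
    (hA : ∀ z ∈ Ω, ∀ ξ : Fin n → ℂ, ‖∑ j, dz j (fun w => (a w : ℂ)) z * ξ j‖ ^ 2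
      + a z * hform (B z) ξ ≤ -a z * leviForm a z ξ) : WeightedBound Ω σ B (4 * M) := by
  intro U hU
  have e : ∀ z, hform (B z) (fun j => (σ z : ℂ) ^ 8 * U j z)
      = σ z ^ 16 * hform (B z) (fun j => U j z) := fun z => by
    rw [← Complex.ofReal_pow, hform_smul]; ring
  have hσc : ContDiffOn ℝ ∞ (fun z => (σ z : ℂ) ^ 8) Ω := hσ.ofReal_comp.pow 8
  have hU' : ∀ j, MemLp (fun z => (σ z : ℂ) ^ 8 * U j z) 2 (volume.restrict Ω) := fun j =>
    ((hU j).mul_contDiffOn hΩ hσc).memLp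
  have hint : IntegrableOn (fun z => σ z ^ 16 * hform (B z) (fun j => U j z)) Ω := by
    have := (hB.integrable hU' hU').re
    refine this.congr (Eventually.of_forall fun z => ?_)
    exact e z
  simp only [e]
  exact weighted_estimate hΩ ha hσ ha0 haM hσ0 hLs hA hU hint

lemma IsDefining.exp_smooth {r : Cn n → ℝ} (hr : IsDefining Ω r) (δ : ℝ) :
    ContDiffOn ℝ ∞ (fun z => Real.exp (r z / δ)) Ω := (hr.smooth.div_const δ).exp

lemma IsDefining.exp_le_one {r : Cn n → ℝ} (hr : IsDefining Ω r) {δ : ℝ} (hδ : 0 < δ)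
    {z : Cn n} (hz : z ∈ Ω) : Real.exp (r z / δ) ≤ 1 :=
  Real.exp_le_one_iff.2 (div_nonpos_of_nonpos_of_nonneg (hr.neg z hz).le hδ.le)

lemma IsDefining.exists_isBddMatrix {r : Cn n → ℝ} (hr : IsDefining Ω r) {δ : ℝ} (hδ : 0 < δ) :
    ∃ C, IsBddMatrix Ω (fun z => (Real.exp (r z / δ) : ℂ) • complexHessian r z) C := by
  obtain ⟨C, hC⟩ := hr.bdd_hessian
  refine ⟨C, .of_continuousOn hr.isOpen (fun j k => ?_) fun z hz j k => ?_⟩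
  · exact (hr.exp_smooth δ).ofReal_comp.mul (contDiffOn_complexHessian hr.isOpen hr.smooth j k)
  · rw [Matrix.smul_apply, smul_eq_mul, norm_mul, Complex.norm_real,
      Real.norm_of_nonneg (Real.exp_pos _).le]
    exact (mul_le_of_le_one_left (norm_nonneg _) (hr.exp_le_one hδ hz)).trans (hC z hz j k)

lemma isBddMatrix_half (hΩ : IsOpen Ω) :
    IsBddMatrix Ω (fun _ => ((1 / 2 : ℝ) : ℂ) • (1 : Matrix (Fin n) (Fin n) ℂ)) 1 := by
  refine .of_continuousOn hΩ (fun j k => contDiffOn_const) fun z hz j k => ?_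
  rw [Matrix.smul_apply, Matrix.one_apply]
  split_ifs <;> norm_num

/-- With e = e^{r/δ} and a = 2δ - δe, minus the Levi form of a is e ℒ + (e/δ)|∂r|². The second term
absorbs |∂a|² and the first is the matrix B. Since δ ≤ a ≤ 2δ on Ω, the constant 4M is 8δ, and its
smallness in δ is the source of compactness. -/
theorem IsDefining.weightedBound_hessian {r : Cn n → ℝ} (hr : IsDefining Ω r)
    (hpsh : IsPlurisubharmonicOn r Ω) {s δ : ℝ} (hs : 0 < s) (hδ : 0 < δ) :
    WeightedBound Ω (sigma r s) (fun z => (Real.exp (r z / δ) : ℂ) • complexHessian r z)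
      (8 * δ) := by
  have hΩ := hr.isOpen
  obtain ⟨C, hB⟩ := hr.exists_isBddMatrix hδ
  have hexp := hr.exp_smooth δ
  have hle : ∀ z ∈ Ω, Real.exp (r z / δ) ≤ 1 := fun z hz => hr.exp_le_one hδ hz
  have d1 : ∀ t : ℝ, HasDerivAt (fun t => Real.exp (t / δ)) (Real.exp (t / δ) / δ) t := fun t => by
    have := ((hasDerivAt_id t).div_const δ).exp
    exact this.congr_deriv (by simp [div_eq_mul_inv])
  have d2 : ∀ t : ℝ, HasDerivAt (fun t => 2 * δ - δ * Real.exp (t / δ)) (-Real.exp (t / δ)) t :=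
    fun t => (((d1 t).const_mul δ).const_sub (2 * δ)).congr_deriv (by field_simp)
  have d3 : ∀ t : ℝ, HasDerivAt (fun t => -Real.exp (t / δ)) (-(Real.exp (t / δ) / δ)) t :=
    fun t => (d1 t).neg
  have e8 : 8 * δ = 4 * (2 * δ) := by ring
  rw [e8]
  refine weightedBound_of_weight (a := fun z => 2 * δ - δ * Real.exp (r z / δ)) hΩ
    (contDiffOn_const.sub (contDiffOn_const.mul hexp)) (hr.sigma_smooth hs) (fun z hz => ?_)
    (fun z _ => ?_) (fun z hz => hr.sigma_pos hs hz)
    (fun z hz ξ => hr.leviForm_sigma_nonpos hpsh hs hz ξ) hB fun z hz ξ => ?_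
  · have := hle z hz
    nlinarith
  · have := (Real.exp_pos (r z / δ)).le
    nlinarith
  · have dr : DifferentiableAt ℝ r z :=
      ((hr.smooth z hz).contDiffAt (hΩ.mem_nhds hz)).differentiableAt (by simp)
    have ed : ∀ j, dz j (fun w => ((2 * δ - δ * Real.exp (r w / δ) : ℝ) : ℂ)) z
        = ((-Real.exp (r z / δ) : ℝ) : ℂ) * dz j (fun w => (r w : ℂ)) z := fun j =>
      dz_comp_ofReal j (d2 (r z)) dr
    have el : leviForm (fun w => 2 * δ - δ * Real.exp (r w / δ)) z ξ = _ :=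
      leviForm_comp hΩ hr.smooth hz (g := fun t => 2 * δ - δ * Real.exp (t / δ))
        (g₁ := fun t => -Real.exp (t / δ)) (fun w _ => d2 (r w)) (d3 (r z)) ξ
    have e1 : hform (complexHessian r z) ξ = leviForm r z ξ := rfl
    rw [el, hform_ofReal_smul, e1]
    simp only [ed, mul_assoc, ← Finset.mul_sum]
    rw [norm_mul, Complex.norm_real, norm_neg, Real.norm_of_nonneg (Real.exp_pos _).le]
    set e := Real.exp (r z / δ)
    set V := ‖∑ j, dz j (fun w => (r w : ℂ)) z * ξ j‖
    have he : 0 < e := Real.exp_pos _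
    have he1 : e ≤ 1 := hle z hz
    -- Equivalent to e ≤ 1 ≤ 2 - e; this is why the constant term of a is 2δ.
    have h1 : e ≤ (2 * δ - δ * e) / δ := by
      rw [le_div_iff₀ hδ]; nlinarith
    have h2 : e * (e * V ^ 2) ≤ (2 * δ - δ * e) / δ * (e * V ^ 2) := by gcongr
    calc _ = e * (e * V ^ 2) + (2 * δ - δ * e) * (e * leviForm r z ξ) := by ring
      _ ≤ (2 * δ - δ * e) / δ * (e * V ^ 2) + (2 * δ - δ * e) * (e * leviForm r z ξ) := by gcongr
      _ = _ := by ring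

/-! ### Derivatives of M - |z|². -/

section NormSq

lemma hasFDerivAt_coord (i : Fin n) (z : Cn n) :
    HasFDerivAt (fun w : Cn n => w i)
      ((EuclideanSpace.proj i : Cn n →L[ℂ] ℂ).restrictScalars ℝ) z :=
  ((EuclideanSpace.proj i : Cn n →L[ℂ] ℂ).restrictScalars ℝ).hasFDerivAt

lemma differentiableAt_coord (i : Fin n) (z : Cn n) :
    DifferentiableAt ℝ (fun w : Cn n => w i) z := (hasFDerivAt_coord i z).differentiableAt

lemma differentiableAt_conj_coord (i : Fin n) (z : Cn n) :
    DifferentiableAt ℝ (fun w : Cn n => conj (w i)) z :=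
  Complex.conjCLE.differentiableAt.comp z (differentiableAt_coord i z)

lemma dz_coord (i j : Fin n) (z : Cn n) :
    dz j (fun w : Cn n => w i) z = if j = i then 1 else 0 := by
  rw [dz, (hasFDerivAt_coord i z).fderiv]
  rcases eq_or_ne j i with h | h
  · subst h; simp; norm_num
  · simp [h, h.symm]

lemma dzbar_coord (i j : Fin n) (z : Cn n) : dzbar j (fun w : Cn n => w i) z = 0 := by
  rw [dzbar, (hasFDerivAt_coord i z).fderiv]
  rcases eq_or_ne j i with h | h
  · subst h; simp
  · simp [h.symm]

lemma fderiv_normSq (M : ℝ) (z : Cn n) :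
    fderiv ℝ (fun w : Cn n => ((M - ‖w‖ ^ 2 : ℝ) : ℂ)) z
      = -∑ i, fderiv ℝ (fun w : Cn n => w i * conj (w i)) z := by
  have e : (fun w : Cn n => ((M - ‖w‖ ^ 2 : ℝ) : ℂ))
      = fun w => (M : ℂ) - ∑ i, w i * conj (w i) := by
    funext w
    rw [EuclideanSpace.norm_sq_eq]
    push_cast
    simp [Complex.mul_conj, Complex.normSq_eq_norm_sq]
  have hd : ∀ i, DifferentiableAt ℝ (fun w : Cn n => w i * conj (w i)) z := fun i =>
    (differentiableAt_coord i z).mul (differentiableAt_conj_coord i z)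
  rw [e, fderiv_const_sub, fderiv_fun_sum fun i _ => hd i]

lemma dz_normSq (M : ℝ) (j : Fin n) (z : Cn n) :
    dz j (fun w : Cn n => ((M - ‖w‖ ^ 2 : ℝ) : ℂ)) z = -conj (z j) := by
  rw [dz_eq, fderiv_normSq, map_neg, map_sum]
  simp only [← dz_eq]
  congr 1
  rw [Finset.sum_eq_single j]
  · rw [dz_mul j (differentiableAt_coord j z) (differentiableAt_conj_coord j z), dz_coord,
      dz_conj, dzbar_coord]
    simp
  · intro i _ hi
    rw [dz_mul j (differentiableAt_coord i z) (differentiableAt_conj_coord i z), dz_coord,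
      dz_conj, dzbar_coord]
    simp [hi.symm]
  · simp

lemma dzbar_normSq (M : ℝ) (j : Fin n) (z : Cn n) :
    dzbar j (fun w : Cn n => ((M - ‖w‖ ^ 2 : ℝ) : ℂ)) z = -(z j) := by
  rw [dzbar_ofReal, dz_normSq]; simp

lemma complexHessian_normSq (M : ℝ) (z : Cn n) :
    complexHessian (fun w : Cn n => M - ‖w‖ ^ 2) z = -1 := by
  ext j k
  have e : complexHessian (fun w : Cn n => M - ‖w‖ ^ 2) z j k
      = dz j (dzbar k fun w : Cn n => ((M - ‖w‖ ^ 2 : ℝ) : ℂ)) z := rfl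
  have e2 : (dzbar k fun w : Cn n => ((M - ‖w‖ ^ 2 : ℝ) : ℂ)) = fun w => -(w k) := by
    funext w; exact dzbar_normSq M k w
  have e3 : fderiv ℝ (fun w : Cn n => -(w k)) z = -fderiv ℝ (fun w : Cn n => w k) z := fderiv_neg
  rw [e, e2, dz_eq, e3, map_neg, ← dz_eq, dz_coord, Matrix.neg_apply, Matrix.one_apply]

lemma leviForm_normSq (M : ℝ) (z : Cn n) (ξ : Fin n → ℂ) :
    leviForm (fun w : Cn n => M - ‖w‖ ^ 2) z ξ = -∑ j, ‖ξ j‖ ^ 2 := by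
  have e : leviForm (fun w : Cn n => M - ‖w‖ ^ 2) z ξ = hform (-1) ξ := by
    rw [← complexHessian_normSq M z]; rfl
  have e1 : (-1 : Matrix (Fin n) (Fin n) ℂ) = ((-1 : ℝ) : ℂ) • 1 := by simp
  rw [e, e1, hform_ofReal_smul, hform_one]; ring

end NormSq

/-- For a = 3R² + 1 - |z|² minus the Levi form is |ξ|², and a ≥ 2R² + 1 makes half of a|ξ|² dominate
|∂a(ξ)|² ≤ R²|ξ|²; the other half is B. This yields the basic L² estimate. -/
theorem IsDefining.weightedBound_one {r : Cn n → ℝ} (hr : IsDefining Ω r)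
    (hpsh : IsPlurisubharmonicOn r Ω) {s R : ℝ} (hs : 0 < s) (hR : ∀ z ∈ Ω, ‖z‖ ≤ R) :
    WeightedBound Ω (sigma r s) (fun _ => ((1 / 2 : ℝ) : ℂ) • 1) (4 * (3 * R ^ 2 + 1)) := by
  have hΩ := hr.isOpen
  have hB := isBddMatrix_half hΩ
  have hz2 : ∀ z ∈ Ω, ‖z‖ ^ 2 ≤ R ^ 2 := fun z hz => by
    have := hR z hz
    gcongr
  refine weightedBound_of_weight (a := fun z => (3 * R ^ 2 + 1) - ‖z‖ ^ 2) hΩ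
    (contDiff_const.sub (contDiff_norm_sq ℂ)).contDiffOn (hr.sigma_smooth hs) (fun z hz => ?_)
    (fun z _ => ?_) (fun z hz => hr.sigma_pos hs hz)
    (fun z hz ξ => hr.leviForm_sigma_nonpos hpsh hs hz ξ) hB fun z hz ξ => ?_
  · have := hz2 z hz
    nlinarith [sq_nonneg R]
  · have := sq_nonneg ‖z‖
    linarith
  · rw [leviForm_normSq, hform_ofReal_smul, hform_one]
    simp only [dz_normSq]
    have h1 : ‖∑ j, -conj (z j) * ξ j‖ ^ 2 ≤ ‖z‖ ^ 2 * ∑ j, ‖ξ j‖ ^ 2 := by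
      rw [EuclideanSpace.norm_sq_eq]
      refine le_trans ?_ (Finset.sum_mul_sq_le_sq_mul_sq Finset.univ (fun j => ‖z j‖)
        fun j => ‖ξ j‖)
      gcongr
      refine (norm_sum_le _ _).trans (le_of_eq ?_)
      simp
    have h2 := hz2 z hz
    have h3 : (0:ℝ) ≤ ∑ j, ‖ξ j‖ ^ 2 := Finset.sum_nonneg fun _ _ => sq_nonneg _
    have h4 : ‖z‖ ^ 2 * ∑ j, ‖ξ j‖ ^ 2 ≤ R ^ 2 * ∑ j, ‖ξ j‖ ^ 2 := by gcongr
    have h5 : R ^ 2 * ∑ j, ‖ξ j‖ ^ 2 ≤ (3 * R ^ 2 + 1 - ‖z‖ ^ 2) * (1 / 2) * ∑ j, ‖ξ j‖ ^ 2 := by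
      gcongr
      nlinarith [sq_nonneg R]
    linarith

end ConcreteWeights

/-! ### Hilbert space preliminaries -/

section HilbertSpace

variable {n : ℕ} {Ω : Set (Cn n)}

/-- The bound makes ℓ factor through the range of θ as a bounded functional; Hahn–Banach extends it
with the same norm and Riesz represents it. -/
lemma exists_riesz_of_norm_le {D E : Type*} [AddCommGroup D] [Module ℂ D] [NormedAddCommGroup E]
    [InnerProductSpace ℂ E] [CompleteSpace E] (θ : D →ₗ[ℂ] E) (ℓ : D →ₗ[ℂ] ℂ) {K : ℝ} (hK : 0 ≤ K)
    (h : ∀ x, ‖ℓ x‖ ≤ K * ‖θ x‖) : ∃ β : E, ‖β‖ ≤ K ∧ ∀ x, ℓ x = inner ℂ β (θ x) := by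
  obtain ⟨g, hg⟩ := θ.rangeRestrict.exists_rightInverse_of_surjective θ.range_rangeRestrict
  have hg' : ∀ e : θ.range, θ (g e) = e := fun e => congrArg Subtype.val (LinearMap.congr_fun hg e)
  let f : StrongDual ℂ θ.range := (ℓ ∘ₗ g).mkContinuous K fun e => by
    have := h (g e)
    rwa [hg'] at this
  obtain ⟨F, hF, hFn⟩ := exists_extension_norm_eq θ.range f
  refine ⟨(InnerProductSpace.toDual ℂ E).symm F, ?_, fun x => ?_⟩
  · rw [LinearIsometryEquiv.norm_map, hFn]
    exact LinearMap.mkContinuous_norm_le _ hK _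
  · rw [InnerProductSpace.toDual_symm_apply]
    have h1 : F (θ x) = ℓ (g (θ.rangeRestrict x)) := hF (θ.rangeRestrict x)
    -- The difference of x and the chosen preimage of θ x lies in the kernel of θ, hence in the
    -- kernel of ℓ.
    have h2 := h (x - g (θ.rangeRestrict x))
    rw [map_sub, map_sub, hg', show (θ.rangeRestrict x : E) = θ x from rfl, sub_self, norm_zero, mul_zero] at h2
    rw [h1]
    exact sub_eq_zero.1 (norm_le_zero_iff.1 h2)

/-- The form with the given square-integrable coefficients. -/
def form1 (v : Fin n → Cn n → ℂ) (hv : ∀ j, MemLp (v j) 2 (volume.restrict Ω)) : L2Form1 Ω :=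
  WithLp.toLp 2 fun j => (hv j).toLp (v j)

lemma form1_coeFn {v : Fin n → Cn n → ℂ} (hv : ∀ j, MemLp (v j) 2 (volume.restrict Ω))
    (j : Fin n) : form1 v hv j =ᵐ[volume.restrict Ω] v j := (hv j).coeFn_toLp

lemma inner_form1 {v : Fin n → Cn n → ℂ} (hv : ∀ j, MemLp (v j) 2 (volume.restrict Ω))
    (x : L2Form1 Ω) : inner ℂ (form1 v hv) x = ∑ j, ∫ z in Ω, x j z * conj (v j z) := by
  rw [PiLp.inner_apply]
  refine Finset.sum_congr rfl fun j _ => ?_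
  rw [L2.inner_def]
  refine integral_congr_ae ?_
  filter_upwards [form1_coeFn hv j] with z hz
  rw [hz]; rfl

lemma inner_form1_right {v : Fin n → Cn n → ℂ} (hv : ∀ j, MemLp (v j) 2 (volume.restrict Ω))
    (x : L2Form1 Ω) : inner ℂ x (form1 v hv) = ∑ j, ∫ z in Ω, v j z * conj (x j z) := by
  rw [PiLp.inner_apply]
  refine Finset.sum_congr rfl fun j _ => ?_
  rw [L2.inner_def]
  refine integral_congr_ae ?_
  filter_upwards [form1_coeFn hv j] with z hz
  rw [hz]; rfl

lemma norm_form1_sq (x : L2Form1 Ω) : ‖x‖ ^ 2 = ∑ j, ∫ z in Ω, ‖x j z‖ ^ 2 := by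
  rw [PiLp.norm_sq_eq_of_L2]
  exact Finset.sum_congr rfl fun j _ => norm_L2_sq _

lemma norm_form2_sq (x : L2Form2 Ω) : ‖x‖ ^ 2 = ∑ i, ∫ z in Ω, ‖x i z‖ ^ 2 := by
  rw [PiLp.norm_sq_eq_of_L2]
  exact Finset.sum_congr rfl fun j _ => norm_L2_sq _

lemma tendsto_form1 {v : ℕ → Fin n → Cn n → ℂ} {v₀ : Fin n → Cn n → ℂ}
    (h : ∀ j, L2Tendsto Ω (fun m => v m j) (v₀ j)) :
    Tendsto (fun m => form1 (v m) fun j => (h j).1 m) atTop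
      (𝓝 (form1 v₀ fun j => (h j).2.1)) :=
  ((PiLp.continuous_toLp 2 _).tendsto _).comp (tendsto_pi_nhds.2 fun j => (h j).toLp)

/-- The integrated sesquilinear form of a matrix function. -/
def sesq (Ω : Set (Cn n)) (B : Cn n → Matrix (Fin n) (Fin n) ℂ) (x y : Fin n → Cn n → ℂ) : ℂ :=
  ∫ z in Ω, ∑ j, ∑ k, B z j k * x j z * conj (y k z)

/-- Smooth bounded positive semidefinite Hermitian matrix functions on `Ω`. -/
structure IsPsdMatrix (Ω : Set (Cn n)) (B : Cn n → Matrix (Fin n) (Fin n) ℂ) : Prop where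
  smooth : ∀ j k, ContDiffOn ℝ ∞ (fun z => B z j k) Ω
  bdd : ∃ C, IsBddMatrix Ω B C
  herm : ∀ z ∈ Ω, ∀ j k, conj (B z j k) = B z k j
  nonneg : ∀ z ∈ Ω, ∀ ξ, 0 ≤ hform (B z) ξ

lemma integral_hform_nonneg (hΩ : IsOpen Ω) {B : Cn n → Matrix (Fin n) (Fin n) ℂ}
    (hB : IsPsdMatrix Ω B) (x : Fin n → Cn n → ℂ) :
    0 ≤ ∫ z in Ω, hform (B z) (fun j => x j z) :=
  setIntegral_nonneg hΩ.measurableSet fun z hz => hB.nonneg z hz _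

lemma hform_add_mul {B : Matrix (Fin n) (Fin n) ℂ} (hB : ∀ j k, conj (B j k) = B k j)
    (c : ℂ) (ξ η : Fin n → ℂ) : hform B (fun j => ξ j + c * η j) = hform B ξ
      + 2 * (conj c * ∑ j, ∑ k, B j k * ξ j * conj (η k)).re + ‖c‖ ^ 2 * hform B η := by
  have e : ∑ j, ∑ k, B j k * (ξ j + c * η j) * conj (ξ k + c * η k)
      = (∑ j, ∑ k, B j k * ξ j * conj (ξ k)) + (conj c * ∑ j, ∑ k, B j k * ξ j * conj (η k))
        + c * (∑ j, ∑ k, B j k * η j * conj (ξ k))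
        + ((‖c‖ ^ 2 : ℝ) : ℂ) * ∑ j, ∑ k, B j k * η j * conj (η k) := by
    rw [← Complex.normSq_eq_norm_sq, ← Complex.mul_conj]
    simp only [Finset.mul_sum, ← Finset.sum_add_distrib, map_add, map_mul]
    exact Finset.sum_congr rfl fun j _ => Finset.sum_congr rfl fun k _ => by ring
  have e2 : c * (∑ j, ∑ k, B j k * η j * conj (ξ k))
      = conj (conj c * ∑ j, ∑ k, B j k * ξ j * conj (η k)) := by
    rw [map_mul, Complex.conj_conj]
    congr 1
    rw [Finset.sum_comm]
    simp only [map_sum, map_mul, hB, Complex.conj_conj]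
    exact Finset.sum_congr rfl fun j _ => Finset.sum_congr rfl fun k _ => by ring
  simp only [hform, e, e2, Complex.add_re, Complex.conj_re, Complex.re_ofReal_mul]
  ring

/-- Cauchy–Schwarz for the integrated semidefinite form. -/
lemma norm_sesq_sq_le (hΩ : IsOpen Ω) {B : Cn n → Matrix (Fin n) (Fin n) ℂ}
    (hB : IsPsdMatrix Ω B) {x y : Fin n → Cn n → ℂ}
    (hx : ∀ j, MemLp (x j) 2 (volume.restrict Ω)) (hy : ∀ j, MemLp (y j) 2 (volume.restrict Ω)) :
    ‖sesq Ω B x y‖ ^ 2 ≤ (∫ z in Ω, hform (B z) (fun j => x j z))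
      * ∫ z in Ω, hform (B z) (fun j => y j z) := by
  obtain ⟨CB, hCB⟩ := hB.bdd
  set A := ∫ z in Ω, hform (B z) (fun j => x j z)
  set D := ∫ z in Ω, hform (B z) (fun j => y j z)
  set w := sesq Ω B x y
  have hi := hCB.integrable hx hy
  have key : ∀ c : ℂ, 0 ≤ A + 2 * (conj c * w).re + ‖c‖ ^ 2 * D := fun c => by
    have h0 := integral_hform_nonneg hΩ hB fun j z => x j z + c * y j z
    have e : ∫ z in Ω, hform (B z) (fun j => x j z + c * y j z)
        = A + 2 * (conj c * w).re + ‖c‖ ^ 2 * D := by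
      have e1 : (conj c * w).re
          = ∫ z in Ω, (conj c * ∑ j, ∑ k, B z j k * x j z * conj (y k z)).re := by
        rw [show conj c * w = ∫ z in Ω, conj c * ∑ j, ∑ k, B z j k * x j z * conj (y k z) from
          (integral_const_mul _ _).symm]
        exact (integral_re (hi.const_mul _)).symm
      rw [e1, ← integral_const_mul, ← integral_const_mul, ← integral_add, ← integral_add]
      · exact setIntegral_congr_fun hΩ.measurableSet fun z hz =>
          hform_add_mul (hB.herm z hz) c _ _
      · exact (hCB.integrable hx hx).re.add ((hi.const_mul _).re.const_mul 2)
      · exact (hCB.integrable hy hy).re.const_mul _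
      · exact (hCB.integrable hx hx).re
      · exact (hi.const_mul _).re.const_mul 2
    rwa [e] at h0
  -- The choice c = -t w aligns the phase and turns positivity into a real quadratic in t, whose
  -- discriminant is nonpositive.
  have key2 : ∀ t : ℝ, 0 ≤ (‖w‖ ^ 2 * D) * (t * t) + (-(2 * ‖w‖ ^ 2)) * t + A := fun t => by
    have h1 := key (-(t : ℂ) * w)
    have h2 : (conj (-(t : ℂ) * w) * w) = ((-(t * ‖w‖ ^ 2) : ℝ) : ℂ) := by
      rw [← Complex.normSq_eq_norm_sq, Complex.ofReal_neg, Complex.ofReal_mul,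
        Complex.normSq_eq_conj_mul_self]
      simp only [map_mul, map_neg, Complex.conj_ofReal]; ring
    rw [h2, Complex.ofReal_re, norm_mul, norm_neg, Complex.norm_real, mul_pow, Real.norm_eq_abs,
      sq_abs] at h1
    linarith
  have h3 := discrim_le_zero key2
  rw [discrim] at h3
  rcases eq_or_ne w 0 with h | h
  · rw [h]
    have := mul_nonneg (integral_hform_nonneg hΩ hB x) (integral_hform_nonneg hΩ hB y)
    simpa using this
  · have hw : 0 < ‖w‖ ^ 2 := by positivity
    nlinarith

end HilbertSpace

/-! ### Weak equations: elementary operations -/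

section WeakEqOperations

variable {n : ℕ} {Ω : Set (Cn n)}

lemma WeakEq.congr_ae {ℓ : Fin n → ((Cn n →L[ℝ] ℂ) →L[ℂ] ℂ)} {f f' : Fin n → Cn n → ℂ}
    {g g' : Cn n → ℂ} (h : WeakEq Ω ℓ f g) (hf : ∀ i, f i =ᵐ[volume.restrict Ω] f' i)
    (hg : g =ᵐ[volume.restrict Ω] g') : WeakEq Ω ℓ f' g' := by
  intro φ hφ
  have e1 : ∀ i, ∫ z in Ω, f' i z * ℓ i (fderiv ℝ φ z) = ∫ z in Ω, f i z * ℓ i (fderiv ℝ φ z) :=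
    fun i => integral_congr_ae (by filter_upwards [hf i] with z hz; rw [hz])
  have e2 : ∫ z in Ω, g' z * φ z = ∫ z in Ω, g z * φ z :=
    integral_congr_ae (by filter_upwards [hg] with z hz; rw [hz])
  simp only [e1, e2]
  exact h φ hφ

lemma WeakEq.sub {ℓ : Fin n → ((Cn n →L[ℝ] ℂ) →L[ℂ] ℂ)} {f f' : Fin n → Cn n → ℂ}
    {g g' : Cn n → ℂ} (h : WeakEq Ω ℓ f g) (h' : WeakEq Ω ℓ f' g')
    (hf : ∀ i, TestIntegrable Ω (f i)) (hf' : ∀ i, TestIntegrable Ω (f' i))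
    (hg : TestIntegrable Ω g) (hg' : TestIntegrable Ω g') :
    WeakEq Ω ℓ (fun i z => f i z - f' i z) (fun z => g z - g' z) := by
  intro φ hφ
  simp only [sub_mul]
  rw [integral_sub (hg φ hφ) (hg' φ hφ)]
  simp only [fun i => integral_sub (hf i _ (hφ.clm_fderiv (ℓ i))) (hf' i _ (hφ.clm_fderiv (ℓ i)))]
  rw [Finset.sum_sub_distrib, h φ hφ, h' φ hφ]
  ring

lemma weakEq_dzL_of_isTest (hΩ : IsOpen Ω) {v : Fin n → Cn n → ℂ} (hv : ∀ j, IsTest Ω (v j)) :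
    WeakEq Ω dzL v (divz v) := by
  intro φ hφ
  have e : ∀ j, ∫ z in Ω, v j z * dzL j (fderiv ℝ φ z) = -∫ z in Ω, dz j (v j) z * φ z := by
    intro j
    have h1 := ((hv j).mul_contDiffOn hΩ hφ.contDiffOn).integral_dz_eq_zero j
    simp only [fun z => dz_mul j (hφ.diffAt z) ((hv j).diffAt z)] at h1
    have i1 : IntegrableOn (fun z => v j z * dz j φ z) Ω :=
      ((hv j).mul_contDiffOn hΩ (hφ.dz j).contDiffOn).integrableOn.congr
        (Eventually.of_forall fun z => mul_comm _ _)
    have i2 : IntegrableOn (fun z => dz j (v j) z * φ z) Ω :=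
      (hφ.mul_contDiffOn hΩ ((hv j).dz j).contDiffOn).integrableOn
    rw [eq_neg_iff_add_eq_zero, ← h1]
    simp only [← dz_eq]
    rw [← integral_add i1 i2]
    exact integral_congr_ae (Eventually.of_forall fun z => by simp only; ring)
  simp only [e, Finset.sum_neg_distrib, divz, Finset.sum_mul]
  rw [integral_finsetSum]
  intro j _
  exact (hφ.mul_contDiffOn hΩ ((hv j).dz j).contDiffOn).integrableOn

lemma mem_dbar1Graph_iff {u : L2Form1 Ω} {α : L2Form2 Ω} :
    (u, α) ∈ dbar1Graph Ω ↔
      ∀ i : Pairs n, WeakEq Ω (dbarL i) (fun k z => u k z) (fun z => α i z) := by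
  refine forall_congr' fun i => forall_congr' fun φ => forall_congr' fun hφ => ?_
  rw [sum_dbarL i (fun k ℓ => ∫ z in Ω, u k z * ℓ (fderiv ℝ φ z))]
  · rfl
  · intro k ℓ ℓ'
    rw [← integral_sub ((hφ.clm_fderiv ℓ).integrable_mul _) ((hφ.clm_fderiv ℓ').integrable_mul _)]
    exact integral_congr_ae (Eventually.of_forall fun z => mul_sub _ _ _)

end WeakEqOperations

/-! ### Splitting a form along the kernel of the weighted `∂̄` -/

section Splitting

variable {n : ℕ} {Ω : Set (Cn n)}

lemma dzbar_dzbar_comm (j k : Fin n) {f : Cn n → ℂ} (hΩ : IsOpen Ω) (hf : ContDiffOn ℝ ∞ f Ω)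
    {z : Cn n} (hz : z ∈ Ω) : dzbar j (dzbar k f) z = dzbar k (dzbar j f) z := by
  have hs : IsSymmSndFDerivAt ℝ f z :=
    ((hf z hz).contDiffAt (hΩ.mem_nhds hz)).isSymmSndFDerivAt (by
      simpa using (WithTop.coe_le_coe.2 le_top : ((2 : ℕ∞) : WithTop ℕ∞) ≤ ∞))
  have e1 : ∀ k u, fderiv ℝ (dzbar k f) z u = dzbarL k (fderiv ℝ (fderiv ℝ f) z u) := fun k =>
    fderiv_clm_fderiv (dzbarL k) hΩ hf hz
  rw [dzbar, dzbar, e1, e1, e1, e1]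
  simp only [dzbarL, evalL, _root_.smul_apply, _root_.add_apply,
    LinearMap.mkContinuous_apply, LinearMap.coe_mk, AddHom.coe_mk, smul_eq_mul]
  rw [hs (EuclideanSpace.single j 1) (EuclideanSpace.single k 1),
    hs (EuclideanSpace.single j 1) (EuclideanSpace.single k Complex.I),
    hs (EuclideanSpace.single j Complex.I) (EuclideanSpace.single k 1),
    hs (EuclideanSpace.single j Complex.I) (EuclideanSpace.single k Complex.I)]
  ring

/-- ∂̄² = 0 in weak form. -/
lemma IsTest.integral_dzbar_mul_dzbar {φ ψ : Cn n → ℂ} (hφ : IsTest Ω φ) (hψ : IsTest Ω ψ)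
    (j k : Fin n) :
    ∫ z in Ω, dzbar j ψ z * dzbar k φ z = ∫ z in Ω, dzbar k ψ z * dzbar j φ z := by
  rw [(hψ.wirtinger j).integral_dzbar hφ k, (hψ.wirtinger k).integral_dzbar hφ j]
  congr 1
  refine integral_congr_ae (Eventually.of_forall fun z => ?_)
  simp only
  rw [dzbar_dzbar_comm k j isOpen_univ hψ.1.contDiffOn (Set.mem_univ z)]

variable {σ : Cn n → ℝ}

lemma IsWeight.pow_smooth (hσ : IsWeight Ω σ) (k : ℕ) :
    ContDiffOn ℝ ∞ (fun z => (σ z : ℂ) ^ k) Ω := hσ.smooth.ofReal_comp.pow k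

lemma IsWeight.inv_pow_smooth (hσ : IsWeight Ω σ) (k : ℕ) :
    ContDiffOn ℝ ∞ (fun z => ((σ z)⁻¹ : ℂ) ^ k) Ω :=
  (hσ.smooth.ofReal_comp.inv fun z hz => Complex.ofReal_ne_zero.2 (hσ.pos z hz).ne').pow k

lemma IsWeight.memLp_pow_mul (hΩ : IsOpen Ω) (hσ : IsWeight Ω σ) (k : ℕ) {f : Cn n → ℂ}
    (hf : MemLp f 2 (volume.restrict Ω)) :
    MemLp (fun z => (σ z : ℂ) ^ k * f z) 2 (volume.restrict Ω) := by
  refine MemLp.mul_bdd (C := 1) hf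
    ((hσ.pow_smooth k).continuousOn.aestronglyMeasurable hΩ.measurableSet) ?_
  filter_upwards [ae_restrict_mem hΩ.measurableSet] with z hz
  rw [norm_pow, Complex.norm_real, Real.norm_of_nonneg (hσ.pos z hz).le]
  exact pow_le_one₀ (hσ.pos z hz).le (hσ.le_one z hz)

/-- The kernel of `u ↦ ∂̄(σ⁻⁷ u)`, as an orthogonal complement. -/
def kerDbar (Ω : Set (Cn n)) (σ : Cn n → ℝ) : Submodule ℂ (L2Form1 Ω) :=
  (Submodule.span ℂ {w | ∃ (i : Pairs n) (φ : Cn n → ℂ), IsTest Ω φ ∧ ∀ k,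
    w k =ᵐ[volume.restrict Ω] fun z => conj (((σ z)⁻¹ : ℂ) ^ 7 * dbarL i k (fderiv ℝ φ z))})ᗮ

instance : (kerDbar Ω σ).HasOrthogonalProjection :=
  have : CompleteSpace (kerDbar Ω σ) := (Submodule.isClosed_orthogonal _).completeSpace_coe
  inferInstance

/-- Defining the kernel of S as an orthogonal complement makes it closed at once; the weak equation
is exactly orthogonality to the adjoint applied to test functions. -/
lemma mem_kerDbar_iff (hΩ : IsOpen Ω) (hσ : IsWeight Ω σ) {x : L2Form1 Ω} :
    x ∈ kerDbar Ω σ ↔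
      ∀ i, WeakEq Ω (dbarL i) (fun k z => ((σ z)⁻¹ : ℂ) ^ 7 * x k z) fun _ => 0 := by
  constructor
  · intro hx i φ hφ
    have hw : ∀ k, MemLp (fun z => conj (((σ z)⁻¹ : ℂ) ^ 7 * dbarL i k (fderiv ℝ φ z))) 2
        (volume.restrict Ω) := fun k =>
      ((hφ.clm_fderiv (dbarL i k)).mul_contDiffOn hΩ (hσ.inv_pow_smooth 7)).conj.memLp
    have h1 := (Submodule.mem_orthogonal _ _).1 hx (form1 _ hw)
      (Submodule.subset_span ⟨i, φ, hφ, form1_coeFn hw⟩)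
    rw [inner_form1] at h1
    simp only [zero_mul, integral_zero, neg_zero]
    rw [← h1]
    refine Finset.sum_congr rfl fun k _ => integral_congr_ae (Eventually.of_forall fun z => ?_)
    simp only [Complex.conj_conj]; ring
  · intro hx
    rw [kerDbar, Submodule.mem_orthogonal]
    intro w hw
    induction hw using Submodule.span_induction with
    | zero => exact inner_zero_left _
    | add a b _ _ ha hb => rw [inner_add_left, ha, hb, add_zero]
    | smul c a _ ha => rw [inner_smul_left, ha, mul_zero]
    | mem w hw =>
      obtain ⟨i, φ, hφ, hw⟩ := hw
      have h1 := hx i φ hφ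
      simp only [zero_mul, integral_zero, neg_zero] at h1
      rw [PiLp.inner_apply, ← h1]
      refine Finset.sum_congr rfl fun k _ => ?_
      rw [L2.inner_def]
      refine integral_congr_ae ?_
      filter_upwards [hw k] with z hz
      rw [hz, RCLike.inner_apply, Complex.conj_conj]; ring

/-- The complex property: the forms σ^7 ∂̄ψ, with ψ a test function, lie in the kernel of S, so a
form orthogonal to that kernel satisfies div(σ^7 y) = 0. -/
lemma weakEq_of_mem_orthogonal_kerDbar (hΩ : IsOpen Ω) (hσ : IsWeight Ω σ) {y : L2Form1 Ω}
    (hy : y ∈ (kerDbar Ω σ)ᗮ) :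
    WeakEq Ω dzL (fun j z => (σ z : ℂ) ^ 7 * y j z) fun _ => 0 := by
  intro φ hφ
  have hψ := hφ.conj
  have ht : ∀ j, MemLp (fun z => (σ z : ℂ) ^ 7 * dzbar j (fun z => conj (φ z)) z) 2
      (volume.restrict Ω) := fun j =>
    ((hψ.wirtinger j).mul_contDiffOn hΩ (hσ.pow_smooth 7)).memLp
  have hmem : form1 _ ht ∈ kerDbar Ω σ := by
    rw [mem_kerDbar_iff hΩ hσ]
    intro i
    refine WeakEq.congr_ae (f := fun j => dzbar j fun z => conj (φ z)) (g := fun _ => 0) ?_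
      (fun j => ?_) EventuallyEq.rfl
    · intro χ hχ
      rw [sum_dbarL i (fun k ℓ => ∫ z in Ω, dzbar k (fun z => conj (φ z)) z * ℓ (fderiv ℝ χ z))]
      · simp only [← dzbar_eq]
        rw [hχ.integral_dzbar_mul_dzbar hψ]
        simp
      · intro k ℓ ℓ'
        rw [← integral_sub]
        · exact integral_congr_ae (Eventually.of_forall fun z => mul_sub _ _ _)
        · exact ((hχ.clm_fderiv ℓ).mul_contDiffOn hΩ (hψ.wirtinger k).contDiffOn).integrableOn
        · exact ((hχ.clm_fderiv ℓ').mul_contDiffOn hΩ (hψ.wirtinger k).contDiffOn).integrableOn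
    · filter_upwards [form1_coeFn ht j, ae_restrict_mem hΩ.measurableSet] with z hz hzΩ
      have h0 : (σ z : ℂ) ≠ 0 := Complex.ofReal_ne_zero.2 (hσ.pos z hzΩ).ne'
      rw [hz, ← mul_assoc, ← mul_pow, inv_mul_cancel₀ h0, one_pow, one_mul]
  have h1 := (Submodule.mem_orthogonal _ _).1 hy _ hmem
  rw [inner_form1] at h1
  simp only [zero_mul, integral_zero, neg_zero]
  rw [← h1]
  refine Finset.sum_congr rfl fun k _ => integral_congr_ae (Eventually.of_forall fun z => ?_)
  simp only [dzbar_conj, map_mul, map_pow, Complex.conj_ofReal, Complex.conj_conj, ← dz_eq]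
  ring

lemma IsWeight.testIntegrable_pow_mul (hΩ : IsOpen Ω) (hσ : IsWeight Ω σ) (k : ℕ) (f : L2 Ω) :
    TestIntegrable Ω fun z => (σ z : ℂ) ^ k * f z :=
  (TestIntegrable.of_memLp (Lp.memLp f)).mul hΩ (hσ.pow_smooth k)

lemma IsWeight.testIntegrable_inv_pow_mul (hΩ : IsOpen Ω) (hσ : IsWeight Ω σ) (k : ℕ) (f : L2 Ω) :
    TestIntegrable Ω fun z => ((σ z)⁻¹ : ℂ) ^ k * f z :=
  (TestIntegrable.of_memLp (Lp.memLp f)).mul hΩ (hσ.inv_pow_smooth k)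

/-- Identifies the last term of `WeightedBound` with σ^{-6} div(σ^14 U), that is with -T* applied to
σ^7 U. -/
lemma divz_pow_mul (hΩ : IsOpen Ω) (hσ : IsWeight Ω σ) {U : Fin n → Cn n → ℂ}
    (hU : ∀ j, IsTest Ω (U j)) {z : Cn n} (hz : z ∈ Ω) :
    divz (fun j z => (σ z : ℂ) ^ 14 * U j z) z = (σ z : ℂ) ^ 6 * ((σ z : ℂ) ^ 8 * divz U z
      + 14 * (σ z : ℂ) ^ 7 * ∑ j, dz j (fun w => (σ w : ℂ)) z * U j z) := by
  have dσ : DifferentiableAt ℝ σ z :=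
    ((hσ.smooth z hz).contDiffAt (hΩ.mem_nhds hz)).differentiableAt (by simp)
  have hp : ∀ j, dz j (fun w => (σ w : ℂ) ^ 14) z
      = 14 * (σ z : ℂ) ^ 13 * dz j (fun w => (σ w : ℂ)) z := fun j => by
    have := dz_comp_ofReal j (hasDerivAt_pow 14 (σ z)) dσ
    simp only [Complex.ofReal_pow] at this
    rw [this]; push_cast; ring
  simp only [divz, Finset.mul_sum, ← Finset.sum_add_distrib]
  refine Finset.sum_congr rfl fun j _ => ?_
  rw [dz_mul j ((hσ.pow_smooth 14).diffAt hΩ hz) ((hU j).diffAt z), hp]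
  ring

/-- The coefficients of the form dual to `F` under the sesquilinear form of `B`. -/
def dualForm (B : Cn n → Matrix (Fin n) (Fin n) ℂ) (F : Fin n → Cn n → ℂ) (j : Fin n)
    (z : Cn n) : ℂ := ∑ k, conj (B z j k) * F k z

lemma isTest_dualForm (hΩ : IsOpen Ω) {B : Cn n → Matrix (Fin n) (Fin n) ℂ}
    (hB : IsPsdMatrix Ω B) {F : Fin n → Cn n → ℂ} (hF : ∀ j, IsTest Ω (F j)) (j : Fin n) :
    IsTest Ω (dualForm B F j) :=
  IsTest.sum _ fun k => (hF k).mul_contDiffOn hΩ (hB.smooth j k).conj_comp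

/-- Here p is the projection onto ker S of the form f = σ^{-7} `dualForm` B F, for which ⟨f, σ^7 u⟩
is the pairing of u with F. For x = σ^7 u the part x - Px satisfies S(x - Px) = σ^8 ∂̄u and T*(x -
Px) = 0, giving the bound by α alone. For x = σ^7 U the part Px satisfies S(Px) = 0 and T*(Px) =
T*x, giving the bound by the weighted divergence alone. In both cases Cauchy–Schwarz for B is
followed by the weak weighted estimate. -/
theorem WeightedBound.exists_split (hΩ : IsOpen Ω) (hσ : IsWeight Ω σ)
    {B : Cn n → Matrix (Fin n) (Fin n) ℂ} (hB : IsPsdMatrix Ω B) {C : ℝ} (hC : 0 ≤ C)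
    (hW : WeightedBound Ω σ B C) {F : Fin n → Cn n → ℂ} (hF : ∀ j, IsTest Ω (F j)) :
    ∃ p : L2Form1 Ω,
      ‖p‖ ^ 2 ≤ ∑ j, ∫ z in Ω, ‖((σ z)⁻¹ : ℂ) ^ 7 * dualForm B F j z‖ ^ 2 ∧
      (∀ (u : L2Form1 Ω) (α : L2Form2 Ω), (u, α) ∈ dbar1Graph Ω →
        ‖sesq Ω B (fun j z => u j z) F
          - inner ℂ p (form1 _ fun j => hσ.memLp_pow_mul hΩ 7 (Lp.memLp (u j)))‖ ^ 2
        ≤ C * ‖α‖ ^ 2 * ∫ z in Ω, hform (B z) fun j => ((σ z)⁻¹ : ℂ) ^ 8 * F j z) ∧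
      ∀ (U : Fin n → Cn n → ℂ) (hU : ∀ j, IsTest Ω (U j)),
        ‖inner ℂ p (form1 _ fun j => hσ.memLp_pow_mul hΩ 7 (hU j).memLp)‖ ^ 2
        ≤ C * (∫ z in Ω, ‖(σ z : ℂ) ^ 8 * divz U z
            + 14 * (σ z : ℂ) ^ 7 * ∑ j, dz j (fun w => (σ w : ℂ)) z * U j z‖ ^ 2)
          * ∫ z in Ω, hform (B z) fun j => ((σ z)⁻¹ : ℂ) ^ 8 * F j z := by
  obtain ⟨CB, hCB⟩ := hB.bdd
  have hσ0 : ∀ z ∈ Ω, (σ z : ℂ) ≠ 0 := fun z hz => Complex.ofReal_ne_zero.2 (hσ.pos z hz).ne'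
  have hf : ∀ j, MemLp (fun z => ((σ z)⁻¹ : ℂ) ^ 7 * dualForm B F j z) 2 (volume.restrict Ω) :=
    fun j => ((isTest_dualForm hΩ hB hF j).mul_contDiffOn hΩ (hσ.inv_pow_smooth 7)).memLp
  have hF8 : ∀ j, MemLp (fun z => ((σ z)⁻¹ : ℂ) ^ 8 * F j z) 2 (volume.restrict Ω) :=
    fun j => ((hF j).mul_contDiffOn hΩ (hσ.inv_pow_smooth 8)).memLp
  have hσ1 : ∀ x : L2Form1 Ω, ∀ j, MemLp (fun z => (σ z : ℂ) * x j z) 2 (volume.restrict Ω) :=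
    fun x j => by simpa using hσ.memLp_pow_mul hΩ 1 (Lp.memLp (x j))
  obtain ⟨N, hN⟩ : ∃ N, N = kerDbar Ω σ := ⟨_, rfl⟩
  have : N.HasOrthogonalProjection := by rw [hN]; infer_instance
  have hNmem : ∀ x, N.starProjection x ∈ kerDbar Ω σ := fun x => hN ▸ N.starProjection_apply_mem x
  have hNorth : ∀ x, x - N.starProjection x ∈ (kerDbar Ω σ)ᗮ := fun x =>
    hN ▸ N.sub_starProjection_mem_orthogonal x
  set D := ∫ z in Ω, hform (B z) fun j => ((σ z)⁻¹ : ℂ) ^ 8 * F j z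
  have hD : 0 ≤ D := integral_hform_nonneg hΩ hB _
  have pair : ∀ x : L2Form1 Ω, inner ℂ (form1 _ hf) x
      = sesq Ω B (fun j z => (σ z : ℂ) * x j z) fun j z => ((σ z)⁻¹ : ℂ) ^ 8 * F j z := by
    intro x
    rw [inner_form1, ← integral_finsetSum]
    · refine setIntegral_congr_fun hΩ.measurableSet fun z hz => ?_
      have h0 := hσ0 z hz
      simp only [dualForm, Finset.mul_sum, map_sum, map_mul, map_pow, map_inv₀,
        Complex.conj_ofReal, Complex.conj_conj]
      refine Finset.sum_congr rfl fun j _ => Finset.sum_congr rfl fun k _ => ?_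
      field_simp
    · exact fun j _ => (Lp.memLp (x j)).integrable_mul (hf j).star
  -- The weight is distributed as σ on x and σ^{-8} on F, because the weak estimate controls B
  -- exactly at σx; F has compact support, so the negative power is harmless.
  have cs : ∀ x : L2Form1 Ω, ‖inner ℂ (form1 _ hf) x‖ ^ 2
      ≤ (∫ z in Ω, hform (B z) fun j => (σ z : ℂ) * x j z) * D := fun x => by
    rw [pair]
    exact norm_sesq_sq_le hΩ hB (hσ1 x) hF8
  refine ⟨N.starProjection (form1 _ hf), ?_, fun u α hu => ?_, fun U hU => ?_⟩
  · have h1 := N.norm_starProjection_apply_le (form1 _ hf)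
    have h2 : ‖form1 _ hf‖ ^ 2 = ∑ j, ∫ z in Ω, ‖((σ z)⁻¹ : ℂ) ^ 7 * dualForm B F j z‖ ^ 2 := by
      rw [norm_form1_sq]
      refine Finset.sum_congr rfl fun j _ => integral_congr_ae ?_
      filter_upwards [form1_coeFn hf j] with z hz
      rw [hz]
    rw [← h2]
    gcongr
  · set x := form1 _ fun j => hσ.memLp_pow_mul hΩ 7 (Lp.memLp (u j)) with hx
    have hxj : ∀ j, x j =ᵐ[volume.restrict Ω] fun z => (σ z : ℂ) ^ 7 * u j z := form1_coeFn _
    set y := x - N.starProjection x with hy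
    have e : sesq Ω B (fun j z => u j z) F - inner ℂ (N.starProjection (form1 _ hf)) x
        = inner ℂ (form1 _ hf) y := by
      rw [hy, inner_sub_right, N.inner_starProjection_left_eq_right, pair x]
      congr 1
      refine integral_congr_ae ?_
      filter_upwards [ae_all_iff.2 hxj, ae_restrict_mem hΩ.measurableSet] with z hz hzΩ
      have h0 := hσ0 z hzΩ
      simp only [hz, map_mul, map_pow, map_inv₀, Complex.conj_ofReal]
      refine Finset.sum_congr rfl fun j _ => Finset.sum_congr rfl fun k _ => ?_
      field_simp
    rw [e]
    refine (cs y).trans (mul_le_mul_of_nonneg_right ?_ hD)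
    have hyj : ∀ j, (fun z => x j z - N.starProjection x j z) =ᵐ[volume.restrict Ω] y j := fun j =>
      (Lp.coeFn_sub (x j) (N.starProjection x j)).symm
    have eg : ∀ i, WeakEq Ω (dbarL i) (fun j z => ((σ z)⁻¹ : ℂ) ^ 7 * y j z)
        (fun z => ((σ z)⁻¹ : ℂ) ^ 8 * ((σ z : ℂ) ^ 8 * α i z)) := fun i => by
      have h1 := mem_dbar1Graph_iff.1 hu i
      have h2 := (mem_kerDbar_iff hΩ hσ).1 (hNmem x) i
      have h3 := h1.sub h2 (fun j => .of_memLp (Lp.memLp _))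
        (fun j => hσ.testIntegrable_inv_pow_mul hΩ 7 _) (.of_memLp (Lp.memLp _))
        (.of_memLp (MemLp.zero' (ε := ℂ)))
      refine h3.congr_ae (fun j => ?_) ?_
      · filter_upwards [hxj j, hyj j, ae_restrict_mem hΩ.measurableSet] with z h4 h5 hzΩ
        have h0 := hσ0 z hzΩ
        rw [← h5, h4]
        field_simp
      · filter_upwards [ae_restrict_mem hΩ.measurableSet] with z hzΩ
        have h0 := hσ0 z hzΩ
        field_simp
        simp
    have ek : WeakEq Ω dzL (fun j z => (σ z : ℂ) ^ 7 * y j z)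
        (fun z => -((σ z : ℂ) ^ 6 * (fun _ => (0 : ℂ)) z)) := by
      refine (weakEq_of_mem_orthogonal_kerDbar hΩ hσ
        (hNorth x)).congr_ae (fun _ => EventuallyEq.rfl) ?_
      exact Eventually.of_forall fun z => by simp
    refine (hW.of_weak hΩ hσ hCB (fun j => Lp.memLp (y j))
      (fun i => hσ.memLp_pow_mul hΩ 8 (Lp.memLp (α i))) (MemLp.zero' (ε := ℂ)) eg ek).trans ?_
    rw [norm_form2_sq]
    simp only [norm_zero, ne_eq, OfNat.ofNat_ne_zero, not_false_eq_true, zero_pow, integral_zero,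
      add_zero]
    refine mul_le_mul_of_nonneg_left (Finset.sum_le_sum fun i _ => ?_) hC
    refine integral_mono_ae ((hσ.memLp_pow_mul hΩ 8 (Lp.memLp (α i))).integrable_norm_pow
      (by norm_num)) ((Lp.memLp (α i)).integrable_norm_pow (by norm_num)) ?_
    filter_upwards [ae_restrict_mem hΩ.measurableSet] with z hz
    rw [norm_mul, norm_pow, Complex.norm_real, Real.norm_of_nonneg (hσ.pos z hz).le]
    have h1 := pow_le_one₀ (n := 8) (hσ.pos z hz).le (hσ.le_one z hz)
    have h2 := pow_nonneg (hσ.pos z hz).le 8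
    gcongr
    exact mul_le_of_le_one_left (norm_nonneg _) h1
  · set x := form1 _ fun j => hσ.memLp_pow_mul hΩ 7 (hU j).memLp with hx
    have hxj : ∀ j, x j =ᵐ[volume.restrict Ω] fun z => (σ z : ℂ) ^ 7 * U j z := form1_coeFn _
    set q := N.starProjection x with hq
    rw [N.inner_starProjection_left_eq_right]
    refine (cs q).trans (mul_le_mul_of_nonneg_right ?_ hD)
    set k : Cn n → ℂ := fun z => (σ z : ℂ) ^ 8 * divz U z
      + 14 * (σ z : ℂ) ^ 7 * ∑ j, dz j (fun w => (σ w : ℂ)) z * U j z with hk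
    have eg : ∀ i, WeakEq Ω (dbarL i) (fun j z => ((σ z)⁻¹ : ℂ) ^ 7 * q j z)
        (fun z => ((σ z)⁻¹ : ℂ) ^ 8 * (fun _ => (0 : ℂ)) z) := fun i =>
      ((mem_kerDbar_iff hΩ hσ).1 (hNmem x) i).congr_ae
        (fun _ => EventuallyEq.rfl) (Eventually.of_forall fun z => by simp)
    have hkt : IsTest Ω k := by
      refine (((IsTest.sum Finset.univ fun j => (hU j).dz j).mul_contDiffOn hΩ
        (hσ.pow_smooth 8)).add ?_)
      refine (IsTest.sum Finset.univ fun j => (hU j).mul_contDiffOn hΩ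
        (contDiffOn_dz j hΩ hσ.smooth.ofReal_comp)).mul_contDiffOn hΩ ?_
      exact contDiffOn_const.mul (hσ.pow_smooth 7)
    have hU14 : ∀ j, IsTest Ω fun z => (σ z : ℂ) ^ 14 * U j z := fun j =>
      (hU j).mul_contDiffOn hΩ (hσ.pow_smooth 14)
    -- The component of σ^7 U orthogonal to ker S contributes nothing to the divergence, so the
    -- projection q has the same T* as σ^7 U itself.
    have ek : WeakEq Ω dzL (fun j z => (σ z : ℂ) ^ 7 * q j z)
        (fun z => -((σ z : ℂ) ^ 6 * (-k z))) := by
      have h1 := weakEq_dzL_of_isTest hΩ hU14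
      have h2 := weakEq_of_mem_orthogonal_kerDbar hΩ hσ (hNorth x)
      have hdiv : IsTest Ω (divz fun j z => (σ z : ℂ) ^ 14 * U j z) :=
        IsTest.sum Finset.univ fun j => (hU14 j).dz j
      have h3 := h1.sub h2 (fun j => .of_memLp (hU14 j).memLp)
        (fun j => hσ.testIntegrable_pow_mul hΩ 7 _) (.of_memLp hdiv.memLp)
        (.of_memLp (MemLp.zero' (ε := ℂ)))
      refine h3.congr_ae (fun j => ?_) ?_
      · filter_upwards [hxj j, Lp.coeFn_sub (x j) (q j)] with z h4 h5
        have h6 : (x - q) j z = x j z - q j z := h5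
        rw [h6, h4]
        ring
      · filter_upwards [ae_restrict_mem hΩ.measurableSet] with z hzΩ
        rw [divz_pow_mul hΩ hσ hU hzΩ, hk]
        ring
    refine (hW.of_weak hΩ hσ hCB (fun j => Lp.memLp (q j))
      (fun i => MemLp.zero' (ε := ℂ)) hkt.memLp.neg eg ek).trans (le_of_eq ?_)
    simp only [norm_zero, ne_eq, OfNat.ofNat_ne_zero, not_false_eq_true, zero_pow, integral_zero,
      Finset.sum_const_zero, zero_add, norm_neg, Pi.neg_apply]
    rfl

end Splitting

/-! ### Limits of the weights -/

section WeightLimits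

variable {n : ℕ} {Ω : Set (Cn n)} {r : Cn n → ℝ}

/-- The sequence of weights tending to one. -/
def sigmaSeq (r : Cn n → ℝ) (m : ℕ) : Cn n → ℝ := sigma r (1 / ((m : ℝ) + 1))

lemma one_div_add_one_pos (m : ℕ) : (0 : ℝ) < 1 / ((m : ℝ) + 1) := by positivity

lemma one_div_add_one_le (m : ℕ) : 1 / ((m : ℝ) + 1) ≤ 1 := by
  rw [div_le_one (by positivity)]
  have : (0 : ℝ) ≤ m := by positivity
  linarith

lemma IsDefining.isWeight_sigmaSeq (hr : IsDefining Ω r) (m : ℕ) : IsWeight Ω (sigmaSeq r m) :=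
  hr.isWeight_sigma (one_div_add_one_pos m)

/-- In this form σ^{-1} is visibly increasing in s, so along the sequence the first weight
dominates. -/
lemma IsDefining.sigma_inv (hr : IsDefining Ω r) {s : ℝ} (hs : 0 < s) {z : Cn n} (hz : z ∈ Ω) :
    (sigma r s z)⁻¹ = 1 + s / -r z := by
  have h1 := hr.sub_pos hs hz
  have h2 := hr.neg z hz
  have h3 : sigma r s z = -r z / (s - r z) := by rw [sigma]; field_simp; ring
  have h4 : -r z ≠ 0 := by linarith
  rw [h3, inv_div, one_add_div h4]
  ring

lemma IsDefining.tendsto_sigmaSeq (hr : IsDefining Ω r) {z : Cn n} (hz : z ∈ Ω) :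
    Tendsto (fun m => sigmaSeq r m z) atTop (𝓝 1) := by
  have hs := tendsto_one_div_add_atTop_nhds_zero_nat (𝕜 := ℝ)
  have h1 : 0 - r z ≠ 0 := by have := hr.neg z hz; linarith
  have := ((hs.mul ((hs.sub_const (r z)).inv₀ h1)).const_sub 1)
  simpa [sigmaSeq, sigma] using this

/-- A bound uniform in s, locally bounded in Ω, used to dominate the derivative term on the compact
support of a test form. -/
lemma IsDefining.norm_dz_sigma_le (hr : IsDefining Ω r) {s : ℝ} (hs : 0 < s) (hs1 : s ≤ 1)
    {z : Cn n} (hz : z ∈ Ω) (j : Fin n) :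
    ‖dz j (fun w => (sigma r s w : ℂ)) z‖ ≤ (r z ^ 2)⁻¹ * ‖dz j (fun w => (r w : ℂ)) z‖ := by
  have h1 := hr.sub_pos hs hz
  have h2 := hr.neg z hz
  rw [hr.dz_sigma hs hz, norm_mul, Complex.norm_real, norm_neg,
    Real.norm_of_nonneg (by positivity)]
  gcongr
  have h3 : 0 < r z ^ 2 := by have := h2.ne; positivity
  calc s * ((s - r z) ^ 2)⁻¹ ≤ 1 * (r z ^ 2)⁻¹ := by
        gcongr ?_ * ?_
        exact inv_anti₀ h3 (by nlinarith)
    _ = _ := one_mul _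

lemma IsDefining.tendsto_dz_sigmaSeq (hr : IsDefining Ω r) {z : Cn n} (hz : z ∈ Ω) (j : Fin n) :
    Tendsto (fun m => dz j (fun w => (sigmaSeq r m w : ℂ)) z) atTop (𝓝 0) := by
  have hs := tendsto_one_div_add_atTop_nhds_zero_nat (𝕜 := ℝ)
  have h1 : (0 - r z) ^ 2 ≠ 0 := by
    have := hr.neg z hz
    exact pow_ne_zero 2 (by linarith)
  have h2 := (hs.mul (((hs.sub_const (r z)).pow 2).inv₀ h1)).neg
  have h3 := (Complex.continuous_ofReal.tendsto _).comp h2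
  have h4 := h3.mul_const (dz j (fun w => (r w : ℂ)) z)
  simp only [zero_mul, neg_zero, Complex.ofReal_zero] at h4
  refine h4.congr fun m => ?_
  exact (hr.dz_sigma (one_div_add_one_pos m) hz j).symm

lemma IsDefining.L2Tendsto_sigmaSeq_pow (hr : IsDefining Ω r) (k : ℕ) {f : Cn n → ℂ}
    (hf : MemLp f 2 (volume.restrict Ω)) :
    L2Tendsto Ω (fun m z => (sigmaSeq r m z : ℂ) ^ k * f z) f := by
  have hm := ae_restrict_mem (μ := (volume : Measure (Cn n))) hr.isOpen.measurableSet
  refine L2Tendsto.of_dominated hf.norm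
    (fun m => ((hr.isWeight_sigmaSeq m).memLp_pow_mul hr.isOpen k hf).1) hf.1 (fun m => ?_) ?_
  · filter_upwards [hm] with z hz
    have hσ := hr.isWeight_sigmaSeq m
    rw [norm_mul, norm_pow, Complex.norm_real, Real.norm_of_nonneg (hσ.pos z hz).le]
    exact mul_le_of_le_one_left (norm_nonneg _) (pow_le_one₀ (hσ.pos z hz).le (hσ.le_one z hz))
  · filter_upwards [hm] with z hz
    have := (((Complex.continuous_ofReal.tendsto _).comp (hr.tendsto_sigmaSeq hz)).pow k).mul_const
      (f z)
    simpa using this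

lemma IsDefining.L2Tendsto_sigmaSeq_inv_pow (hr : IsDefining Ω r) (k : ℕ) {φ : Cn n → ℂ}
    (hφ : IsTest Ω φ) : L2Tendsto Ω (fun m z => ((sigmaSeq r m z)⁻¹ : ℂ) ^ k * φ z) φ := by
  have hm := ae_restrict_mem (μ := (volume : Measure (Cn n))) hr.isOpen.measurableSet
  have ht : ∀ m, IsTest Ω fun z => ((sigmaSeq r m z)⁻¹ : ℂ) ^ k * φ z := fun m =>
    hφ.mul_contDiffOn hr.isOpen ((hr.isWeight_sigmaSeq m).inv_pow_smooth k)
  refine L2Tendsto.of_dominated (ht 0).memLp.norm (fun m => (ht m).memLp.1) hφ.memLp.1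
    (fun m => ?_) ?_
  · filter_upwards [hm] with z hz
    simp only [norm_mul, norm_pow, norm_inv, Complex.norm_real,
      Real.norm_of_nonneg ((hr.isWeight_sigmaSeq _).pos z hz).le]
    have h1 := hr.neg z hz
    rw [sigmaSeq, sigmaSeq, hr.sigma_inv (one_div_add_one_pos m) hz,
      hr.sigma_inv (one_div_add_one_pos 0) hz]
    have h3 : (0 : ℝ) < -r z := by linarith
    have h4 := one_div_add_one_pos m
    gcongr
    simp
  · filter_upwards [hm] with z hz
    have := ((((Complex.continuous_ofReal.tendsto _).comp (hr.tendsto_sigmaSeq hz)).inv₀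
      (by simp)).pow k).mul_const (φ z)
    simpa using this

/-- As s → 0 the weight tends to 1 and its derivative to 0 at each interior point, so the weighted
divergence of a fixed test form tends to the ordinary one. -/
lemma IsDefining.L2Tendsto_weighted_div (hr : IsDefining Ω r) {U : Fin n → Cn n → ℂ}
    (hU : ∀ j, IsTest Ω (U j)) :
    L2Tendsto Ω (fun m z => (sigmaSeq r m z : ℂ) ^ 8 * divz U z
      + 14 * (sigmaSeq r m z : ℂ) ^ 7 * ∑ j, dz j (fun w => (sigmaSeq r m w : ℂ)) z * U j z)
      (divz U) := by
  have hΩ := hr.isOpen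
  have hm := ae_restrict_mem (μ := (volume : Measure (Cn n))) hΩ.measurableSet
  have hdiv : IsTest Ω (divz U) := IsTest.sum Finset.univ fun j => (hU j).dz j
  have hg : ∀ j, IsTest Ω fun z => ((r z ^ 2 : ℝ) : ℂ)⁻¹ * (dz j (fun w => (r w : ℂ)) z * U j z) :=
    fun j => ((hU j).mul_contDiffOn hΩ (contDiffOn_dz j hΩ hr.smooth.ofReal_comp)).mul_contDiffOn
      hΩ ((hr.smooth.pow 2).ofReal_comp.inv fun z hz =>
        Complex.ofReal_ne_zero.2 (pow_ne_zero 2 (hr.neg z hz).ne))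
  have hgm : MemLp (fun z => ‖divz U z‖
      + 14 * ∑ j, ‖((r z ^ 2 : ℝ) : ℂ)⁻¹ * (dz j (fun w => (r w : ℂ)) z * U j z)‖) 2
      (volume.restrict Ω) :=
    hdiv.memLp.norm.add ((memLp_finsetSum _ fun j _ => (hg j).memLp.norm).const_mul 14)
  refine L2Tendsto.of_dominated hgm (fun m => ?_) hdiv.memLp.1 (fun m => ?_) ?_
  · have hσ := hr.isWeight_sigmaSeq m
    refine ((hdiv.mul_contDiffOn hΩ (hσ.pow_smooth 8)).add
      ((IsTest.sum Finset.univ fun j => (hU j).mul_contDiffOn hΩ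
        (contDiffOn_dz j hΩ hσ.smooth.ofReal_comp)).mul_contDiffOn hΩ ?_)).memLp.1
    exact contDiffOn_const.mul (hσ.pow_smooth 7)
  · filter_upwards [hm] with z hz
    have hσ := hr.isWeight_sigmaSeq m
    have hp : ∀ k, ‖(sigmaSeq r m z : ℂ) ^ k‖ ≤ 1 := fun k => by
      rw [norm_pow, Complex.norm_real, Real.norm_of_nonneg (hσ.pos z hz).le]
      exact pow_le_one₀ (hσ.pos z hz).le (hσ.le_one z hz)
    refine (norm_add_le _ _).trans (add_le_add ?_ ?_)
    · rw [norm_mul]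
      exact mul_le_of_le_one_left (norm_nonneg _) (hp 8)
    · rw [norm_mul, norm_mul, Complex.norm_ofNat, mul_assoc]
      refine mul_le_mul_of_nonneg_left ?_ (by norm_num)
      refine (mul_le_of_le_one_left (norm_nonneg _) (hp 7)).trans ((norm_sum_le _ _).trans ?_)
      refine Finset.sum_le_sum fun j _ => ?_
      rw [norm_mul, norm_mul, norm_mul, ← mul_assoc, norm_inv, Complex.norm_real,
        Real.norm_of_nonneg (sq_nonneg (r z))]
      gcongr
      exact hr.norm_dz_sigma_le (one_div_add_one_pos m) (one_div_add_one_le m) hz j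
  · filter_upwards [hm] with z hz
    have h1 := (Complex.continuous_ofReal.tendsto _).comp (hr.tendsto_sigmaSeq hz)
    have h2 : Tendsto (fun m => ∑ j, dz j (fun w => (sigmaSeq r m w : ℂ)) z * U j z) atTop
        (𝓝 (∑ j, 0 * U j z)) :=
      tendsto_finsetSum _ fun j _ => (hr.tendsto_dz_sigmaSeq hz j).mul_const _
    have h3 := ((h1.pow 8).mul_const (divz U z)).add (((h1.pow 7).const_mul 14).mul h2)
    simpa using h3

end WeightLimits

/-! ### Approximation by test forms and weak limits -/

section Approximation

variable {n : ℕ} {Ω : Set (Cn n)}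

/-- Test forms. -/
def testForms (Ω : Set (Cn n)) : Submodule ℂ (Fin n → Cn n → ℂ) where
  carrier := {U | ∀ j, IsTest Ω (U j)}
  add_mem' ha hb j := (ha j).add (hb j)
  zero_mem' _ := IsTest.zero
  smul_mem' c _ ha j := (ha j).const_mul c

lemma isTest_coe_testForms (U : testForms Ω) (j : Fin n) : IsTest Ω (U.1 j) := U.2 j

lemma isTest_divz {U : Fin n → Cn n → ℂ} (hU : ∀ j, IsTest Ω (U j)) : IsTest Ω (divz U) :=
  IsTest.sum Finset.univ fun j => (hU j).dz j

lemma divz_add {U V : Fin n → Cn n → ℂ} (hU : ∀ j, IsTest Ω (U j)) (hV : ∀ j, IsTest Ω (V j)) :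
    divz (U + V) = divz U + divz V := by
  funext z
  simp only [divz, Pi.add_apply, ← Finset.sum_add_distrib]
  exact Finset.sum_congr rfl fun j _ => dz_add j ((hU j).diffAt z) ((hV j).diffAt z)

lemma divz_smul (c : ℂ) {U : Fin n → Cn n → ℂ} (hU : ∀ j, IsTest Ω (U j)) :
    divz (c • U) = c • divz U := by
  funext z
  simp only [divz, Pi.smul_apply, smul_eq_mul, Finset.mul_sum]
  refine Finset.sum_congr rfl fun j _ => ?_
  have := fderiv_const_smul ((hU j).diffAt z) c
  rw [dz_eq, dz_eq, ← smul_eq_mul, ← map_smul, ← this]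

/-- The inclusion of test forms into `L²`. -/
def testToL2 (Ω : Set (Cn n)) : testForms Ω →ₗ[ℂ] L2Form1 Ω where
  toFun U := form1 U.1 fun j => (isTest_coe_testForms U j).memLp
  map_add' _ _ := rfl
  map_smul' _ _ := rfl

/-- The formal adjoint of `-∂̄` on test forms. -/
def testDiv (Ω : Set (Cn n)) : testForms Ω →ₗ[ℂ] L2 Ω where
  toFun U := (isTest_divz (isTest_coe_testForms U)).memLp.toLp (divz U.1)
  map_add' U V :=
    (MemLp.toLp_congr _ _ (Eventually.of_forall fun z => congrFun
      (divz_add (isTest_coe_testForms U) (isTest_coe_testForms V)) z)).trans (MemLp.toLp_add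
        (isTest_divz (isTest_coe_testForms U)).memLp (isTest_divz (isTest_coe_testForms V)).memLp)
  map_smul' c U :=
    (MemLp.toLp_congr _ _ (Eventually.of_forall fun z => congrFun
      (divz_smul c (isTest_coe_testForms U)) z)).trans
      (MemLp.toLp_const_smul c (isTest_divz (isTest_coe_testForms U)).memLp)

/-- A function orthogonal to all test functions is zero, so test functions are dense. -/
lemma exists_test_L2Tendsto (hΩ : IsOpen Ω) (f : L2 Ω) :
    ∃ φ : ℕ → Cn n → ℂ, (∀ m, IsTest Ω (φ m)) ∧ L2Tendsto Ω φ f := by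
  let S : Submodule ℂ (L2 Ω) :=
    { carrier := {g | ∃ (φ : Cn n → ℂ) (h : IsTest Ω φ), g = h.memLp.toLp φ}
      add_mem' := by
        rintro _ _ ⟨φ, h, rfl⟩ ⟨ψ, h', rfl⟩
        exact ⟨_, h.add h', rfl⟩
      zero_mem' := ⟨_, IsTest.zero, rfl⟩
      smul_mem' := by
        rintro c _ ⟨φ, h, rfl⟩
        exact ⟨_, h.const_mul c, rfl⟩ }
  have hS : Dense (S : Set (L2 Ω)) := by
    rw [Submodule.dense_iff_topologicalClosure_eq_top, Submodule.topologicalClosure_eq_top_iff,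
      Submodule.eq_bot_iff]
    intro g hg
    refine L2.eq_zero_of_test hΩ g fun φ h => ?_
    have h0 := (Submodule.mem_orthogonal _ _).1 hg _ ⟨_, h.conj, rfl⟩
    rw [L2.inner_def] at h0
    rw [← h0]
    refine integral_congr_ae ?_
    filter_upwards [h.conj.memLp.coeFn_toLp] with z hz
    rw [hz, RCLike.inner_apply, Complex.conj_conj]
  obtain ⟨g, hg, hgf⟩ := mem_closure_iff_seq_limit.1 (hS f)
  choose φ h e using hg
  refine ⟨φ, h, fun m => (h m).memLp, Lp.memLp f, ?_⟩
  rw [← Lp.tendsto_Lp_iff_tendsto_eLpNorm'' φ (fun m => (h m).memLp) f (Lp.memLp f),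
    Lp.toLp_coeFn]
  simpa only [← e] using hgf

lemma exists_testForm_L2Tendsto (hΩ : IsOpen Ω) (u : L2Form1 Ω) :
    ∃ F : ℕ → Fin n → Cn n → ℂ, (∀ m j, IsTest Ω (F m j)) ∧
      ∀ j, L2Tendsto Ω (fun m => F m j) (u j) := by
  choose φ h h' using fun j => exists_test_L2Tendsto hΩ (u j)
  exact ⟨fun m j => φ j m, fun m j => h j m, h'⟩

/-- Banach–Alaoglu along an ultrafilter finer than `atTop`, which avoids extracting a subsequence.
The conclusion pairs a weakly convergent family with a strongly convergent one, because the forms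
σ^7 u paired with p also vary with m. -/
lemma exists_weak_limit {E : Type*} [NormedAddCommGroup E] [InnerProductSpace ℂ E]
    [CompleteSpace E] {p : ℕ → E} {R : ℝ} (h : ∀ m, ‖p m‖ ≤ R) :
    ∃ (l : Filter ℕ) (b : E), l.NeBot ∧ l ≤ atTop ∧ ∀ (x : ℕ → E) (x₀ : E),
      Tendsto x atTop (𝓝 x₀) →
      Tendsto (fun m => inner ℂ (p m) (x m)) l (𝓝 (inner ℂ b x₀)) := by
  let q : ℕ → WeakDual ℂ E := fun m => StrongDual.toWeakDual (InnerProductSpace.toDual ℂ E (p m))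
  have hK := WeakDual.isCompact_closedBall (𝕜 := ℂ) (E := E) 0 R
  let 𝒰 : Ultrafilter ℕ := Ultrafilter.of atTop
  have h𝒰 : (𝒰 : Filter ℕ) ≤ atTop := Ultrafilter.of_le _
  obtain ⟨ℓ, -, hℓ⟩ := hK.ultrafilter_le_nhds (𝒰.map q) (by
    rw [le_principal_iff]
    refine Filter.mem_map.2 (Filter.univ_mem' fun m => ?_)
    change InnerProductSpace.toDual ℂ E (p m) ∈ Metric.closedBall 0 R
    rw [mem_closedBall_zero_iff, LinearIsometryEquiv.norm_map]
    exact h m)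
  refine ⟨𝒰, (InnerProductSpace.toDual ℂ E).symm (WeakDual.toStrongDual ℓ), 𝒰.neBot, h𝒰,
    fun x x₀ hx => ?_⟩
  rw [InnerProductSpace.toDual_symm_apply]
  have h1 : Tendsto (fun m => inner ℂ (p m) x₀) 𝒰 (𝓝 (ℓ x₀)) :=
    ((WeakDual.eval_continuous x₀).tendsto ℓ).comp (show Tendsto q 𝒰 (𝓝 ℓ) from hℓ)
  have h2 : Tendsto (fun m => inner ℂ (p m) (x m - x₀)) 𝒰 (𝓝 0) := by
    have h3 : Tendsto (fun m => R * ‖x m - x₀‖) 𝒰 (𝓝 0) := by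
      have := ((hx.mono_left h𝒰).sub_const x₀).norm.const_mul R
      simpa using this
    refine squeeze_zero_norm (fun m => (norm_inner_le_norm _ _).trans ?_) h3
    gcongr
    exact h m
  have h4 := h1.add h2
  simp only [← inner_add_right, add_sub_cancel, add_zero] at h4
  exact h4

end Approximation

/-! ### Transfer of the weighted estimates to the `∂̄`-Neumann domain -/

section Transfer

variable {n : ℕ} {Ω : Set (Cn n)} {r : Cn n → ℝ}

/-- The bound on test forms represents b through the divergence: ⟨b,U⟩ = -⟨β, div U⟩ with ‖β‖ ≤ K.
This says ∂̄β = b weakly, without boundary condition on β, so the definition of the adjoint gives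
⟨u,b⟩ = ⟨∂̄*u, β⟩. -/
lemma norm_inner_le_of_test (hΩ : IsOpen Ω) {b : L2Form1 Ω} {K : ℝ} (hK : 0 ≤ K)
    (h : ∀ U : testForms Ω, ‖inner ℂ b (testToL2 Ω U)‖ ≤ K * ‖testDiv Ω U‖)
    (u : (dbarStar Ω).domain) : ‖inner ℂ b (u : L2Form1 Ω)‖ ≤ K * ‖dbarStar Ω u‖ := by
  obtain ⟨β, hβ, e⟩ := exists_riesz_of_norm_le (-testDiv Ω)
    ((innerSL ℂ b).toLinearMap ∘ₗ testToL2 Ω) hK (fun U => by simpa using h U)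
  have hmem : (β, b) ∈ dbar0Graph Ω := by
    intro j φ hφ
    -- The form with the single component conj φ in position j recovers the j-th equation ∂β/∂z̄_j =
    -- b_j.
    have hU : ∀ k, IsTest Ω ((Pi.single j fun z => conj (φ z) : Fin n → Cn n → ℂ) k) := by
      intro k
      rcases eq_or_ne k j with rfl | hk
      · simpa using hφ.conj
      · rw [Pi.single_eq_of_ne hk]; exact IsTest.zero
    have h1 := e ⟨_, hU⟩
    have h2 : inner ℂ b (form1 _ fun k => (hU k).memLp)
        = ∫ z in Ω, conj (φ z) * conj (b j z) := by
      rw [inner_form1_right, Finset.sum_eq_single j]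
      · simp
      · intro k _ hk
        simp [hk]
      · simp
    have hdiv : divz (Pi.single j fun z => conj (φ z) : Fin n → Cn n → ℂ)
        = fun z => conj (dzbar j φ z) := by
      funext z
      rw [divz, Finset.sum_eq_single j]
      · simp [dz_conj]
      · intro k _ hk
        simp [hk, dz]
      · simp
    have h3 : inner ℂ β ((-testDiv Ω) ⟨_, hU⟩)
        = -∫ z in Ω, conj (dzbar j φ z) * conj (β z) := by
      rw [LinearMap.neg_apply, inner_neg_right, L2.inner_def]
      congr 1
      refine integral_congr_ae ?_
      filter_upwards [(isTest_divz hU).memLp.coeFn_toLp] with z hz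
      rw [← congrFun hdiv z, ← hz]
      rfl
    have h4 : ∫ z in Ω, conj (φ z) * conj (b j z) = -∫ z in Ω, conj (dzbar j φ z) * conj (β z) :=
      h2.symm.trans (h1.trans h3)
    have h5 := congrArg conj h4
    rw [map_neg, ← integral_conj, ← integral_conj] at h5
    simp only [map_mul, Complex.conj_conj] at h5
    change ∫ z in Ω, β z * dzbar j φ z = -∫ z in Ω, b j z * φ z
    simp only [mul_comm (β _), mul_comm (b j _), h5, neg_neg]
  rw [← dbar0_graph hΩ, LinearPMap.mem_graph_iff] at hmem
  obtain ⟨y, hy1, hy2⟩ := hmem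
  have h6 := (LinearPMap.adjoint_isFormalAdjoint (dbar0_dense hΩ)) u y
  have h7 : inner ℂ b (u : L2Form1 Ω) = conj (inner ℂ (dbarStar Ω u) (y : L2 Ω)) := by
    have h8 : inner ℂ (dbarStar Ω u) (y : L2 Ω) = inner ℂ (u : L2Form1 Ω) (dbar0 Ω y) := h6
    rw [h8, inner_conj_symm, hy2]
  rw [h7, RCLike.norm_conj]
  refine (norm_inner_le_norm _ _).trans ?_
  rw [mul_comm]
  have : ‖(y : L2 Ω)‖ ≤ K := by rw [show (y : L2 Ω) = β from hy1]; exact hβ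
  gcongr

/-- The constant C must not depend on s: the two bounds of `WeightedBound.exists_split` then survive
the limit s → 0 and give K‖α‖ for the pairing minus ⟨b,u⟩, and K‖∂̄*u‖ for ⟨b,u⟩. -/
lemma IsDefining.norm_sesq_le (hr : IsDefining Ω r) {B : Cn n → Matrix (Fin n) (Fin n) ℂ}
    (hB : IsPsdMatrix Ω B) {C : ℝ} (hC : 0 ≤ C)
    (hW : ∀ s > 0, WeightedBound Ω (sigma r s) B C) {u : L2Form1 Ω} {α : L2Form2 Ω}
    (hu : (u, α) ∈ dbar1Graph Ω) (hu' : u ∈ (dbarStar Ω).domain)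
    {F : Fin n → Cn n → ℂ} (hF : ∀ j, IsTest Ω (F j)) :
    ‖sesq Ω B (fun j z => u j z) F‖
      ≤ √(C * ∫ z in Ω, hform (B z) fun j => F j z) * (‖α‖ + ‖dbarStar Ω ⟨u, hu'⟩‖) := by
  have hΩ := hr.isOpen
  obtain ⟨CB, hCB⟩ := hB.bdd
  have hσ := hr.isWeight_sigmaSeq
  have split := fun m => (hW _ (one_div_add_one_pos m)).exists_split hΩ (hσ m) hB hC hF
  choose p hp hpu hpU using split
  set D := ∫ z in Ω, hform (B z) fun j => F j z
  have hD0 : 0 ≤ D := integral_hform_nonneg hΩ hB F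
  have hDlim := tendsto_integral_hform hCB fun j => hr.L2Tendsto_sigmaSeq_inv_pow 8 (hF j)
  -- The bounds on ‖p m‖² converge because F has compact support, so the sequence p is bounded.
  have hbd : Tendsto (fun m => ∑ j, ∫ z in Ω, ‖((sigmaSeq r m z)⁻¹ : ℂ) ^ 7 * dualForm B F j z‖ ^ 2)
      atTop (𝓝 (∑ j, ∫ z in Ω, ‖dualForm B F j z‖ ^ 2)) :=
    tendsto_finsetSum _ fun j _ =>
      (hr.L2Tendsto_sigmaSeq_inv_pow 7 (isTest_dualForm hΩ hB hF j)).norm_sq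
  obtain ⟨R, hR⟩ := hbd.bddAbove_range
  have hpR : ∀ m, ‖p m‖ ≤ √R := fun m =>
    Real.le_sqrt_of_sq_le ((hp m).trans (hR ⟨m, rfl⟩))
  obtain ⟨l, b, hl, hl', hb⟩ := exists_weak_limit hpR
  set K := √(C * D)
  have hK : 0 ≤ K := Real.sqrt_nonneg _
  have h1 : ‖sesq Ω B (fun j z => u j z) F - inner ℂ b u‖ ≤ K * ‖α‖ := by
    have t1 := hb _ _ (tendsto_form1 fun j => hr.L2Tendsto_sigmaSeq_pow 7 (Lp.memLp (u j)))
    have e : form1 (fun j z => u j z) (fun j => Lp.memLp (u j)) = u := by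
      ext1 j
      exact Lp.toLp_coeFn (u j) (Lp.memLp (u j))
    rw [e] at t1
    have t2 := ((t1.const_sub (sesq Ω B (fun j z => u j z) F)).norm.pow 2)
    have t3 := (hDlim.mono_left hl').const_mul (C * ‖α‖ ^ 2)
    have h2 := le_of_tendsto_of_tendsto t2 t3 (Eventually.of_forall fun m => hpu m u α hu)
    have h3 : (K * ‖α‖) ^ 2 = C * ‖α‖ ^ 2 * D := by
      rw [mul_pow, Real.sq_sqrt (mul_nonneg hC hD0)]; ring
    rw [← h3] at h2
    exact le_of_sq_le_sq h2 (by positivity)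
  have h2 : ‖inner ℂ b u‖ ≤ K * ‖dbarStar Ω ⟨u, hu'⟩‖ := by
    refine norm_inner_le_of_test hΩ hK (fun U => ?_) ⟨u, hu'⟩
    have hU := isTest_coe_testForms U
    have t1 := hb _ _ (tendsto_form1 fun j => hr.L2Tendsto_sigmaSeq_pow 7 (hU j).memLp)
    have t2 := t1.norm.pow 2
    have t3 := (((hr.L2Tendsto_weighted_div hU).norm_sq.const_mul C).mul hDlim).mono_left hl'
    have h2 := le_of_tendsto_of_tendsto t2 t3 (Eventually.of_forall fun m => hpU m U.1 hU)
    have h3 : (K * ‖testDiv Ω U‖) ^ 2 = C * (∫ z in Ω, ‖divz U.1 z‖ ^ 2) * D := by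
      rw [mul_pow, Real.sq_sqrt (mul_nonneg hC hD0)]
      have : ‖testDiv Ω U‖ ^ 2 = ∫ z in Ω, ‖divz U.1 z‖ ^ 2 :=
        norm_toLp_sq (isTest_divz hU).memLp
      rw [this]; ring
    rw [← h3] at h2
    exact le_of_sq_le_sq h2 (by positivity)
  calc ‖sesq Ω B (fun j z => u j z) F‖
      = ‖(sesq Ω B (fun j z => u j z) F - inner ℂ b u) + inner ℂ b u‖ := by rw [sub_add_cancel]
    _ ≤ K * ‖α‖ + K * ‖dbarStar Ω ⟨u, hu'⟩‖ := (norm_add_le _ _).trans (add_le_add h1 h2)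
    _ = _ := by ring

lemma tendsto_sesq {B : Cn n → Matrix (Fin n) (Fin n) ℂ} {C : ℝ} (hB : IsBddMatrix Ω B C)
    {u : Fin n → Cn n → ℂ} (hu : ∀ j, MemLp (u j) 2 (volume.restrict Ω))
    {F : ℕ → Fin n → Cn n → ℂ} {F₀ : Fin n → Cn n → ℂ}
    (hF : ∀ j, L2Tendsto Ω (fun m => F m j) (F₀ j)) :
    Tendsto (fun m => sesq Ω B u (F m)) atTop (𝓝 (sesq Ω B u F₀)) := by
  have hi : ∀ {v : Fin n → Cn n → ℂ}, (∀ j, MemLp (v j) 2 (volume.restrict Ω)) → ∀ j k,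
      IntegrableOn (fun z => B z j k * u j z * conj (v k z)) Ω := fun hv j k =>
    (MemLp.mul_bdd (hu j) (hB j k).1 (hB j k).2).integrable_mul (hv k).star
  have e : ∀ {v : Fin n → Cn n → ℂ}, (∀ j, MemLp (v j) 2 (volume.restrict Ω)) →
      sesq Ω B u v = ∑ j, ∑ k, ∫ z in Ω, B z j k * u j z * conj (v k z) := fun hv => by
    rw [sesq, integral_finsetSum _ fun j _ => integrable_finsetSum _ fun k _ => hi hv j k]
    exact Finset.sum_congr rfl fun j _ => integral_finsetSum _ fun k _ => hi hv j k
  rw [e fun j => (hF j).2.1]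
  simp only [fun m => e fun j => (hF j).1 m]
  exact tendsto_finsetSum _ fun j _ => tendsto_finsetSum _ fun k _ =>
    ((L2Tendsto.const (hu j)).mul_bdd (hB j k).1 (hB j k).2).integral_mul_conj (hF k)

/-- Approximation of u by test forms in L² alone suffices, since the bound of
`IsDefining.norm_sesq_le` involves no derivative of F. -/
theorem IsDefining.integral_hform_le (hr : IsDefining Ω r)
    {B : Cn n → Matrix (Fin n) (Fin n) ℂ} (hB : IsPsdMatrix Ω B) {C : ℝ} (hC : 0 ≤ C)
    (hW : ∀ s > 0, WeightedBound Ω (sigma r s) B C) {u : L2Form1 Ω} {α : L2Form2 Ω}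
    (hu : (u, α) ∈ dbar1Graph Ω) (hu' : u ∈ (dbarStar Ω).domain) :
    ∫ z in Ω, hform (B z) (fun j => u j z)
      ≤ 2 * C * (‖α‖ ^ 2 + ‖dbarStar Ω ⟨u, hu'⟩‖ ^ 2) := by
  have hΩ := hr.isOpen
  obtain ⟨CB, hCB⟩ := hB.bdd
  have hum : ∀ j, MemLp (fun z => u j z) 2 (volume.restrict Ω) := fun j => Lp.memLp (u j)
  set A := ∫ z in Ω, hform (B z) (fun j => u j z) with hA
  have hA0 : 0 ≤ A := integral_hform_nonneg hΩ hB _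
  set a := ‖α‖
  set b := ‖dbarStar Ω ⟨u, hu'⟩‖
  obtain ⟨F, hF, hFu⟩ := exists_testForm_L2Tendsto hΩ u
  have h1 : ‖sesq Ω B (fun j z => u j z) fun j z => u j z‖ ≤ √(C * A) * (a + b) := by
    have t1 := (tendsto_sesq hCB hum hFu).norm
    have t2 := (((tendsto_integral_hform hCB hFu).const_mul C).sqrt).mul_const (a + b)
    exact le_of_tendsto_of_tendsto t1 t2 (Eventually.of_forall fun m =>
      hr.norm_sesq_le hB hC hW hu hu' (hF m))
  have h2 : A = (sesq Ω B (fun j z => u j z) fun j z => u j z).re :=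
    integral_re (hCB.integrable hum hum)
  have h3 : A ≤ √(C * A) * (a + b) := by
    calc A ≤ |A| := le_abs_self A
      _ ≤ _ := by rw [h2]; exact (Complex.abs_re_le_norm _).trans (by rw [← h2]; exact h1)
  -- With F replaced by u the quantity A occurs on both sides; squaring and dividing by A, when it
  -- is positive, removes it.
  have h4 : A ^ 2 ≤ C * A * (a + b) ^ 2 := by
    have := pow_le_pow_left₀ hA0 h3 2
    rwa [mul_pow, Real.sq_sqrt (mul_nonneg hC hA0)] at this
  rcases hA0.eq_or_lt with h0 | h0
  · rw [← h0]; positivity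
  · have h5 : A ≤ C * (a + b) ^ 2 := by
      refine le_of_mul_le_mul_right ?_ h0
      linarith
    have h6 : (a + b) ^ 2 ≤ 2 * (a ^ 2 + b ^ 2) := by nlinarith [sq_nonneg (a - b)]
    calc A ≤ C * (a + b) ^ 2 := h5
      _ ≤ C * (2 * (a ^ 2 + b ^ 2)) := by gcongr
      _ = _ := by ring

end Transfer

/-! ### Interior regularity -/

section Interior

variable {n : ℕ} {Ω : Set (Cn n)}

lemma dz_const (j : Fin n) (c : ℂ) : dz j (fun _ : Cn n => c) = 0 := by
  funext z; simp [dz]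

lemma dzbar_const (j : Fin n) (c : ℂ) : dzbar j (fun _ : Cn n => c) = 0 := by
  funext z; simp [dzbar]

/-- The Morrey–Kohn identity with constant weight 1. -/
lemma integral_dzbar_mul_conj_dzbar (hΩ : IsOpen Ω) {U : Fin n → Cn n → ℂ}
    (hU : ∀ j, IsTest Ω (U j)) (j k : Fin n) :
    ∫ z in Ω, dzbar k (U j) z * conj (dzbar j (U k) z)
      = ∫ z in Ω, dz j (U j) z * conj (dz k (U k) z) := by
  have h := integral_morreyTerm hΩ (W := fun _ => (1 : ℂ)) contDiffOn_const hU j k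
  have h0 : dzbar k (0 : Cn n → ℂ) = 0 := dzbar_const k 0
  simp only [morreyTerm, dz_const, dzbar_const, h0, Pi.zero_apply, one_mul, zero_mul,
    sub_zero] at h
  rw [integral_sub] at h
  · exact sub_eq_zero.1 h
  · exact (((hU k).wirtinger j).conj.mul_contDiffOn hΩ
      ((hU j).wirtinger k).contDiffOn).integrableOn
  · exact (((hU k).dz k).conj.mul_contDiffOn hΩ ((hU j).dz j).contDiffOn).integrableOn

lemma IsTest.integrable_norm_sq {φ : Cn n → ℂ} (h : IsTest Ω φ) :
    IntegrableOn (fun z => ‖φ z‖ ^ 2) Ω := h.memLp.integrable_norm_pow (by norm_num)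

lemma ofReal_integral_norm_sq (φ : Cn n → ℂ) :
    ((∫ z in Ω, ‖φ z‖ ^ 2 : ℝ) : ℂ) = ∫ z in Ω, φ z * conj (φ z) := by
  rw [← integral_complex_ofReal]
  simp only [Complex.mul_conj, Complex.normSq_eq_norm_sq]

lemma IsTest.integral_dz_sq (hΩ : IsOpen Ω) {φ : Cn n → ℂ} (h : IsTest Ω φ) (j : Fin n) :
    ∫ z in Ω, ‖_root_.dz j φ z‖ ^ 2 = ∫ z in Ω, ‖dzbar j φ z‖ ^ 2 := by
  have := integral_dzbar_mul_conj_dzbar hΩ (U := fun _ => φ) (fun _ => h) j j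
  rw [← ofReal_integral_norm_sq, ← ofReal_integral_norm_sq] at this
  exact_mod_cast this.symm

/-- On compactly supported forms ∂̄ ⊕ div is elliptic: together they control every ∂̄-derivative,
with equality, and hence all first derivatives. -/
lemma sum_integral_dzbar_sq (hΩ : IsOpen Ω) {U : Fin n → Cn n → ℂ} (hU : ∀ j, IsTest Ω (U j)) :
    ∑ j, ∑ k, ∫ z in Ω, ‖dzbar k (U j) z‖ ^ 2
      = (∑ i : Pairs n, ∫ z in Ω, ‖dzbar i.1.1 (U i.1.2) z - dzbar i.1.2 (U i.1.1) z‖ ^ 2)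
        + ∫ z in Ω, ‖divz U z‖ ^ 2 := by
  have i1 : ∀ j k, IntegrableOn (fun z => ‖dzbar k (U j) z‖ ^ 2) Ω := fun j k =>
    ((hU j).wirtinger k).integrable_norm_sq
  have i2 : ∀ j k, IntegrableOn (fun z => dzbar k (U j) z * conj (dzbar j (U k) z)) Ω :=
    fun j k => (((hU k).wirtinger j).conj.mul_contDiffOn hΩ
      ((hU j).wirtinger k).contDiffOn).integrableOn
  have i3 : ∀ j k, IntegrableOn (fun z => dz j (U j) z * conj (dz k (U k) z)) Ω :=
    fun j k => (((hU k).dz k).conj.mul_contDiffOn hΩ ((hU j).dz j).contDiffOn).integrableOn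
  have i4 : ∀ i : Pairs n, IntegrableOn
      (fun z => ‖dzbar i.1.1 (U i.1.2) z - dzbar i.1.2 (U i.1.1) z‖ ^ 2) Ω := fun i =>
    (((hU i.1.2).wirtinger i.1.1).sub ((hU i.1.1).wirtinger i.1.2)).integrable_norm_sq
  have e1 : ∑ i : Pairs n, ∫ z in Ω, ‖dzbar i.1.1 (U i.1.2) z - dzbar i.1.2 (U i.1.1) z‖ ^ 2
      = (∑ j, ∑ k, ∫ z in Ω, ‖dzbar k (U j) z‖ ^ 2)
        - (∑ j, ∑ k, ∫ z in Ω, dzbar k (U j) z * conj (dzbar j (U k) z)).re := by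
    rw [← integral_finsetSum _ fun i _ => i4 i]
    simp only [fun z => sum_antisymm_sq fun a b => dzbar a (U b) z]
    have e3 : ∑ j, ∑ k, ∫ z in Ω, dzbar k (U j) z * conj (dzbar j (U k) z)
        = ∫ z in Ω, ∑ j, ∑ k, dzbar k (U j) z * conj (dzbar j (U k) z) := by
      rw [integral_finsetSum _ fun j _ => integrable_finsetSum _ fun k _ => i2 j k]
      exact Finset.sum_congr rfl fun j _ => (integral_finsetSum _ fun k _ => i2 j k).symm
    have e4 : ∑ j, ∑ k, ∫ z in Ω, ‖dzbar k (U j) z‖ ^ 2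
        = ∫ z in Ω, ∑ j, ∑ k, ‖dzbar k (U j) z‖ ^ 2 := by
      rw [integral_finsetSum _ fun j _ => integrable_finsetSum _ fun k _ => i1 j k]
      exact Finset.sum_congr rfl fun j _ => (integral_finsetSum _ fun k _ => i1 j k).symm
    have i5 : IntegrableOn (fun z => ∑ j, ∑ k, dzbar k (U j) z * conj (dzbar j (U k) z)) Ω :=
      integrable_finsetSum _ fun j _ => integrable_finsetSum _ fun k _ => i2 j k
    have i6 : IntegrableOn (fun z =>
        (∑ j, ∑ k, dzbar k (U j) z * conj (dzbar j (U k) z)).re) Ω := i5.re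
    have i7 : IntegrableOn (fun z => ∑ j, ∑ k, ‖dzbar k (U j) z‖ ^ 2) Ω :=
      integrable_finsetSum _ fun j _ => integrable_finsetSum _ fun k _ => i1 j k
    rw [e3, e4, integral_sub i7 i6]
    congr 1
    exact integral_re i5
  have e2 : ∑ j, ∑ k, ∫ z in Ω, dzbar k (U j) z * conj (dzbar j (U k) z)
      = ((∫ z in Ω, ‖divz U z‖ ^ 2 : ℝ) : ℂ) := by
    rw [ofReal_integral_norm_sq]
    simp only [fun j k => integral_dzbar_mul_conj_dzbar hΩ hU j k, divz, map_sum,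
      Finset.sum_mul_sum]
    rw [integral_finsetSum _ fun j _ => integrable_finsetSum _ fun k _ => i3 j k]
    exact Finset.sum_congr rfl fun j _ => (integral_finsetSum _ fun k _ => i3 j k).symm
  rw [e1, e2, Complex.ofReal_re]
  ring

/-- The ∂_j and ∂̄_j derivatives of a test function have equal L² norms, so the real gradient is
controlled by ∂̄ alone. -/
lemma IsTest.sobolevOneSq_eq (hΩ : IsOpen Ω) {φ : Cn n → ℂ} (h : IsTest Ω φ) :
    sobolevOneSq Ω φ = (∫ z in Ω, ‖φ z‖ ^ 2) + 4 * ∑ j, ∫ z in Ω, ‖dzbar j φ z‖ ^ 2 := by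
  rw [sobolevOneSq, Finset.mul_sum]
  congr 1
  refine Finset.sum_congr rfl fun j _ => ?_
  have e : ∀ z, ‖fderiv ℝ φ z (EuclideanSpace.single j 1)‖ ^ 2
      + ‖fderiv ℝ φ z (EuclideanSpace.single j Complex.I)‖ ^ 2
      = 2 * ‖_root_.dz j φ z‖ ^ 2 + 2 * ‖dzbar j φ z‖ ^ 2 := fun z => by
    simp only [_root_.dz, dzbar, ← Complex.normSq_eq_norm_sq, Complex.normSq_apply,
      Complex.mul_re, Complex.mul_im, Complex.sub_re, Complex.sub_im, Complex.add_re,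
      Complex.add_im, Complex.I_re, Complex.I_im]
    norm_num
    ring
  rw [← integral_add (fderiv_apply_test h _).integrable_norm_sq
    (fderiv_apply_test h _).integrable_norm_sq]
  simp only [e]
  rw [integral_add ((h.dz j).integrable_norm_sq.const_mul 2)
    ((h.wirtinger j).integrable_norm_sq.const_mul 2), integral_const_mul, integral_const_mul,
    h.integral_dz_sq hΩ]
  ring

lemma sobolevOneSq_conj (φ : Cn n → ℂ) :
    sobolevOneSq Ω (fun z => conj (φ z)) = sobolevOneSq Ω φ := by
  simp only [sobolevOneSq, fderiv_conj, RCLike.norm_conj]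

lemma sobolevOneSq_nonneg (φ : Cn n → ℂ) : 0 ≤ sobolevOneSq Ω φ :=
  add_nonneg (integral_nonneg fun _ => sq_nonneg _) (Finset.sum_nonneg fun _ _ =>
    add_nonneg (integral_nonneg fun _ => sq_nonneg _) (integral_nonneg fun _ => sq_nonneg _))

lemma IsTest.sobolevOneSq_const_mul {φ : Cn n → ℂ} (h : IsTest Ω φ) (c : ℂ) :
    sobolevOneSq Ω (fun z => c * φ z) = ‖c‖ ^ 2 * sobolevOneSq Ω φ := by
  have e : ∀ z v, fderiv ℝ (fun z => c * φ z) z v = c * fderiv ℝ φ z v := fun z v => by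
    have := fderiv_const_smul (h.diffAt z) c
    exact congrArg (fun A : Cn n →L[ℝ] ℂ => A v) this
  simp only [sobolevOneSq, e, norm_mul, mul_pow, integral_const_mul, mul_add, Finset.mul_sum]

lemma sobolevNegOne_nonneg (f : L2 Ω) : 0 ≤ sobolevNegOne f :=
  Real.sSup_nonneg (by rintro _ ⟨φ, _, _, rfl⟩; exact norm_nonneg _)

/-- Homogeneous form of the W⁻¹–W¹₀ duality. The shift by T > 0 permits normalisation even when the
Sobolev norm vanishes, and T → 0 removes it. -/
lemma IsTest.norm_integral_le {φ : Cn n → ℂ} (h : IsTest Ω φ) (f : L2 Ω) :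
    ‖∫ z in Ω, f z * φ z‖ ≤ sobolevNegOne f * √(sobolevOneSq Ω φ) := by
  have step : ∀ T > 0, ‖∫ z in Ω, f z * φ z‖ ≤ sobolevNegOne f * √(sobolevOneSq Ω φ + T) := by
    intro T hT
    set S := sobolevOneSq Ω φ + T
    have hS : 0 < S := add_pos_of_nonneg_of_pos (sobolevOneSq_nonneg φ) hT
    have hS' : 0 < √S := Real.sqrt_pos.2 hS
    have h1 : sobolevOneSq Ω (fun z => (((√S)⁻¹ : ℝ) : ℂ) * φ z) ≤ 1 := by
      rw [h.sobolevOneSq_const_mul, Complex.norm_real, Real.norm_of_nonneg (by positivity),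
        inv_pow, Real.sq_sqrt hS.le, inv_mul_le_iff₀ hS]
      simp only [S]
      linarith
    have h2 := le_csSup (sobolevNegOne_bddAbove f) ⟨_, h.const_mul _, h1, rfl⟩
    have e : ∫ z in Ω, f z * ((((√S)⁻¹ : ℝ) : ℂ) * φ z)
        = (((√S)⁻¹ : ℝ) : ℂ) * ∫ z in Ω, f z * φ z := by
      rw [← integral_const_mul]
      exact integral_congr_ae (Eventually.of_forall fun z => by simp only; ring)
    rw [e, norm_mul, Complex.norm_real, Real.norm_of_nonneg (by positivity),
      inv_mul_le_iff₀ hS'] at h2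
    rw [mul_comm]
    exact h2
  have hlim : Tendsto (fun T => sobolevNegOne f * √(sobolevOneSq Ω φ + T)) (𝓝[>] 0)
      (𝓝 (sobolevNegOne f * √(sobolevOneSq Ω φ + 0))) :=
    ((((continuous_const.add continuous_id).sqrt).const_mul _).tendsto 0).mono_left
      nhdsWithin_le_nhds
  rw [add_zero] at hlim
  exact ge_of_tendsto hlim (eventually_mem_nhdsWithin.mono step)

/-- In the interior ∂̄* is the formal adjoint -div: the adjoint relation is tested against conj φ.
-/
lemma weakEq_of_mem_dbarStar (hΩ : IsOpen Ω) (u : (dbarStar Ω).domain) :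
    WeakEq Ω dzL (fun j z => (u : L2Form1 Ω) j z) (fun z => -dbarStar Ω u z) := by
  intro φ hφ
  have hψ := hφ.conj
  obtain ⟨y, hy1, hy2⟩ : ∃ y : (dbar0 Ω).domain, (y : L2 Ω) = hψ.memLp.toLp _ ∧
      dbar0 Ω y = form1 _ fun j => (hψ.wirtinger j).memLp := by
    have hmem : (hψ.memLp.toLp _, form1 _ fun j => (hψ.wirtinger j).memLp) ∈ dbar0Graph Ω := by
      intro j χ hχ
      have h1 : ∫ z in Ω, (hψ.memLp.toLp _) z * dzbar j χ z
          = ∫ z in Ω, conj (φ z) * dzbar j χ z :=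
        integral_congr_ae (by filter_upwards [hψ.memLp.coeFn_toLp] with z hz; rw [hz])
      have h2 : ∫ z in Ω, (form1 _ fun j => (hψ.wirtinger j).memLp) j z * χ z
          = ∫ z in Ω, dzbar j (fun z => conj (φ z)) z * χ z :=
        integral_congr_ae (by
          filter_upwards [form1_coeFn (fun j => (hψ.wirtinger j).memLp) j] with z hz; rw [hz])
      exact h1.trans ((hψ.integral_dzbar hχ j).trans (congrArg _ h2.symm))
    rw [← dbar0_graph hΩ, LinearPMap.mem_graph_iff] at hmem
    exact hmem
  have h3 : inner ℂ (dbarStar Ω u) (y : L2 Ω) = inner ℂ (u : L2Form1 Ω) (dbar0 Ω y) :=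
    (LinearPMap.adjoint_isFormalAdjoint (dbar0_dense hΩ)) u y
  have h4 := congrArg conj h3
  rw [inner_conj_symm, inner_conj_symm, hy1, hy2, inner_form1, L2.inner_def] at h4
  have h5 : ∫ z in Ω, inner ℂ (hψ.memLp.toLp _ z) (dbarStar Ω u z)
      = ∫ z in Ω, dbarStar Ω u z * φ z := by
    refine integral_congr_ae ?_
    filter_upwards [hψ.memLp.coeFn_toLp] with z hz
    rw [hz, RCLike.inner_apply, Complex.conj_conj]
  rw [h5] at h4
  simp only [neg_mul, integral_neg, neg_neg, h4, dzbar_conj, Complex.conj_conj, ← dz_eq]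

end Interior

/-! ### Control of a truncated form by its W⁻¹ norm. -/

section InteriorEstimate

variable {n : ℕ} {Ω : Set (Cn n)}

lemma norm_add_sum_mul_sq_le {a : ℂ} {c f : Fin n → ℂ} {M : ℝ} (hc : ∀ k, ‖c k‖ ≤ M) :
    ‖a + ∑ k, c k * f k‖ ^ 2 ≤ 2 * ‖a‖ ^ 2 + 2 * n * M ^ 2 * ∑ k, ‖f k‖ ^ 2 := by
  have h1 : ‖∑ k, c k * f k‖ ^ 2 ≤ n * ∑ k, ‖c k * f k‖ ^ 2 := by
    have h2 := sq_sum_le_card_mul_sum_sq (s := Finset.univ) (f := fun k => ‖c k * f k‖)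
    rw [Finset.card_univ, Fintype.card_fin] at h2
    refine le_trans ?_ h2
    gcongr
    exact norm_sum_le _ _
  have h3 : ∑ k, ‖c k * f k‖ ^ 2 ≤ M ^ 2 * ∑ k, ‖f k‖ ^ 2 := by
    rw [Finset.mul_sum]
    refine Finset.sum_le_sum fun k _ => ?_
    rw [norm_mul, mul_pow]
    gcongr
    exact hc k
  have h4 : (n : ℝ) * ∑ k, ‖c k * f k‖ ^ 2 ≤ n * (M ^ 2 * ∑ k, ‖f k‖ ^ 2) := by gcongr
  have h5 := norm_add_le a (∑ k, c k * f k)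
  have h6 := pow_le_pow_left₀ (norm_nonneg _) h5 2
  nlinarith [sq_nonneg (‖a‖ - ‖∑ k, c k * f k‖)]

lemma integral_norm_add_sum_mul_sq_le {χ : Cn n → ℂ} (hχ : IsTest Ω χ) (hχ1 : ∀ z, ‖χ z‖ ≤ 1)
    {c : Fin n → Cn n → ℂ} {M : ℝ} (hc : ∀ k, IsTest Ω (c k)) (hcM : ∀ k z, ‖c k z‖ ≤ M)
    {f : Cn n → ℂ} (hf : MemLp f 2 (volume.restrict Ω)) (u : L2Form1 Ω) :
    MemLp (fun z => χ z * f z + ∑ k, c k z * u k z) 2 (volume.restrict Ω) ∧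
    ∫ z in Ω, ‖χ z * f z + ∑ k, c k z * u k z‖ ^ 2
      ≤ 2 * (∫ z in Ω, ‖f z‖ ^ 2) + 2 * n * M ^ 2 * ‖u‖ ^ 2 := by
  have hm : MemLp (fun z => χ z * f z + ∑ k, c k z * u k z) 2 (volume.restrict Ω) :=
    (MemLp.mul_bdd hf hχ.1.continuous.aestronglyMeasurable (Eventually.of_forall hχ1)).add
      (memLp_finsetSum _ fun k _ => MemLp.mul_bdd (Lp.memLp (u k))
        (hc k).1.continuous.aestronglyMeasurable (Eventually.of_forall (hcM k)))
  refine ⟨hm, ?_⟩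
  have i0 : Integrable (fun z => ‖f z‖ ^ 2) (volume.restrict Ω) :=
    hf.integrable_norm_pow (by norm_num)
  have i1 : ∀ k, Integrable (fun z => ‖u k z‖ ^ 2) (volume.restrict Ω) := fun k =>
    (Lp.memLp (u k)).integrable_norm_pow (by norm_num)
  have i2 : Integrable (fun z => ∑ k, ‖u k z‖ ^ 2) (volume.restrict Ω) :=
    integrable_finsetSum _ fun k _ => i1 k
  rw [norm_form1_sq, ← integral_finsetSum _ fun k _ => i1 k, ← integral_const_mul,
    ← integral_const_mul, ← integral_add (i0.const_mul _) (i2.const_mul _)]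
  refine integral_mono (hm.integrable_norm_pow (by norm_num))
    ((i0.const_mul _).add (i2.const_mul _)) fun z => ?_
  refine (norm_add_sum_mul_sq_le fun k => hcM k z).trans ?_
  have : ‖χ z * f z‖ ≤ ‖f z‖ := by
    rw [norm_mul]; exact mul_le_of_le_one_left (norm_nonneg _) (hχ1 z)
  simp only
  gcongr

/-- The left side is the pairing of u_j with χu_j. By duality it is at most the W⁻¹ norm of u_j
times the W¹ norm of χu_j, and ellipticity bounds the latter by ∂̄u, ∂̄*u and commutators with χ. -/
theorem exists_interior_bound (hΩ : IsOpen Ω) {χ : Cn n → ℝ}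
    (hχ : IsTest Ω fun z => (χ z : ℂ)) (h01 : ∀ z, χ z ∈ Set.Icc (0 : ℝ) 1) :
    ∃ C, 0 ≤ C ∧ ∀ (u : L2Form1 Ω) (α : L2Form2 Ω) (_ : (u, α) ∈ dbar1Graph Ω)
      (h' : u ∈ (dbarStar Ω).domain) (j : Fin n), ∫ z in Ω, χ z * ‖u j z‖ ^ 2
        ≤ sobolevNegOne (u j)
          * √(C * (‖α‖ ^ 2 + ‖dbarStar Ω ⟨u, h'⟩‖ ^ 2 + ‖u‖ ^ 2)) := by
  set X : Cn n → ℂ := fun z => (χ z : ℂ) with hX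
  have hX1 : ∀ z, ‖X z‖ ≤ 1 := fun z => by
    rw [hX, Complex.norm_real, Real.norm_of_nonneg (h01 z).1]; exact (h01 z).2
  obtain ⟨M, hM⟩ := (hχ.2.1.fderiv (𝕜 := ℝ)).exists_bound_of_continuous
    (hχ.1.continuous_fderiv (by simp))
  have hM0 : 0 ≤ M := (norm_nonneg _).trans (hM 0)
  set P : ℝ := (Fintype.card (Pairs n) : ℝ)
  set A : ℝ := 2 * n * (2 * M) ^ 2
  have hA : 0 ≤ A := by positivity
  have hP : 0 ≤ P := by positivity
  -- The squared W¹ norm is at most ‖u‖² + 4(2‖α‖² + PA‖u‖² + 2‖b‖² + A‖u‖²); 9 covers both 1 and 8.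
  refine ⟨9 + 4 * P * A + 4 * A, by positivity, fun u α hu hu' j => ?_⟩
  set b := dbarStar Ω ⟨u, hu'⟩ with hb
  have X0 : ∀ z, z ∉ tsupport X → X z = 0 := fun z hz => image_eq_zero_of_notMem_tsupport hz
  have dX0 : ∀ z, z ∉ tsupport X → fderiv ℝ X z = 0 := fun z hz => by
    by_contra hne
    exact hz (support_fderiv_subset ℝ hne)
  let W : Fin n → Cn n → ℂ := fun k z => X z * u k z
  let G : Pairs n → Cn n → ℂ := fun i z => X z * α i z + ∑ k, dbarL i k (fderiv ℝ X z) * u k z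
  let D : Cn n → ℂ := fun z => X z * -b z + ∑ k, dzL k (fderiv ℝ X z) * u k z
  have mW : ∀ k, MemLp (W k) 2 := fun k => hχ.memLp_mul hΩ (Lp.memLp (u k))
  have mb : MemLp (fun z => -b z) 2 (volume.restrict Ω) := (Lp.memLp b).neg
  have mG : ∀ i, MemLp (G i) 2 := fun i =>
    (hχ.memLp_mul hΩ (Lp.memLp (α i))).add (memLp_finsetSum _ fun k _ =>
      (hχ.clm_fderiv (dbarL i k)).memLp_mul hΩ (Lp.memLp (u k)))
  have mD : MemLp D 2 := (hχ.memLp_mul hΩ mb).add (memLp_finsetSum _ fun k _ =>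
      (hχ.clm_fderiv (dzL k)).memLp_mul hΩ (Lp.memLp (u k)))
  have iu : ∀ k, TestIntegrable Ω fun z => u k z := fun k => .of_memLp (Lp.memLp (u k))
  have eG : ∀ i, WeakEq Ω (dbarL i) W (G i) := fun i =>
    (mem_dbar1Graph_iff.1 hu i).mul hΩ iu (.of_memLp (Lp.memLp (α i))) hχ.contDiffOn
  have eD : WeakEq Ω dzL W D :=
    (weakEq_of_mem_dbarStar hΩ ⟨u, hu'⟩).mul hΩ iu (.of_memLp mb) hχ.contDiffOn
  have bG : ∀ i, ∫ z in Ω, ‖G i z‖ ^ 2 ≤ 2 * (∫ z in Ω, ‖α i z‖ ^ 2) + A * ‖u‖ ^ 2 := fun i =>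
    (integral_norm_add_sum_mul_sq_le hχ hX1 (fun k => hχ.clm_fderiv (dbarL i k))
      (fun k z => (norm_dbarL_le i k _).trans (by gcongr; exact hM z)) (Lp.memLp (α i)) u).2
  have bD : ∫ z in Ω, ‖D z‖ ^ 2 ≤ 2 * ‖b‖ ^ 2 + A * ‖u‖ ^ 2 := by
    have := (integral_norm_add_sum_mul_sq_le hχ hX1 (fun k => hχ.clm_fderiv (dzL k))
      (M := 2 * M) (fun k z => (norm_dzL_le k _).trans ((hM z).trans (by linarith))) mb u).2
    simp only [norm_neg, ← norm_L2_sq] at this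
    exact this
  have bW : ∫ z in Ω, ‖W j z‖ ^ 2 ≤ ‖u‖ ^ 2 := by
    rw [norm_form1_sq]
    refine le_trans ?_ (Finset.single_le_sum (f := fun k => ∫ z in Ω, ‖u k z‖ ^ 2)
      (fun k _ => integral_nonneg fun z => sq_nonneg _) (Finset.mem_univ j))
    refine integral_mono (((mW j).restrict Ω).integrable_norm_pow (by norm_num))
      ((Lp.memLp (u j)).integrable_norm_pow (by norm_num)) fun z => ?_
    simp only [W, norm_mul]
    gcongr
    exact mul_le_of_le_one_left (norm_nonneg _) (hX1 z)
  have hK : IsCompact (tsupport X) := hχ.2.1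
  have loc : ∀ k, LocallyIntegrable (W k) := fun k => (mW k).locallyIntegrable (by norm_num)
  have W0 : ∀ k z, z ∉ tsupport X → W k z = 0 := fun k z hz => by simp [W, X0 z hz]
  have hev : ∀ᶠ m in atTop, ∀ k, IsTest Ω (moll m (W k)) :=
    eventually_all.2 fun k => moll_isTest hK hΩ hχ.2.2 (loc k) (W0 k)
  have tW : L2Tendsto Ω (fun m => moll m (W j)) (W j) := L2Tendsto_moll (mW j)
  have t0 := ((L2Tendsto.const (Lp.memLp (u j))).integral_mul_conj tW).norm
  have t1 := (((tW.norm_sq.add (((tendsto_finsetSum Finset.univ fun i _ =>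
    (L2Tendsto_moll (Ω := Ω) (mG i)).norm_sq).add
      (L2Tendsto_moll (Ω := Ω) mD).norm_sq).const_mul 4)).sqrt).const_mul (sobolevNegOne (u j)))
  -- The duality applies to test functions, so it is used for the mollifications of χu_j and both
  -- sides are passed to the limit.
  have key := le_of_tendsto_of_tendsto t0 t1 (by
    filter_upwards [hev] with m hm
    refine ((hm j).conj.norm_integral_le (u j)).trans ?_
    have e1 : ∀ (i : Pairs n) z, dzbar i.1.1 (moll m (W i.1.2)) z
        - dzbar i.1.2 (moll m (W i.1.1)) z = moll m (G i) z := fun i z => by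
      rw [← (eG i).moll hΩ hK hχ.2.2 loc W0 (fun z hz => by simp [G, X0 z hz, dX0 z hz]) m z,
        sum_dbarL_apply]
      rfl
    have e2 : ∀ z, divz (fun k => moll m (W k)) z = moll m D z := fun z => by
      rw [← eD.moll hΩ hK hχ.2.2 loc W0 (fun z hz => by simp [D, X0 z hz, dX0 z hz]) m z]
      rfl
    have e3 := sum_integral_dzbar_sq hΩ hm
    simp only [e1, e2] at e3
    rw [sobolevOneSq_conj, (hm j).sobolevOneSq_eq hΩ, ← e3]
    refine mul_le_mul_of_nonneg_left (Real.sqrt_le_sqrt ?_) (sobolevNegOne_nonneg _)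
    refine add_le_add le_rfl (mul_le_mul_of_nonneg_left ?_ (by norm_num))
    exact Finset.single_le_sum (f := fun j => ∑ k, ∫ z in Ω, ‖dzbar k (moll m (W j)) z‖ ^ 2)
      (fun j _ => Finset.sum_nonneg fun k _ => integral_nonneg fun z => sq_nonneg _)
      (Finset.mem_univ j))
  have e4 : ∫ z in Ω, u j z * conj (W j z) = ((∫ z in Ω, χ z * ‖u j z‖ ^ 2 : ℝ) : ℂ) := by
    rw [← integral_complex_ofReal]
    refine integral_congr_ae (Eventually.of_forall fun z => ?_)
    simp only [W, hX, map_mul, Complex.conj_ofReal]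
    push_cast
    rw [← Complex.conj_mul']
    ring
  rw [e4, Complex.norm_real] at key
  refine (le_abs_self _).trans (key.trans ?_)
  refine mul_le_mul_of_nonneg_left (Real.sqrt_le_sqrt ?_) (sobolevNegOne_nonneg _)
  have b1 : ∑ i, ∫ z in Ω, ‖G i z‖ ^ 2 ≤ 2 * ‖α‖ ^ 2 + P * (A * ‖u‖ ^ 2) := by
    refine (Finset.sum_le_sum fun i _ => bG i).trans (le_of_eq ?_)
    rw [Finset.sum_add_distrib, ← Finset.mul_sum, norm_form2_sq, Finset.sum_const, nsmul_eq_mul,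
      Finset.card_univ]
  have p1 := mul_nonneg hP hA
  have h1 := sq_nonneg ‖α‖
  have h2 := sq_nonneg ‖b‖
  have h3 := sq_nonneg ‖u‖
  nlinarith [mul_nonneg p1 h1, mul_nonneg p1 h2, mul_nonneg hA h1, mul_nonneg hA h2]

end InteriorEstimate

/-! ### The compactness estimate for the complex Hessian -/

section Main

variable {n : ℕ} {Ω : Set (Cn n)} {r : Cn n → ℝ}

lemma conj_complexHessian (hΩ : IsOpen Ω) (hr : ContDiffOn ℝ ∞ r Ω) {z : Cn n} (hz : z ∈ Ω)
    (j k : Fin n) : conj (complexHessian r z j k) = complexHessian r z k j := by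
  have e : ∀ j k, complexHessian r z j k = dz j (dzbar k fun w => (r w : ℂ)) z := fun _ _ => rfl
  have e1 : (fun w => conj (dzbar k (fun w => (r w : ℂ)) w)) = dz k fun w => (r w : ℂ) := by
    funext w
    rw [dzbar_ofReal, Complex.conj_conj]
  rw [e, e, ← dzbar_conj, e1, dz_dzbar_comm k j hΩ hr.ofReal_comp hz]

lemma IsDefining.isPsdMatrix_hessian (hr : IsDefining Ω r) (hpsh : IsPlurisubharmonicOn r Ω)
    {δ : ℝ} (hδ : 0 < δ) :
    IsPsdMatrix Ω fun z => (Real.exp (r z / δ) : ℂ) • complexHessian r z where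
  smooth j k := (hr.exp_smooth δ).ofReal_comp.mul (contDiffOn_complexHessian hr.isOpen hr.smooth j k)
  bdd := hr.exists_isBddMatrix hδ
  herm z hz j k := by
    simp only [Matrix.smul_apply, smul_eq_mul, map_mul, Complex.conj_ofReal,
      conj_complexHessian hr.isOpen hr.smooth hz]
  nonneg z hz ξ := by
    rw [hform_ofReal_smul]
    exact mul_nonneg (Real.exp_pos _).le (hpsh z hz ξ)

lemma isPsdMatrix_half (hΩ : IsOpen Ω) :
    IsPsdMatrix Ω fun _ => ((1 / 2 : ℝ) : ℂ) • (1 : Matrix (Fin n) (Fin n) ℂ) where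
  smooth _ _ := contDiffOn_const
  bdd := ⟨1, isBddMatrix_half hΩ⟩
  herm z _ j k := by
    simp only [Matrix.smul_apply, smul_eq_mul, map_mul, Complex.conj_ofReal, Matrix.one_apply,
      eq_comm (a := j)]
    split_ifs <;> simp
  nonneg z _ ξ := by
    rw [hform_ofReal_smul, hform_one]
    exact mul_nonneg (by norm_num) (Finset.sum_nonneg fun _ _ => sq_nonneg _)

lemma hform_le_of_norm_le {B : Matrix (Fin n) (Fin n) ℂ} {Λ : ℝ} (hB : ∀ j k, ‖B j k‖ ≤ Λ)
    (hΛ : 0 ≤ Λ) (ξ : Fin n → ℂ) : hform B ξ ≤ Λ * n * ∑ j, ‖ξ j‖ ^ 2 := by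
  have h1 : hform B ξ ≤ ∑ j, ∑ k, Λ * (‖ξ j‖ * ‖ξ k‖) := by
    refine (Complex.re_le_norm _).trans ((norm_sum_le _ _).trans (Finset.sum_le_sum fun j _ =>
      (norm_sum_le _ _).trans (Finset.sum_le_sum fun k _ => ?_)))
    rw [norm_mul, norm_mul, RCLike.norm_conj, mul_assoc]
    gcongr
    exact hB j k
  have h2 : ∑ j, ∑ k, Λ * (‖ξ j‖ * ‖ξ k‖) = Λ * (∑ j, ‖ξ j‖) ^ 2 := by
    simp only [← Finset.mul_sum, sq, Finset.sum_mul]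
  have h3 := sq_sum_le_card_mul_sum_sq (s := Finset.univ) (f := fun j => ‖ξ j‖)
  rw [Finset.card_univ, Fintype.card_fin] at h3
  rw [h2] at h1
  calc hform B ξ ≤ Λ * (∑ j, ‖ξ j‖) ^ 2 := h1
    _ ≤ Λ * (n * ∑ j, ‖ξ j‖ ^ 2) := by gcongr
    _ = _ := by ring

/-- For 0 ≤ B ≤ Λ one has |Bξ|² ≤ Λ (Bξ,ξ): positivity is tested at ξ - Λ⁻¹v, where v is the image
of ξ. The transpose matches the convention of `hform`, whose first index is paired with ξ and second
with its conjugate. -/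
lemma sum_norm_mulVec_sq_le {B : Matrix (Fin n) (Fin n) ℂ} {Λ : ℝ} (hΛ : 0 < Λ)
    (hB : ∀ j k, conj (B j k) = B k j) (h0 : ∀ ξ, 0 ≤ hform B ξ)
    (h1 : ∀ ξ, hform B ξ ≤ Λ * ∑ j, ‖ξ j‖ ^ 2) (ξ : Fin n → ℂ) :
    ∑ j, ‖∑ k, B.transpose j k * ξ k‖ ^ 2 ≤ Λ * hform B ξ := by
  set v : Fin n → ℂ := fun j => ∑ k, B.transpose j k * ξ k with hv
  set S := ∑ j, ‖v j‖ ^ 2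
  have e : ∑ j, ∑ k, B j k * ξ j * conj (v k) = (S : ℂ) := by
    rw [Finset.sum_comm]
    simp only [S]
    push_cast
    refine Finset.sum_congr rfl fun k _ => ?_
    rw [← Finset.sum_mul, ← Complex.mul_conj']
    rfl
  have h2 := h0 fun j => ξ j + (((-Λ⁻¹ : ℝ)) : ℂ) * v j
  rw [hform_add_mul hB, e, Complex.conj_ofReal, ← Complex.ofReal_mul, Complex.ofReal_re,
    Complex.norm_real, Real.norm_eq_abs, sq_abs] at h2
  have h3 := mul_le_mul_of_nonneg_left (h1 v) (sq_nonneg (-Λ⁻¹))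
  have h4 : (-Λ⁻¹) ^ 2 * (Λ * S) = Λ⁻¹ * S := by field_simp
  have h5 : Λ⁻¹ * S ≤ hform B ξ := by
    change (-Λ⁻¹) ^ 2 * hform B v ≤ (-Λ⁻¹) ^ 2 * (Λ * S) at h3
    linarith
  rwa [inv_mul_le_iff₀ hΛ] at h5

/-- Basic `L²` estimate. -/
lemma IsDefining.norm_sq_le (hr : IsDefining Ω r) (hpsh : IsPlurisubharmonicOn r Ω) {R : ℝ}
    (hR : ∀ z ∈ Ω, ‖z‖ ≤ R) {u : L2Form1 Ω} {α : L2Form2 Ω} (hu : (u, α) ∈ dbar1Graph Ω)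
    (hu' : u ∈ (dbarStar Ω).domain) :
    ‖u‖ ^ 2 ≤ 16 * (3 * R ^ 2 + 1) * (‖α‖ ^ 2 + ‖dbarStar Ω ⟨u, hu'⟩‖ ^ 2) := by
  have h1 := hr.integral_hform_le (isPsdMatrix_half hr.isOpen) (C := 4 * (3 * R ^ 2 + 1))
    (by positivity) (fun s hs => hr.weightedBound_one hpsh hs hR) hu hu'
  have i1 : ∀ k, Integrable (fun z => ‖u k z‖ ^ 2) (volume.restrict Ω) := fun k =>
    (Lp.memLp (u k)).integrable_norm_pow (by norm_num)
  simp only [hform_ofReal_smul, hform_one, integral_const_mul] at h1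
  rw [integral_finsetSum _ fun k _ => i1 k, ← norm_form1_sq] at h1
  linarith

theorem IsDefining.compactness_estimate (hr : IsDefining Ω r) (hpsh : IsPlurisubharmonicOn r Ω)
    (hb : Bornology.IsBounded Ω) {ε : ℝ} (hε : 0 < ε) : ∃ C : ℝ, 0 < C ∧
    ∀ (u : L2Form1 Ω) (α : L2Form2 Ω) (_ : (u, α) ∈ dbar1Graph Ω) (h' : u ∈ (dbarStar Ω).domain),
      matrixNormSq (fun z => (complexHessian r z).transpose) u
        ≤ ε * (‖α‖ ^ 2 + ‖dbarStar Ω ⟨u, h'⟩‖ ^ 2) + C * sobolevNegOneSq u := by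
  have hΩ := hr.isOpen
  obtain ⟨R, hR⟩ := hb.exists_norm_le
  obtain ⟨Λ₀, hΛ₀⟩ := hr.bdd_hessian
  set Λ : ℝ := |Λ₀| * n + 1 with hΛ
  have hΛ0 : 0 < Λ := by positivity
  -- Chosen so that 3Λ · 2 · 8δ = ε/2.
  set δ : ℝ := ε / (96 * Λ) with hδ'
  have hδ : 0 < δ := by positivity
  obtain ⟨χ, hχ, hχ1, h01⟩ := exists_cutoff (hr.compact δ hδ) hΩ (hr.sublevel_subset δ hδ)
  obtain ⟨C₁, hC₁, hint⟩ := exists_interior_bound hΩ hχ h01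
  set C₀ : ℝ := 16 * (3 * R ^ 2 + 1)
  have hC₀ : 0 ≤ C₀ := by positivity
  set C₂ : ℝ := C₁ * (1 + C₀)
  have hC₂ : 0 ≤ C₂ := by positivity
  -- Each of the n components may cost θQ; their sum stays below ε/2 · Q, and n + 1 keeps θ well
  -- defined when n = 0.
  set θ : ℝ := ε / (2 * (n + 1))
  have hθ : 0 < θ := by positivity
  have hpt0 : ∀ z ∈ Ω, ∀ ξ, hform (complexHessian r z) ξ ≤ Λ * ∑ j, ‖ξ j‖ ^ 2 := fun z hz ξ => by
    refine (hform_le_of_norm_le (fun j k => (hΛ₀ z hz j k).trans (le_abs_self _))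
      (abs_nonneg _) ξ).trans ?_
    have : (0:ℝ) ≤ ∑ j, ‖ξ j‖ ^ 2 := Finset.sum_nonneg fun _ _ => sq_nonneg _
    gcongr
    rw [hΛ]; linarith
  -- Two regimes: where r ≤ -δ the cut-off is 1 and |ℒξ|² ≤ Λ²|ξ|² is used; in the strip r > -δ the
  -- exponential is at least 1/e ≥ 1/3, whence the factor 3.
  have hpt : ∀ z ∈ Ω, ∀ ξ, ∑ j, ‖∑ k, (complexHessian r z).transpose j k * ξ k‖ ^ 2
      ≤ 3 * Λ * hform ((Real.exp (r z / δ) : ℂ) • complexHessian r z) ξ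
        + Λ ^ 2 * ∑ j, χ z * ‖ξ j‖ ^ 2 := by
    intro z hz ξ
    have h1 := sum_norm_mulVec_sq_le hΛ0 (conj_complexHessian hΩ hr.smooth hz)
      (fun ξ => hpsh z hz ξ) (hpt0 z hz) ξ
    have h2 : 0 ≤ hform (complexHessian r z) ξ := hpsh z hz ξ
    have h3 : 0 ≤ ∑ j, χ z * ‖ξ j‖ ^ 2 :=
      Finset.sum_nonneg fun _ _ => mul_nonneg (h01 z).1 (sq_nonneg _)
    rw [hform_ofReal_smul]
    have he := Real.exp_pos (r z / δ)
    by_cases hzδ : r z ≤ -δ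
    · have h4 : χ z = 1 := hχ1.self_of_nhdsSet z ⟨subset_closure hz, hzδ⟩
      have h5 := hpt0 z hz ξ
      simp only [h4, one_mul]
      have h6 : 0 ≤ 3 * Λ * (Real.exp (r z / δ) * hform (complexHessian r z) ξ) := by positivity
      have h7 : Λ * hform (complexHessian r z) ξ ≤ Λ * (Λ * ∑ j, ‖ξ j‖ ^ 2) := by gcongr
      linarith
    · have h4 : Real.exp (-1) ≤ Real.exp (r z / δ) := by
        refine Real.exp_le_exp.2 ?_
        rw [le_div_iff₀ hδ]
        linarith [not_le.1 hzδ]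
      have h5 : (1 / 3 : ℝ) ≤ Real.exp (-1) := by
        rw [Real.exp_neg, one_div]
        exact inv_anti₀ (Real.exp_pos 1) (by linarith [Real.exp_one_lt_d9])
      have h6 : 1 / 3 * hform (complexHessian r z) ξ
          ≤ Real.exp (r z / δ) * hform (complexHessian r z) ξ := by
        gcongr
        exact h5.trans h4
      have h7 : 0 ≤ Λ ^ 2 * ∑ j, χ z * ‖ξ j‖ ^ 2 := by positivity
      nlinarith
  -- The first term is the Young constant for Λ² N √C₂ √Q against θQ; the added 1 only ensures
  -- positivity.
  refine ⟨Λ ^ 4 * C₂ / (4 * θ) + 1, by positivity, fun u α hu hu' => ?_⟩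
  set Q := ‖α‖ ^ 2 + ‖dbarStar Ω ⟨u, hu'⟩‖ ^ 2
  have hQ : 0 ≤ Q := by positivity
  have hum : ∀ j, MemLp (fun z => u j z) 2 (volume.restrict Ω) := fun j => Lp.memLp (u j)
  obtain ⟨CE, hCE⟩ := hr.exists_isBddMatrix hδ
  have iE : Integrable (fun z => hform ((Real.exp (r z / δ) : ℂ) • complexHessian r z)
      fun j => u j z) (volume.restrict Ω) := (hCE.integrable hum hum).re
  have iχ : ∀ j, Integrable (fun z => χ z * ‖u j z‖ ^ 2) (volume.restrict Ω) := fun j => by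
    have h1 : Integrable (fun z => ‖u j z‖ ^ 2) (volume.restrict Ω) :=
      (hum j).integrable_norm_pow (by norm_num)
    refine h1.mono' ?_ (Eventually.of_forall fun z => ?_)
    · have : Continuous χ := by
        have := Complex.continuous_re.comp hχ.1.continuous
        exact this
      exact this.aestronglyMeasurable.mul h1.1
    · rw [Real.norm_of_nonneg (mul_nonneg (h01 z).1 (sq_nonneg _))]
      exact mul_le_of_le_one_left (sq_nonneg _) (h01 z).2
  obtain ⟨Cc, hCc⟩ : ∃ C, IsBddMatrix Ω (complexHessian r) C :=
    ⟨Λ₀, .of_continuousOn hΩ (contDiffOn_complexHessian hΩ hr.smooth) hΛ₀⟩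
  have iL : ∀ j, Integrable (fun z => ‖∑ k, (complexHessian r z).transpose j k * u k z‖ ^ 2)
      (volume.restrict Ω) := fun j => by
    refine MemLp.integrable_norm_pow (p := 2) (memLp_finsetSum _ fun k _ => ?_) (by norm_num)
    exact MemLp.mul_bdd (hum k) (hCc k j).1 (hCc k j).2
  have h1 : matrixNormSq (fun z => (complexHessian r z).transpose) u
      ≤ 3 * Λ * (∫ z in Ω, hform ((Real.exp (r z / δ) : ℂ) • complexHessian r z) fun j => u j z)
        + Λ ^ 2 * ∑ j, ∫ z in Ω, χ z * ‖u j z‖ ^ 2 := by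
    rw [matrixNormSq, ← integral_finsetSum _ fun j _ => iL j,
      ← integral_finsetSum _ fun j _ => iχ j, ← integral_const_mul, ← integral_const_mul,
      ← integral_add (iE.const_mul _) ((integrable_finsetSum _ fun j _ => iχ j).const_mul _)]
    refine integral_mono_ae (integrable_finsetSum _ fun j _ => iL j)
      ((iE.const_mul _).add ((integrable_finsetSum _ fun j _ => iχ j).const_mul _)) ?_
    filter_upwards [ae_restrict_mem hΩ.measurableSet] with z hz
    exact hpt z hz _
  have h2 := hr.integral_hform_le (hr.isPsdMatrix_hessian hpsh hδ) (C := 8 * δ) (by positivity)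
    (fun s hs => hr.weightedBound_hessian hpsh hs hδ) hu hu'
  have h3 : 3 * Λ * (∫ z in Ω, hform ((Real.exp (r z / δ) : ℂ) • complexHessian r z)
      fun j => u j z) ≤ ε / 2 * Q := by
    calc _ ≤ 3 * Λ * (2 * (8 * δ) * Q) := by gcongr
      _ = ε / 2 * Q := by rw [hδ']; field_simp; norm_num
  have h4 : ∀ j, Λ ^ 2 * ∫ z in Ω, χ z * ‖u j z‖ ^ 2
      ≤ θ * Q + Λ ^ 4 * C₂ / (4 * θ) * sobolevNegOne (u j) ^ 2 := by
    intro j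
    have h5 := hint u α hu hu' j
    set N := sobolevNegOne (u j)
    have hN : 0 ≤ N := sobolevNegOne_nonneg _
    have h6 : C₁ * (‖α‖ ^ 2 + ‖dbarStar Ω ⟨u, hu'⟩‖ ^ 2 + ‖u‖ ^ 2) ≤ C₂ * Q := by
      have := hr.norm_sq_le hpsh hR hu hu'
      calc C₁ * (Q + ‖u‖ ^ 2) ≤ C₁ * (Q + C₀ * Q) := by gcongr
        _ = _ := by ring
    have h7 : ∫ z in Ω, χ z * ‖u j z‖ ^ 2 ≤ N * (√C₂ * √Q) := by
      rw [← Real.sqrt_mul hC₂]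
      exact h5.trans (mul_le_mul_of_nonneg_left (Real.sqrt_le_sqrt h6) hN)
    have s1 := Real.sq_sqrt hC₂
    have s2 := Real.sq_sqrt hQ
    have h8 : Λ ^ 2 * (N * (√C₂ * √Q)) ≤ θ * Q + Λ ^ 4 * C₂ / (4 * θ) * N ^ 2 := by
      -- Young's inequality as an exact completion of the square.
      have e : θ * Q + Λ ^ 4 * C₂ / (4 * θ) * N ^ 2 - Λ ^ 2 * (N * (√C₂ * √Q))
          = θ * (√Q - Λ ^ 2 * N * √C₂ / (2 * θ)) ^ 2 := by
        conv_lhs => rw [← s1, ← s2, Real.sqrt_sq (Real.sqrt_nonneg _),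
          Real.sqrt_sq (Real.sqrt_nonneg _)]
        field_simp
        ring
      have := mul_nonneg hθ.le (sq_nonneg (√Q - Λ ^ 2 * N * √C₂ / (2 * θ)))
      linarith
    exact (mul_le_mul_of_nonneg_left h7 (by positivity)).trans h8
  have h5 : Λ ^ 2 * ∑ j, ∫ z in Ω, χ z * ‖u j z‖ ^ 2
      ≤ n * (θ * Q) + Λ ^ 4 * C₂ / (4 * θ) * sobolevNegOneSq u := by
    rw [Finset.mul_sum]
    refine (Finset.sum_le_sum fun j _ => h4 j).trans (le_of_eq ?_)
    rw [Finset.sum_add_distrib, ← Finset.mul_sum, Finset.sum_const, Finset.card_univ,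
      Fintype.card_fin, nsmul_eq_mul, sobolevNegOneSq, ← Finset.mul_sum]
    ring
  have h6 : n * (θ * Q) ≤ ε / 2 * Q := by
    rw [← mul_assoc]
    refine mul_le_mul_of_nonneg_right ?_ hQ
    have : ε / 2 = (n + 1) * θ := by simp only [θ]; field_simp
    rw [this]
    gcongr
    linarith
  have h7 : 0 ≤ sobolevNegOneSq u := Finset.sum_nonneg fun _ _ => sq_nonneg _
  linarith

end Main

end

/-! ### The theorem. -/

theorem mainTheorem8 (n : ℕ) (Ω : Set (Cn n)) (hΩ : IsSmoothBoundedPseudoconvexDomain Ω)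
    (r : Cn n → ℝ) (hr : IsSmoothDefiningFunction Ω r) (hpsh : IsPlurisubharmonicOn r Ω) :
    IsAllowableMatrix Ω (fun z => (complexHessian r z).transpose) := by
  refine ⟨?_, fun ε hε => ?_⟩
  · obtain ⟨⟨U, hU, hcl, hs, -⟩, -⟩ := hr
    exact ⟨U, hU, hcl, fun j k => contDiffOn_complexHessian hU hs k j⟩
  · obtain ⟨C, hC, h⟩ :=
      (hr.isDefining hΩ.isOpen hΩ.isBounded).compactness_estimate hpsh hΩ.isBounded hε
    refine ⟨C, hC, fun u hu hu' => ?_⟩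
    refine h u _ ?_ hu'
    rw [← dbar1_graph hΩ.isOpen]
    exact (dbar1 Ω).mem_graph ⟨u, hu⟩
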